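/- Let $M$ be a smooth (Hausdorff, second countable) manifold of dimension $n$ without boundary, and let $X$ be a smooth vector field on $M$ with a strictly positive source at $p\in M$. This means that $X(p)=0$ and that all eigenvalues of the linearization $\nabla X|_p\in\mathrm{End}(T_pM)$ have strictly positive real part; the linearization is formed with any connection on $TM$ and, because $X(p)=0$, does not depend on it. Here and below, the eigenvalues of an endomorphism of a finite-dimensional vector space are the complex roots of its characteristic polynomial, repeated according to algebraic multiplicity. Let $U\subseteq M$ be an open neighbourhood of $p$ that is star-shaped around $p$ with respect to $X$: for every $q\in U$ the flow line $\Phi_t(q)$ of $X$ exists for all $t\le 0$, stays in $U$ for all $t\le 0$, and satisfies $\lim_{t\to-\infty}\Phi_t(q)=p$. Let $\mathcal V\to M$ be a smooth complex vector bundle of rank $m$ with a smooth (complex linear) connection $\nabla$, let $A$ be a smooth section of $\mathrm{End}(\mathcal V)$, and consider $\nabla_X+A$ as a linear operator on the space $\Gamma^\infty(U,\mathcal V)$ of smooth sections of $\mathcal V$ over $U$. Let $\mu_1,\dots,\mu_n$ be the eigenvalues of $\nabla X|_p$ and $\rho_1,\dots,\rho_m$ the eigenvalues of $A(p)$, each repeated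 with multiplicity. A number $\lambda\in\mathbb C$ is an eigenvalue of $\nabla_X+A$ (i.e. $(\nabla_X+A)u=\lambda u$ has a solution $u\ne 0$ in $\Gamma^\infty(U,\mathcal V)$) if and only if $$\lambda=\alpha_1\mu_1+\dots+\alpha_n\mu_n+\rho_j$$ for some multi-index $\alpha\in\mathbb N_0^n$ and some $1\le j\le m$. In this case $$1\le\dim_{\mathbb C}\ker(\nabla_X+A-\lambda)\le m(\lambda)<\infty,$$ where $m(\lambda)$ is the number of pairs $(\alpha,j)\in\mathbb N_0^n\times\{1,\dots,m\}$ with $\lambda=\alpha_1\mu_1+\dots+\alpha_n\mu_n+\rho_j$. -/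

import Mathlib

open Bundle Set Filter Topology
open scoped Manifold ContDiff

noncomputable section

section Linearization

variable {E : Type*} [NormedAddCommGroup E] [NormedSpace ℝ E] [FiniteDimensional ℝ E]
  {M : Type*} [TopologicalSpace M] [ChartedSpace E M] [IsManifold 𝓘(ℝ, E) ∞ M]

/-- The linearization `∇X|_p ∈ End(T_p M)`, `v ↦ ∇_v X`, of a vector field `X` at `p`, formed with
a connection `∇` on the tangent bundle. (If `X p = 0` it does not depend on the connection.) -/
def linearizationAt (nabla : CovariantDerivative 𝓘(ℝ, E) E (TangentSpace 𝓘(ℝ, E) : M → Type _))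
    (X : Π x : M, TangentSpace 𝓘(ℝ, E) x) (p : M) :
    TangentSpace 𝓘(ℝ, E) p →L[ℝ] TangentSpace 𝓘(ℝ, E) p :=
  nabla X p

instance tangentSpace_moduleFinite (p : M) : Module.Finite ℝ (TangentSpace 𝓘(ℝ, E) p) :=
  inferInstanceAs (Module.Finite ℝ E)

/-- The eigenvalues of the linearization of `X` at `p`: the complex roots of its characteristic
polynomial, with algebraic multiplicity. -/
def linearizationEigenvalues
    (nabla : CovariantDerivative 𝓘(ℝ, E) E (TangentSpace 𝓘(ℝ, E) : M → Type _))
    (X : Π x : M, TangentSpace 𝓘(ℝ, E) x) (p : M) : Multiset ℂ :=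
  (LinearMap.charpoly (linearizationAt nabla X p).toLinearMap).aroots ℂ

/-- `p` is a strictly positive source of `X`: `X` vanishes at `p`, and all eigenvalues of the
linearization of `X` at `p` have strictly positive real part. -/
structure IsStrictlyPositiveSource
    (nabla : CovariantDerivative 𝓘(ℝ, E) E (TangentSpace 𝓘(ℝ, E) : M → Type _))
    (X : Π x : M, TangentSpace 𝓘(ℝ, E) x) (p : M) : Prop where
  apply_eq_zero : X p = 0
  re_pos : ∀ z ∈ linearizationEigenvalues nabla X p, 0 < z.re

/-- The open set `U` is a neighbourhood of `p` which is star-shaped around `p` with respect to `X`: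
for every `q ∈ U` the integral curve of `X` through `q` exists for all times `t ≤ 0`, stays in `U`
for these times, and converges to `p` as `t → -∞`. -/
structure IsStarShapedAround (X : Π x : M, TangentSpace 𝓘(ℝ, E) x) (p : M)
    (U : TopologicalSpace.Opens M) : Prop where
  mem : p ∈ U
  flow : ∀ q ∈ U, ∃ γ : ℝ → M, γ 0 = q ∧ IsMIntegralCurveOn (I := 𝓘(ℝ, E)) γ X (Iic 0) ∧
    (∀ t ≤ 0, γ t ∈ U) ∧ Tendsto γ atBot (𝓝 p)

end Linearization

/-- The fibres of a complex vector bundle with finite-dimensional typical fibre `F` are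
finite-dimensional. -/
theorem moduleFinite_fiber {M : Type*} [TopologicalSpace M]
    (F : Type*) [NormedAddCommGroup F] [NormedSpace ℂ F] [FiniteDimensional ℂ F]
    {V : M → Type*} [TopologicalSpace (TotalSpace F V)]
    [∀ x, AddCommGroup (V x)] [∀ x, Module ℂ (V x)] [∀ x, TopologicalSpace (V x)]
    [FiberBundle F V] [VectorBundle ℂ F V] (p : M) : Module.Finite ℂ (V p) :=
  Module.Finite.equiv ((trivializationAt F V p).continuousLinearEquivAt ℂ p
    (mem_baseSet_trivializationAt F V p)).symm.toLinearEquiv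

/-! Throughout the next section, `V` is a smooth complex vector bundle with typical fibre `F` over
the real manifold `M`: the local trivializations are complex linear on the fibres
(`VectorBundle ℂ F V`) and their coordinate changes are smooth over the real manifold `M`
(`ContMDiffVectorBundle ∞ F V 𝓘(ℝ, E)`, where `F` and the fibres carry the underlying real
structure). -/

section Operator

set_option linter.unusedSectionVars false

variable {E : Type*} [NormedAddCommGroup E] [NormedSpace ℝ E] [FiniteDimensional ℝ E]
  {M : Type*} [TopologicalSpace M] [ChartedSpace E M] [IsManifold 𝓘(ℝ, E) ∞ M]
  (F : Type*) [NormedAddCommGroup F] [NormedSpace ℂ F] [FiniteDimensional ℂ F]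
  (V : M → Type*) [TopologicalSpace (TotalSpace F V)]
  [∀ x, AddCommGroup (V x)] [∀ x, Module ℂ (V x)] [∀ x, TopologicalSpace (V x)]
  [∀ x, IsTopologicalAddGroup (V x)] [∀ x, ContinuousSMul ℝ (V x)]
  [FiberBundle F V] [VectorBundle ℂ F V] [VectorBundle ℝ F V]

variable (E) in
/-- A smooth connection on the complex vector bundle `V`: a smooth covariant derivative which is
complex linear. -/
structure ComplexConnection extends CovariantDerivative 𝓘(ℝ, E) F V where
  smooth : CovariantDerivative.ContMDiffCovariantDerivative toCovariantDerivative ∞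
  map_smul : ∀ (c : ℂ) (σ : Π x, V x) (x : M),
    MDifferentiableAt 𝓘(ℝ, E) (𝓘(ℝ, E).prod 𝓘(ℝ, F)) (fun y ↦ TotalSpace.mk' F y (σ y)) x →
    ∀ v : TangentSpace 𝓘(ℝ, E) x, toFun (c • σ) x v = c • toFun σ x v

variable (E) in
/-- A smooth section of the bundle `End(V)` of complex linear endomorphisms of `V`. -/
structure SmoothEndomorphismField where
  toFun : Π x, V x →L[ℂ] V x
  smooth : ContMDiff 𝓘(ℝ, E) (𝓘(ℝ, E).prod 𝓘(ℝ, F →L[ℝ] F)) ∞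
    (fun x ↦ TotalSpace.mk' (F →L[ℝ] F) (E := fun x ↦ V x →L[ℝ] V x) x
      ((toFun x).restrictScalars ℝ))

variable {V}

/-- The eigenvalues of an endomorphism of the fibre of `V` at `p`: the roots of its characteristic
polynomial, with algebraic multiplicity. -/
def fiberEigenvalues {p : M} (B : V p →L[ℂ] V p) : Multiset ℂ :=
  haveI := moduleFinite_fiber F (V := V) p
  (LinearMap.charpoly B.toLinearMap).roots

open Classical in
/-- Extension by zero of a section over `U` to all of `M`. -/
def extendByZero {U : TopologicalSpace.Opens M} (s : Π x : U, V x) : Π x : M, V x :=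
  fun x ↦ if h : x ∈ U then s ⟨x, h⟩ else 0

theorem extendByZero_apply {U : TopologicalSpace.Opens M} (s : Π x : U, V x) (x : U) :
    extendByZero s (x : M) = s x := by
  simp [extendByZero]

theorem extendByZero_add {U : TopologicalSpace.Opens M} (s t : Π x : U, V x) :
    extendByZero (s + t) = extendByZero s + extendByZero t := by
  funext x
  by_cases h : x ∈ U <;> simp [extendByZero, h]

theorem extendByZero_smul {U : TopologicalSpace.Opens M} (c : ℂ) (s : Π x : U, V x) :
    extendByZero (c • s) = c • extendByZero s := by
  funext x
  by_cases h : x ∈ U <;> simp [extendByZero, h]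

theorem contMDiffOn_const_smul_section {U : Set M} {s : Π x : M, V x} (c : ℂ)
    (hs : ContMDiffOn 𝓘(ℝ, E) (𝓘(ℝ, E).prod 𝓘(ℝ, F)) ∞ (fun x ↦ TotalSpace.mk' F x (s x)) U) :
    ContMDiffOn 𝓘(ℝ, E) (𝓘(ℝ, E).prod 𝓘(ℝ, F)) ∞
      (fun x ↦ TotalSpace.mk' F x ((c • s) x)) U := by
  intro x₀ hx₀
  have h := hs x₀ hx₀
  rw [contMDiffWithinAt_section] at h ⊢
  have hL : ContMDiff 𝓘(ℝ, F) 𝓘(ℝ, F) ∞ (fun y : F ↦ c • y) :=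
    (contDiff_const_smul c).contMDiff
  refine (hL.contMDiffAt.comp_contMDiffWithinAt x₀ h).congr_of_eventuallyEq ?_ ?_
  · filter_upwards [mem_nhdsWithin_of_mem_nhds
      ((trivializationAt F V x₀).open_baseSet.mem_nhds
        (mem_baseSet_trivializationAt F V x₀))] with x hx
    exact ((trivializationAt F V x₀).linear ℂ hx).2 c (s x)
  · exact ((trivializationAt F V x₀).linear ℂ (mem_baseSet_trivializationAt F V x₀)).2 c (s x₀)

variable (E) (V) in
/-- The complex vector space `Γ^∞(U, V)` of smooth sections of `V` over the open set `U`. -/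
def smoothSections (U : TopologicalSpace.Opens M) : Submodule ℂ (Π x : U, V x) where
  carrier := {s | ContMDiffOn 𝓘(ℝ, E) (𝓘(ℝ, E).prod 𝓘(ℝ, F)) ∞
    (fun x ↦ TotalSpace.mk' F x (extendByZero s x)) U}
  add_mem' {s t} hs ht := by
    rw [mem_ofPred_eq, extendByZero_add]
    exact ContMDiffOn.add_section hs ht
  zero_mem' := by
    have h : extendByZero (0 : Π x : U, V x) = 0 := by
      funext x
      by_cases h : x ∈ U <;> simp [extendByZero, h]
    rw [mem_ofPred_eq, h]
    exact contMDiffOn_zeroSection ℝ V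
  smul_mem' c s hs := by
    rw [mem_ofPred_eq, extendByZero_smul]
    exact contMDiffOn_const_smul_section F c hs

variable {F}

theorem mdifferentiableAt_extendByZero {U : TopologicalSpace.Opens M}
    (s : smoothSections E F V U) (x : U) :
    MDifferentiableAt 𝓘(ℝ, E) (𝓘(ℝ, E).prod 𝓘(ℝ, F))
      (fun y ↦ TotalSpace.mk' F y (extendByZero s.1 y)) (x : M) :=
  ((s.2 x x.2).contMDiffAt (U.isOpen.mem_nhds x.2)).mdifferentiableAt (by simp)

/-- `(∇_X + A) s`, as a (not yet smooth) section over `U`. -/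
def transportFun (nabla : ComplexConnection E F V) (X : Π x : M, TangentSpace 𝓘(ℝ, E) x)
    (A : SmoothEndomorphismField E F V) {U : TopologicalSpace.Opens M} (s : Π x : U, V x) :
    Π x : U, V x :=
  fun x ↦ nabla.toFun (extendByZero s) x (X x) + A.toFun x (s x)

theorem transportFun_mem [T2Space M] (nabla : ComplexConnection E F V)
    {X : Π x : M, TangentSpace 𝓘(ℝ, E) x}
    (hX : ContMDiff 𝓘(ℝ, E) 𝓘(ℝ, E).tangent ∞ (fun x ↦ (⟨x, X x⟩ : TangentBundle 𝓘(ℝ, E) M)))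
    (A : SmoothEndomorphismField E F V) {U : TopologicalSpace.Opens M}
    (s : smoothSections E F V U) :
    transportFun nabla X A s.1 ∈ smoothSections E F V U := by
  intro x hx
  have hU := U.isOpen.mem_nhds hx
  obtain ⟨f, -, hf⟩ := (SmoothBumpFunction.nhds_basis_tsupport (I := 𝓘(ℝ, E)) x).mem_iff.1 hU
  set t : Π x : M, V x := (f : M → ℝ) • extendByZero s.1 with ht
  have hts : ContMDiff 𝓘(ℝ, E) (𝓘(ℝ, E).prod 𝓘(ℝ, F)) ∞ (fun y ↦ TotalSpace.mk' F y (t y)) :=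
    ContMDiffOn.smul_section_of_tsupport (𝕜 := ℝ) f.contMDiff.contMDiffOn U.isOpen hf s.2
  have h1 := nabla.smooth.contMDiff.contMDiff (σ := t) (by simpa using! hts.contMDiffOn)
  have h2 := (h1.contMDiffAt (x := x) univ_mem).clm_bundle_apply (hX x)
  have h3 := ((A.smooth x).clm_bundle_apply ((s.2 x hx).contMDiffAt hU))
  refine ((h2.add_section h3).congr_of_eventuallyEq ?_).contMDiffWithinAt
  filter_upwards [eventually_eventually_nhds.2 f.eventuallyEq_one, hU] with y hy hyU
  have h4 : nabla.toFun (extendByZero s.1) y = nabla.toFun t y := by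
    refine nabla.isCovariantDerivativeOnUniv.congr_of_eventuallyEq
      (mdifferentiableAt_extendByZero s ⟨y, hyU⟩) (hts.mdifferentiableAt (by simp)) univ_mem ?_
    filter_upwards [hy] with z hz
    simp [ht, hz]
  have h5 : extendByZero (transportFun nabla X A s.1) y =
      nabla.toFun t y (X y) + A.toFun y (extendByZero s.1 y) := by
    rw [← h4, extendByZero_apply _ ⟨y, hyU⟩, extendByZero_apply _ ⟨y, hyU⟩]
    rfl
  simp only [h5]
  rfl

/-- The operator `∇_X + A` on the space `Γ^∞(U, V)` of smooth sections over `U`. -/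
def transportOperator [T2Space M] (nabla : ComplexConnection E F V)
    (X : Π x : M, TangentSpace 𝓘(ℝ, E) x)
    (hX : ContMDiff 𝓘(ℝ, E) 𝓘(ℝ, E).tangent ∞ (fun x ↦ (⟨x, X x⟩ : TangentBundle 𝓘(ℝ, E) M)))
    (A : SmoothEndomorphismField E F V) (U : TopologicalSpace.Opens M) :
    Module.End ℂ (smoothSections E F V U) where
  toFun s := ⟨transportFun nabla X A s.1, transportFun_mem nabla hX A s⟩
  map_add' s t := by
    ext x
    have h := nabla.isCovariantDerivativeOnUniv.add (mdifferentiableAt_extendByZero s x)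
      (mdifferentiableAt_extendByZero t x)
    simp only [transportFun, Submodule.coe_add, extendByZero_add, Pi.add_apply, map_add, h,
      add_apply]
    abel
  map_smul' c s := by
    ext x
    have h := nabla.map_smul c _ x (mdifferentiableAt_extendByZero s x) (X x)
    simp only [transportFun, Submodule.coe_smul, extendByZero_smul, Pi.smul_apply, map_smul, h,
      RingHom.id_apply, smul_add]

end Operator

/-- The representations `λ = α₁ μ₁ + ⋯ + αₙ μₙ + ρⱼ` of `lam`, i.e. the pairs `(α, j)` of a
multi-index `α ∈ ℕⁿ` and an index `j`. -/
def representations {n m : ℕ} (μ : Fin n → ℂ) (ρ : Fin m → ℂ) (lam : ℂ) :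
    Set ((Fin n → ℕ) × Fin m) :=
  {r | lam = ∑ i, (r.1 i : ℂ) * μ i + ρ r.2}

end

/-! In a chart centred at p and a trivialization of the bundle, the operator becomes `L u = Du(X) +
A u` with `X 0 = 0`. The proof studies the action of `L` on Taylor coefficients at 0 and then passes
from formal to smooth solutions.

Jets. Take a basis of the complexified tangent space in which DX(0) is triangular and a basis of the
fibre in which A(0) is triangular. Up to coefficients of smaller rank, `L` multiplies the Taylor
coefficient with index (α, j) by α·μ + ρ_j (`iterDeriv_fieldOp_apply_zero`,
`exists_isTriangular_fieldOp`). A formal solution of `L u = lam u` is therefore determined by its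
resonant coefficients, those with α·μ + ρ_j = lam. There are finitely many of them because all μ_i
have positive real part (`finite_resonant`).

Upper bound. If all resonant coefficients of an eigensection vanish, then it is flat at p. Backwards
in time the flow contracts exponentially towards p, while along a flow line the section solves a
linear equation with bounded coefficient. A flat solution thus vanishes near p on the flow line
(`SourceRegion.eq_zero_of_decay`), and then on all of it by uniqueness. So the eigenspace embeds in
the space of resonant coefficients (`LocalModel.eq_zero_of_jetCoord_eq_zero`). This gives the
dimension bound, and also that every eigenvalue has the stated form.

Existence. Start from a resonant index of maximal rank. No zero occurs on the diagonal beyond it, so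
for every N there is a polynomial u_N solving the equation up to O(‖x‖^(N+1))
(`IsTriangular.exists_eq`). Genuine solutions near 0 are the functions fixed by the transport
operators T : v ↦ R · (v ∘ φ), where φ is the backward flow for a short time and R is parallel
transport for the linear equation. As φ is a contraction, the powers of T decay geometrically on
functions vanishing to high order. Hence T^n u_N converges, by telescoping, to a limit v that does
not depend on N. The pair (v, Dv) is governed by an operator of the same kind, so the limit is C^k
for N large in terms of k, and therefore smooth (`exists_tendsto_weightedPullback`,
`FlowBox.exists_solution`). Since v - u_N = O(‖x‖^(N+1)), v is not zero. Finally, v is transported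
along the flow lines to all of U (`IsEigensectionOn.exists_extension_of_isStarShapedAround`).

Smooth dependence of flows on initial values is proved with the inverse function theorem on a Banach
space of curves (`exists_smooth_local_flow`). -/

noncomputable section

/-! ### Smoothness of composition operators on spaces of continuous functions -/

section Nemytskii

universe u

variable {K : Type*} [TopologicalSpace K] [CompactSpace K]

/-- Pointwise application of a continuous bilinear pairing to continuous functions, as a
continuous bilinear map. -/
def ContinuousMap.pairingCLM (K : Type*) [TopologicalSpace K] [CompactSpace K]
    {E G H : Type*} [NormedAddCommGroup E] [NormedSpace ℝ E]
    [NormedAddCommGroup G] [NormedSpace ℝ G] [NormedAddCommGroup H] [NormedSpace ℝ H]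
    (B : H →L[ℝ] E →L[ℝ] G) : C(K, H) →L[ℝ] C(K, E) →L[ℝ] C(K, G) :=
  LinearMap.mkContinuous₂
    (LinearMap.mk₂ ℝ (fun (A : C(K, H)) (h : C(K, E)) ↦
        (⟨fun s ↦ B (A s) (h s), by fun_prop⟩ : C(K, G)))
      (fun _ _ _ ↦ by ext; simp) (fun _ _ _ ↦ by ext; simp)
      (fun _ _ _ ↦ by ext; simp) (fun _ _ _ ↦ by ext; simp)) ‖B‖ (by
    intro A h
    rw [ContinuousMap.norm_le _ (by positivity)]
    intro s
    simp only [LinearMap.mk₂_apply, ContinuousMap.coe_mk]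
    refine (B.le_opNorm₂ _ _).trans ?_
    gcongr
    · exact A.norm_coe_le_norm s
    · exact h.norm_coe_le_norm s)

theorem ContinuousMap.pairingCLM_apply {E G H : Type*} [NormedAddCommGroup E] [NormedSpace ℝ E]
    [NormedAddCommGroup G] [NormedSpace ℝ G] [NormedAddCommGroup H] [NormedSpace ℝ H]
    (B : H →L[ℝ] E →L[ℝ] G) (A : C(K, H)) (h : C(K, E)) (s : K) :
    ContinuousMap.pairingCLM K B A h s = B (A s) (h s) := rfl

/-- The composition operator on continuous functions given by a continuously differentiable map is
differentiable. -/
theorem hasFDerivAt_postcomp {E G H : Type*} [NormedAddCommGroup E] [NormedSpace ℝ E]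
    [NormedAddCommGroup G] [NormedSpace ℝ G] [NormedAddCommGroup H] [NormedSpace ℝ H]
    (B : H →L[ℝ] E →L[ℝ] G) (v : C(E, G)) (v' : C(E, H))
    (hv : ∀ x, HasFDerivAt v (B (v' x)) x) (γ : C(K, E)) :
    HasFDerivAt (fun γ : C(K, E) ↦ v.comp γ) (ContinuousMap.pairingCLM K B (v'.comp γ)) γ := by
  rw [hasFDerivAt_iff_isLittleO_nhds_zero, Asymptotics.isLittleO_iff]
  intro c hc
  -- Continuity of composition with `v'` in the sup norm provides one δ for all `s` at once,
  -- although `v'` need not be uniformly continuous on `E`.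
  have hcont := (ContinuousMap.continuous_postcomp (X := K) v').continuousAt (x := γ)
  rw [Metric.continuousAt_iff] at hcont
  obtain ⟨δ, hδ, H⟩ := hcont (c / (‖B‖ + 1)) (by positivity)
  filter_upwards [Metric.ball_mem_nhds (0 : C(K, E)) hδ] with h hh
  rw [mem_ball_zero_iff] at hh
  rw [ContinuousMap.norm_le _ (by positivity)]
  intro s
  have hseg : ∀ x ∈ segment ℝ (γ s) (γ s + h s), ‖B (v' x) - B (v' (γ s))‖ ≤ c := by
    intro x hx
    rw [segment_eq_image'] at hx
    obtain ⟨θ, hθ, rfl⟩ := hx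
    have h1 : dist (γ + θ • h) γ < δ := by
      rw [dist_eq_norm, add_sub_cancel_left, norm_smul, Real.norm_of_nonneg hθ.1]
      exact (mul_le_of_le_one_left (norm_nonneg _) hθ.2).trans_lt hh
    have h2 := H h1
    rw [dist_eq_norm] at h2
    have h3 := (ContinuousMap.norm_coe_le_norm (v'.comp (γ + θ • h) - v'.comp γ) s).trans h2.le
    rw [← map_sub]
    refine (B.le_opNorm _).trans ?_
    have h4 : ‖v' (γ s + θ • (γ s + h s - γ s)) - v' (γ s)‖ ≤ c / (‖B‖ + 1) := by simpa using h3
    calc ‖B‖ * _ ≤ (‖B‖ + 1) * (c / (‖B‖ + 1)) := by gcongr; linarith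
      _ = c := by field_simp
  have key := (convex_segment (𝕜 := ℝ) (γ s)
    (γ s + h s)).norm_image_sub_le_of_norm_hasFDerivWithin_le'
    (f := v) (fun x _ ↦ (hv x).hasFDerivWithinAt) hseg
    (left_mem_segment ℝ _ _) (right_mem_segment ℝ _ _)
  rw [add_sub_cancel_left] at key
  refine le_trans (le_of_eq ?_) (key.trans (mul_le_mul_of_nonneg_left (h.norm_coe_le_norm s) hc.le))
  simp [ContinuousMap.pairingCLM_apply]

/-- The derivative of γ ↦ v ∘ γ is pairing with v' ∘ γ, a continuous linear function of the
composition operator of `v'`. One order of differentiability is gained over that operator. -/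
theorem contDiff_postcomp_succ {E G H : Type*} [NormedAddCommGroup E] [NormedSpace ℝ E]
    [NormedAddCommGroup G] [NormedSpace ℝ G] [NormedAddCommGroup H] [NormedSpace ℝ H]
    (B : H →L[ℝ] E →L[ℝ] G) (v : C(E, G)) (v' : C(E, H))
    (hv : ∀ x, HasFDerivAt v (B (v' x)) x) {k : ℕ}
    (hk : ContDiff ℝ k (fun γ : C(K, E) ↦ v'.comp γ)) :
    ContDiff ℝ (k + 1) (fun γ : C(K, E) ↦ v.comp γ) := by
  have hd := hasFDerivAt_postcomp (K := K) B v v' hv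
  rw [contDiff_succ_iff_fderiv]
  refine ⟨fun γ ↦ (hd γ).differentiableAt, by simp, ?_⟩
  have h2 : fderiv ℝ (fun γ : C(K, E) ↦ v.comp γ) =
      fun γ ↦ ContinuousMap.pairingCLM K B (v'.comp γ) := funext fun γ ↦ (hd γ).fderiv
  rw [h2]
  exact (ContinuousMap.pairingCLM K B).contDiff.comp hk

/-- The induction replaces `v` by its derivative and `G` by `E →L[ℝ] G`; it stays in one universe
because `E` and `G` share theirs. -/
theorem contDiff_postcomp_nat (k : ℕ) {E G : Type u} [NormedAddCommGroup E] [NormedSpace ℝ E]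
    [NormedAddCommGroup G] [NormedSpace ℝ G] (v : E → G) (hv : ContDiff ℝ ∞ v) :
    ContDiff ℝ k (fun γ : C(K, E) ↦ (⟨v, hv.continuous⟩ : C(E, G)).comp γ) := by
  induction k generalizing G with
  | zero => exact contDiff_zero.2 (ContinuousMap.continuous_postcomp _)
  | succ k ih =>
    have hdv : ContDiff ℝ ∞ (fderiv ℝ v) := hv.fderiv_right (by simp)
    exact_mod_cast contDiff_postcomp_succ (ContinuousLinearMap.id ℝ (E →L[ℝ] G)) _ _
      (fun x ↦ (hv.differentiable (by simp) x).hasFDerivAt) (ih (fderiv ℝ v) hdv)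

/-- The composition operator on continuous functions given by a smooth map is smooth. -/
theorem contDiff_postcomp {E G : Type u} [NormedAddCommGroup E] [NormedSpace ℝ E]
    [NormedAddCommGroup G] [NormedSpace ℝ G] (v : C(E, G)) (hv : ContDiff ℝ ∞ v) :
    ContDiff ℝ ∞ (fun γ : C(K, E) ↦ v.comp γ) :=
  contDiff_infty.2 fun k ↦ contDiff_postcomp_nat k v hv

end Nemytskii

/-! ### Local flows depending smoothly on the initial value -/

section LocalFlow

set_option linter.unusedSectionVars false

variable {E : Type*} [NormedAddCommGroup E] [NormedSpace ℝ E] [CompleteSpace E]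

theorem neg_one_le_one_real : (-1 : ℝ) ≤ 1 := by norm_num

/-- The primitive vanishing at `0` of a continuous function on `[-1, 1]`. -/
def primitiveCLM (E : Type*) [NormedAddCommGroup E] [NormedSpace ℝ E] :
    C(Icc (-1 : ℝ) 1, E) →L[ℝ] C(Icc (-1 : ℝ) 1, E) :=
  LinearMap.mkContinuous
    { toFun := fun η ↦ ⟨fun s ↦ ∫ r in (0 : ℝ)..s, η.IccExtend neg_one_le_one_real r,
        (intervalIntegral.continuous_primitive
          (fun a b ↦ (η.IccExtend neg_one_le_one_real).continuous.intervalIntegrable a b) 0).comp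
          continuous_subtype_val⟩
      map_add' := fun η ζ ↦ by
        ext s
        exact intervalIntegral.integral_add
          ((η.IccExtend neg_one_le_one_real).continuous.intervalIntegrable _ _)
          ((ζ.IccExtend neg_one_le_one_real).continuous.intervalIntegrable _ _)
      map_smul' := fun c η ↦ by
        ext s
        exact intervalIntegral.integral_smul c _ } 1 (by
    intro η
    rw [ContinuousMap.norm_le _ (by positivity)]
    intro s
    have h := intervalIntegral.norm_integral_le_of_norm_le_const (a := 0) (b := (s : ℝ)) (C := ‖η‖)
      (f := η.IccExtend neg_one_le_one_real) (fun x _ ↦ η.norm_coe_le_norm _)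
    refine h.trans ?_
    rw [sub_zero, mul_comm]
    exact mul_le_mul_of_nonneg_right (abs_le.2 s.2) (norm_nonneg _))

theorem primitiveCLM_apply (η : C(Icc (-1 : ℝ) 1, E)) (s : Icc (-1 : ℝ) 1) :
    primitiveCLM E η s = ∫ r in (0 : ℝ)..s, η.IccExtend neg_one_le_one_real r := rfl

theorem ContinuousMap.IccExtend_apply_of_mem {a b : ℝ} (h : a ≤ b) {X : Type*} [TopologicalSpace X]
    (η : C(Icc a b, X)) {t : ℝ} (ht : t ∈ Icc a b) : η.IccExtend h t = η ⟨t, ht⟩ :=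
  Set.IccExtend_of_mem h η ht

/-- The embedding of `E` in the space of `E`-valued functions on `[-1, 1]` as constants. -/
def constCLM (E : Type*) [NormedAddCommGroup E] [NormedSpace ℝ E] :
    E →L[ℝ] C(Icc (-1 : ℝ) 1, E) :=
  LinearMap.mkContinuous
    { toFun := fun x ↦ ContinuousMap.const _ x
      map_add' := fun _ _ ↦ rfl
      map_smul' := fun _ _ ↦ rfl } 1 (by
    intro x
    rw [ContinuousMap.norm_le _ (by positivity)]
    intro s
    rw [one_mul]
    exact le_rfl)

theorem constCLM_apply (x : E) (s : Icc (-1 : ℝ) 1) : constCLM E x s = x := rfl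

/-- The map whose zeros in the last component are the integral curves of `τ • v` through `x`. -/
def flowEquation (v : C(E, E)) (y : (E × ℝ) × C(Icc (-1 : ℝ) 1, E)) :
    (E × ℝ) × C(Icc (-1 : ℝ) 1, E) :=
  (y.1, y.2 - constCLM E y.1.1 - y.1.2 • primitiveCLM E (v.comp y.2))

theorem contDiff_flowEquation (v : C(E, E)) (hv : ContDiff ℝ ∞ v) :
    ContDiff ℝ ∞ (flowEquation v) := by
  have h1 : ContDiff ℝ ∞ (fun y : (E × ℝ) × C(Icc (-1 : ℝ) 1, E) ↦ v.comp y.2) :=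
    (contDiff_postcomp v hv).comp contDiff_snd
  have h2 := (primitiveCLM E).contDiff.comp h1 (n := ∞)
  have h3 := (constCLM E).contDiff.comp
    (contDiff_fst.comp (contDiff_fst (𝕜 := ℝ) (E := E × ℝ) (F := C(Icc (-1 : ℝ) 1, E)))) (n := ∞)
  exact contDiff_fst.prodMk ((contDiff_snd.sub h3).sub
    ((contDiff_snd.comp contDiff_fst).smul h2))

/-- The derivative of `flowEquation v` at parameter `0`, a shear. -/
def flowEquationDeriv (e : C(Icc (-1 : ℝ) 1, E)) :
    ((E × ℝ) × C(Icc (-1 : ℝ) 1, E)) ≃L[ℝ] ((E × ℝ) × C(Icc (-1 : ℝ) 1, E)) :=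
  let S : E × ℝ →L[ℝ] C(Icc (-1 : ℝ) 1, E) :=
    (constCLM E).comp (ContinuousLinearMap.fst ℝ E ℝ) +
      (ContinuousLinearMap.snd ℝ E ℝ).smulRight e
  ContinuousLinearEquiv.equivOfInverse
    ((ContinuousLinearMap.fst ℝ _ _).prod
      (ContinuousLinearMap.snd ℝ _ _ - S.comp (ContinuousLinearMap.fst ℝ _ _)))
    ((ContinuousLinearMap.fst ℝ _ _).prod
      (ContinuousLinearMap.snd ℝ _ _ + S.comp (ContinuousLinearMap.fst ℝ _ _)))
    (fun y ↦ by ext1 <;> simp) (fun y ↦ by ext1 <;> simp)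

/-- At time parameter 0 the integral term carries the factor 0, so it contributes to the derivative
only in the direction of the time parameter. What remains is the identity minus a map from the
parameters to the curves, hence a shear, and no smallness assumption on `v` is needed to invert it.
-/
theorem hasFDerivAt_flowEquation (v : C(E, E)) (hv : ContDiff ℝ ∞ v) (x₀ : E) :
    HasFDerivAt (flowEquation v)
      (flowEquationDeriv (primitiveCLM E (v.comp (constCLM E x₀))) :
        ((E × ℝ) × C(Icc (-1 : ℝ) 1, E)) →L[ℝ] ((E × ℝ) × C(Icc (-1 : ℝ) 1, E)))
      ((x₀, 0), constCLM E x₀) := by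
  set y₀ : (E × ℝ) × C(Icc (-1 : ℝ) 1, E) := ((x₀, 0), constCLM E x₀)
  have h1 : ContDiff ℝ ∞ (fun y : (E × ℝ) × C(Icc (-1 : ℝ) 1, E) ↦ primitiveCLM E (v.comp y.2)) :=
    (primitiveCLM E).contDiff.comp ((contDiff_postcomp v hv).comp contDiff_snd)
  have h2 := (h1.differentiable (by simp) y₀).hasFDerivAt
  have h3 : HasFDerivAt (fun y : (E × ℝ) × C(Icc (-1 : ℝ) 1, E) ↦ y.1.2)
      ((ContinuousLinearMap.snd ℝ E ℝ).comp (ContinuousLinearMap.fst ℝ _ _)) y₀ :=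
    ((ContinuousLinearMap.snd ℝ E ℝ).comp
      (ContinuousLinearMap.fst ℝ (E × ℝ) C(Icc (-1 : ℝ) 1, E))).hasFDerivAt
  have h4 : HasFDerivAt (fun y : (E × ℝ) × C(Icc (-1 : ℝ) 1, E) ↦ constCLM E y.1.1)
      ((constCLM E).comp ((ContinuousLinearMap.fst ℝ E ℝ).comp (ContinuousLinearMap.fst ℝ _ _)))
      y₀ := ((constCLM E).comp ((ContinuousLinearMap.fst ℝ E ℝ).comp
        (ContinuousLinearMap.fst ℝ (E × ℝ) C(Icc (-1 : ℝ) 1, E)))).hasFDerivAt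
  refine (hasFDerivAt_fst.prodMk ((hasFDerivAt_snd.sub h4).sub (h3.smul h2))).congr_fderiv ?_
  refine ContinuousLinearMap.ext fun y ↦ Prod.ext rfl ?_
  simp [flowEquationDeriv, y₀, sub_sub]

/-- A smooth vector field on a Banach space has a local flow depending smoothly on the initial
value. -/
theorem exists_smooth_local_flow (v : E → E) (hv : ContDiff ℝ ∞ v) (x₀ : E) :
    ∃ ε > 0, ∃ r > 0, ∃ Φ : ℝ → E → E,
      (∀ x ∈ Metric.ball x₀ r, Φ 0 x = x) ∧
      (∀ x ∈ Metric.ball x₀ r, ∀ t ∈ Ioo (-ε) ε, HasDerivAt (fun t ↦ Φ t x) (v (Φ t x)) t) ∧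
      (∀ t ∈ Ioo (-ε) ε, ContDiffOn ℝ ∞ (Φ t) (Metric.ball x₀ r)) ∧
      ContinuousOn (Function.uncurry Φ) (Ioo (-ε) ε ×ˢ Metric.ball x₀ r) := by
  let w : C(E, E) := ⟨v, hv.continuous⟩
  have hw : ContDiff ℝ ∞ w := hv
  have hG := contDiff_flowEquation w hw
  have hG' := hasFDerivAt_flowEquation w hw x₀
  set y₀ : (E × ℝ) × C(Icc (-1 : ℝ) 1, E) := ((x₀, 0), constCLM E x₀) with hy₀
  let e := hG.contDiffAt.toOpenPartialHomeomorph (flowEquation w) hG' (by simp)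
  have he : ∀ y, e y = flowEquation w y := fun _ ↦ rfl
  have hmem : y₀ ∈ e.source := hG.contDiffAt.mem_toOpenPartialHomeomorph_source hG' (by simp)
  have hval : e y₀ = ((x₀, 0), 0) := by
    rw [he]
    simp [flowEquation, hy₀]
  -- the set where the derivative is invertible
  have hinv : ∀ᶠ y in 𝓝 y₀, fderiv ℝ (flowEquation w) y ∈
      range ((↑) : (((E × ℝ) × C(Icc (-1 : ℝ) 1, E)) ≃L[ℝ] ((E × ℝ) × C(Icc (-1 : ℝ) 1, E))) →
        ((E × ℝ) × C(Icc (-1 : ℝ) 1, E)) →L[ℝ] ((E × ℝ) × C(Icc (-1 : ℝ) 1, E))) := by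
    have hc : ContinuousAt (fderiv ℝ (flowEquation w)) y₀ :=
      (hG.continuous_fderiv (by simp)).continuousAt
    refine hc ?_
    rw [hG'.fderiv]
    exact ContinuousLinearEquiv.nhds _
  have htar : ∀ᶠ z in 𝓝 (((x₀, 0), 0) : (E × ℝ) × C(Icc (-1 : ℝ) 1, E)), z ∈ e.target ∧
      ContDiffAt ℝ ∞ e.symm z := by
    have h1 : e.target ∈ 𝓝 (((x₀, 0), 0) : (E × ℝ) × C(Icc (-1 : ℝ) 1, E)) := by
      rw [← hval]
      exact e.open_target.mem_nhds (e.map_source hmem)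
    have h2 : Tendsto e.symm (𝓝 (((x₀, 0), 0) : (E × ℝ) × C(Icc (-1 : ℝ) 1, E))) (𝓝 y₀) := by
      rw [← hval]
      exact e.tendsto_symm hmem
    filter_upwards [h1, h2.eventually hinv] with z hz hz'
    obtain ⟨f', hf'⟩ := hz'
    refine ⟨hz, e.contDiffAt_symm hz (f₀' := f') ?_ hG.contDiffAt⟩
    rw [hf']
    exact (hG.differentiable (by simp) _).hasFDerivAt
  rw [Metric.eventually_nhds_iff_ball] at htar
  obtain ⟨r, hr, hball⟩ := htar
  -- The time parameter is frozen at `r / 2`: positive, and small enough for the parameter point to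
  -- stay in the ball on which the inverse is smooth.
  have hin : ∀ x ∈ Metric.ball x₀ r, ((x, r / 2), 0) ∈
      Metric.ball (((x₀, 0), 0) : (E × ℝ) × C(Icc (-1 : ℝ) 1, E)) r := by
    intro x hx
    rw [Metric.mem_ball, Prod.dist_eq, Prod.dist_eq, max_lt_iff, max_lt_iff]
    refine ⟨⟨hx, ?_⟩, by simpa using hr⟩
    simp only [Real.dist_eq, sub_zero]
    rw [abs_of_pos (by positivity)]
    linarith
  set T : ℝ := r / 2 with hT
  have hTpos : 0 < T := by positivity
  -- `c x` is the integral curve of `T • v` through `x` on [-1, 1]. Run at speed `1 / T`, it becomes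
  -- an integral curve of `v` on (-T, T).
  let c : E → C(Icc (-1 : ℝ) 1, E) := fun x ↦ (e.symm ((x, T), 0)).2
  have hc : ∀ x ∈ Metric.ball x₀ r,
      c x = constCLM E x + T • primitiveCLM E (w.comp (c x)) := by
    intro x hx
    have h1 := e.right_inv (hball _ (hin x hx)).1
    rw [he] at h1
    have h2 : (e.symm ((x, T), 0)).1 = (x, T) := congrArg Prod.fst h1
    have h3 := congrArg Prod.snd h1
    simp only [flowEquation, h2] at h3
    rw [sub_sub, sub_eq_zero] at h3
    exact h3
  have hcd : ContDiffOn ℝ ∞ c (Metric.ball x₀ r) := by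
    intro x hx
    have h1 := (hball _ (hin x hx)).2
    have h2 : ContDiffAt ℝ ∞ (fun x : E ↦ (((x, T), 0) : (E × ℝ) × C(Icc (-1 : ℝ) 1, E))) x :=
      (contDiffAt_id.prodMk contDiffAt_const).prodMk contDiffAt_const
    exact (contDiffAt_snd.comp x (h1.comp x h2)).contDiffWithinAt
  have hmemT : ∀ t ∈ Ioo (-T) T, t / T ∈ Icc (-1 : ℝ) 1 := by
    intro t ht
    rw [mem_Icc, le_div_iff₀ hTpos, div_le_one hTpos]
    exact ⟨by linarith [ht.1], ht.2.le⟩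
  have h0 : (0 : ℝ) ∈ Icc (-1 : ℝ) 1 := by norm_num
  refine ⟨T, hTpos, r, hr, fun t x ↦ (c x).IccExtend neg_one_le_one_real (t / T), ?_, ?_, ?_, ?_⟩
  · intro x hx
    simp only [zero_div]
    rw [ContinuousMap.IccExtend_apply_of_mem _ _ h0, hc x hx]
    simp [constCLM_apply, primitiveCLM_apply]
  · intro x hx t ht
    set f : ℝ → E := fun s ↦ (w.comp (c x)).IccExtend neg_one_le_one_real s with hf
    have hfc : Continuous f := ((w.comp (c x)).IccExtend neg_one_le_one_real).continuous
    have h1 := (hfc.integral_hasStrictDerivAt 0 (t / T)).hasDerivAt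
    have h2 : HasDerivAt (fun t ↦ t / T) (1 / T) t := (hasDerivAt_id t).div_const T
    have h3 := ((h1.scomp t h2).const_smul T).const_add x
    have h4 : T • (1 / T) • f (t / T) = v ((c x).IccExtend neg_one_le_one_real (t / T)) := by
      rw [smul_smul, mul_one_div_cancel hTpos.ne', one_smul]
      rfl
    rw [h4] at h3
    refine h3.congr_of_eventuallyEq ?_
    filter_upwards [Ioo_mem_nhds ht.1 ht.2] with s hs
    rw [ContinuousMap.IccExtend_apply_of_mem _ _ (hmemT s hs)]
    conv_lhs => rw [hc x hx]
    rfl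
  · intro t ht
    have h1 : ContDiff ℝ ∞ (fun η : C(Icc (-1 : ℝ) 1, E) ↦ η ⟨t / T, hmemT t ht⟩) :=
      (ContinuousMap.evalCLM ℝ (M := E) (⟨t / T, hmemT t ht⟩ : Icc (-1 : ℝ) 1)).contDiff
    refine (h1.comp_contDiffOn hcd).congr fun x _ ↦ ?_
    exact ContinuousMap.IccExtend_apply_of_mem _ _ (hmemT t ht)
  · have h1 : ContinuousOn (fun y : ℝ × E ↦
        (c y.2, projIcc (-1 : ℝ) 1 neg_one_le_one_real (y.1 / T)))
        (Ioo (-T) T ×ˢ Metric.ball x₀ r) := by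
      refine ContinuousOn.prodMk ?_ ?_
      · exact hcd.continuousOn.comp continuousOn_snd fun y hy ↦ hy.2
      · exact (continuous_projIcc.comp (continuous_fst.div_const T)).continuousOn
    have h2 : Continuous (fun z : C(Icc (-1 : ℝ) 1, E) × Icc (-1 : ℝ) 1 ↦ z.1 z.2) := by
      fun_prop
    exact h2.comp_continuousOn h1

end LocalFlow

/-! ### Flow and fundamental solution of a linear equation along it -/

section Transport

set_option linter.unusedSectionVars false

variable {E : Type*} [NormedAddCommGroup E] [NormedSpace ℝ E] [FiniteDimensional ℝ E]
  {F : Type*} [NormedAddCommGroup F] [NormedSpace ℝ F] [FiniteDimensional ℝ F]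

/-- Integral curves of a smooth vector field on a compact interval are determined by one value. -/
theorem eqOn_Icc_of_hasDerivWithinAt {X : E → E} (hX : ContDiff ℝ ∞ X) {f g : ℝ → E} {a b t₀ : ℝ}
    (ht₀ : t₀ ∈ Icc a b) (hf : ∀ t ∈ Icc a b, HasDerivWithinAt f (X (f t)) (Icc a b) t)
    (hg : ∀ t ∈ Icc a b, HasDerivWithinAt g (X (g t)) (Icc a b) t) (h : f t₀ = g t₀) :
    EqOn f g (Icc a b) := by
  have hfc : ContinuousOn f (Icc a b) := fun t ht ↦ (hf t ht).continuousWithinAt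
  have hgc : ContinuousOn g (Icc a b) := fun t ht ↦ (hg t ht).continuousWithinAt
  -- A smooth field is Lipschitz only on bounded sets; both curves stay in a common closed ball,
  -- which suffices for uniqueness.
  obtain ⟨R, hR⟩ := ((isCompact_Icc.image_of_continuousOn hfc).union
    (isCompact_Icc.image_of_continuousOn hgc)).isBounded.subset_closedBall (0 : E)
  have hfR : ∀ t ∈ Icc a b, f t ∈ Metric.closedBall (0 : E) R :=
    fun t ht ↦ hR (Or.inl (mem_image_of_mem f ht))
  have hgR : ∀ t ∈ Icc a b, g t ∈ Metric.closedBall (0 : E) R :=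
    fun t ht ↦ hR (Or.inr (mem_image_of_mem g ht))
  obtain ⟨K, hK⟩ := (hX.contDiffOn (s := Metric.closedBall (0 : E) R)).exists_lipschitzOnWith
    (by simp) (convex_closedBall _ _) (isCompact_closedBall _ _)
  have hright : EqOn f g (Icc t₀ b) := by
    refine ODE_solution_unique_of_mem_Icc_right (v := fun _ ↦ X)
      (s := fun _ ↦ Metric.closedBall (0 : E) R) (fun _ _ ↦ hK)
      (hfc.mono (Icc_subset_Icc_left ht₀.1)) ?_ ?_ (hgc.mono (Icc_subset_Icc_left ht₀.1)) ?_ ?_ h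
    · exact fun t ht ↦ (hf t ⟨ht₀.1.trans ht.1, ht.2.le⟩).mono_of_mem_nhdsWithin
        (mem_of_superset (Icc_mem_nhdsGE ht.2) (Icc_subset_Icc_left (ht₀.1.trans ht.1)))
    · exact fun t ht ↦ hfR t ⟨ht₀.1.trans ht.1, ht.2.le⟩
    · exact fun t ht ↦ (hg t ⟨ht₀.1.trans ht.1, ht.2.le⟩).mono_of_mem_nhdsWithin
        (mem_of_superset (Icc_mem_nhdsGE ht.2) (Icc_subset_Icc_left (ht₀.1.trans ht.1)))
    · exact fun t ht ↦ hgR t ⟨ht₀.1.trans ht.1, ht.2.le⟩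
  have hleft : EqOn f g (Icc a t₀) := by
    refine ODE_solution_unique_of_mem_Icc_left (v := fun _ ↦ X)
      (s := fun _ ↦ Metric.closedBall (0 : E) R) (fun _ _ ↦ hK)
      (hfc.mono (Icc_subset_Icc_right ht₀.2)) ?_ ?_ (hgc.mono (Icc_subset_Icc_right ht₀.2)) ?_ ?_ h
    · exact fun t ht ↦ (hf t ⟨ht.1.le, ht.2.trans ht₀.2⟩).mono_of_mem_nhdsWithin
        (mem_of_superset (Icc_mem_nhdsLE ht.1) (Icc_subset_Icc_right (ht.2.trans ht₀.2)))
    · exact fun t ht ↦ hfR t ⟨ht.1.le, ht.2.trans ht₀.2⟩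
    · exact fun t ht ↦ (hg t ⟨ht.1.le, ht.2.trans ht₀.2⟩).mono_of_mem_nhdsWithin
        (mem_of_superset (Icc_mem_nhdsLE ht.1) (Icc_subset_Icc_right (ht.2.trans ht₀.2)))
    · exact fun t ht ↦ hgR t ⟨ht.1.le, ht.2.trans ht₀.2⟩
  intro t ht
  rcases le_total t t₀ with h1 | h1
  · exact hleft ⟨ht.1, h1⟩
  · exact hright ⟨h1, ht.2⟩

/-- The local flow `Φ` of a vector field `X` on `E` near `x₀`, together with the fundamental
solution `P` of the linear equation `y' = a y` along the flow lines. -/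
structure LocalTransport (X : E → E) (a : E → F →L[ℝ] F) (x₀ : E) where
  ε : ℝ
  r : ℝ
  ε_pos : 0 < ε
  r_pos : 0 < r
  Φ : ℝ → E → E
  P : ℝ → E → F →L[ℝ] F
  Φ_zero : ∀ x ∈ Metric.ball x₀ r, Φ 0 x = x
  P_zero : ∀ x ∈ Metric.ball x₀ r, P 0 x = 1
  hasDerivAt_Φ : ∀ x ∈ Metric.ball x₀ r, ∀ t ∈ Ioo (-ε) ε,
    HasDerivAt (fun t ↦ Φ t x) (X (Φ t x)) t
  hasDerivAt_P : ∀ x ∈ Metric.ball x₀ r, ∀ t ∈ Ioo (-ε) ε,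
    HasDerivAt (fun t ↦ P t x) ((a (Φ t x)).comp (P t x)) t
  contDiffOn_Φ : ∀ t ∈ Ioo (-ε) ε, ContDiffOn ℝ ∞ (Φ t) (Metric.ball x₀ r)
  contDiffOn_P : ∀ t ∈ Ioo (-ε) ε, ContDiffOn ℝ ∞ (P t) (Metric.ball x₀ r)
  continuousOn_Φ : ContinuousOn (Function.uncurry Φ) (Ioo (-ε) ε ×ˢ Metric.ball x₀ r)

/-- The flow and the fundamental solution are the two components of the flow of the single smooth
field (X, a·P) on `E × End F`, started at (x, 1). Smoothness in `x` of both comes from the smooth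
local flow. -/
theorem exists_localTransport {X : E → E} (hX : ContDiff ℝ ∞ X) {a : E → F →L[ℝ] F}
    (ha : ContDiff ℝ ∞ a) (x₀ : E) : Nonempty (LocalTransport X a x₀) := by
  let V : E × (F →L[ℝ] F) → E × (F →L[ℝ] F) := fun y ↦ (X y.1, (a y.1).comp y.2)
  have hV : ContDiff ℝ ∞ V :=
    (hX.comp contDiff_fst).prodMk ((ha.comp contDiff_fst).clm_comp contDiff_snd)
  obtain ⟨ε, hε, r, hr, Ψ, h0, hd, hs, hc⟩ := exists_smooth_local_flow V hV (x₀, 1)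
  have hin : ∀ x ∈ Metric.ball x₀ r,
      ((x, 1) : E × (F →L[ℝ] F)) ∈ Metric.ball ((x₀, 1) : E × (F →L[ℝ] F)) r := by
    intro x hx
    rw [Metric.mem_ball, Prod.dist_eq, max_lt_iff]
    exact ⟨hx, by simpa using hr⟩
  have hi : ContDiffOn ℝ ∞ (fun x : E ↦ ((x, 1) : E × (F →L[ℝ] F))) (Metric.ball x₀ r) :=
    contDiffOn_id.prodMk contDiffOn_const
  exact ⟨{
    ε := ε
    r := r
    ε_pos := hε
    r_pos := hr
    Φ := fun t x ↦ (Ψ t (x, 1)).1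
    P := fun t x ↦ (Ψ t (x, 1)).2
    Φ_zero := fun x hx ↦ by rw [h0 _ (hin x hx)]
    P_zero := fun x hx ↦ by rw [h0 _ (hin x hx)]
    hasDerivAt_Φ := fun x hx t ht ↦ (hd _ (hin x hx) t ht).fst
    hasDerivAt_P := fun x hx t ht ↦ (hd _ (hin x hx) t ht).snd
    contDiffOn_Φ := fun t ht ↦ contDiff_fst.comp_contDiffOn ((hs t ht).comp hi hin)
    contDiffOn_P := fun t ht ↦ contDiff_snd.comp_contDiffOn ((hs t ht).comp hi hin)
    continuousOn_Φ := by
      refine continuous_fst.comp_continuousOn (hc.comp (f := fun y : ℝ × E ↦ (y.1, (y.2, 1))) ?_ ?_)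
      · fun_prop
      · exact fun y hy ↦ ⟨hy.1, hin _ hy.2⟩ }⟩

namespace LocalTransport

variable {X : E → E} {a : E → F →L[ℝ] F} {x₀ : E} (T : LocalTransport X a x₀)


theorem zero_mem : (0 : ℝ) ∈ Ioo (-T.ε) T.ε := ⟨by linarith [T.ε_pos], T.ε_pos⟩

/-- A curve following the flow, with a solution of the linear equation above it, is given by the
local transport. -/
theorem eq_of_hasDerivWithinAt (hX : ContDiff ℝ ∞ X) (ha : ContDiff ℝ ∞ a)
    {c : ℝ → E} {y : ℝ → F} {α β : ℝ} (hα : -T.ε < α) (hβ : β < T.ε) (h0 : (0 : ℝ) ∈ Icc α β)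
    (hx : c 0 ∈ Metric.ball x₀ T.r)
    (hc : ∀ t ∈ Icc α β, HasDerivWithinAt c (X (c t)) (Icc α β) t)
    (hy : ∀ t ∈ Icc α β, HasDerivWithinAt y (a (c t) (y t)) (Icc α β) t) {t : ℝ}
    (ht : t ∈ Icc α β) : c t = T.Φ t (c 0) ∧ y t = T.P t (c 0) (y 0) := by
  let V : E × F → E × F := fun z ↦ (X z.1, a z.1 z.2)
  have hV : ContDiff ℝ ∞ V :=
    (hX.comp contDiff_fst).prodMk ((ha.comp contDiff_fst).clm_apply contDiff_snd)
  have key := eqOn_Icc_of_hasDerivWithinAt hV (f := fun t ↦ (c t, y t))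
    (g := fun t ↦ (T.Φ t (c 0), T.P t (c 0) (y 0))) h0
    (fun t ht ↦ (hc t ht).prodMk (hy t ht)) (fun t ht ↦ ?_) ?_ ht
  · exact ⟨congrArg Prod.fst key, congrArg Prod.snd key⟩
  · have ht' : t ∈ Ioo (-T.ε) T.ε := ⟨hα.trans_le ht.1, ht.2.trans_lt hβ⟩
    have h1 := (T.hasDerivAt_Φ _ hx t ht').hasDerivWithinAt (s := Icc α β)
    have h2 := ((T.hasDerivAt_P _ hx t ht').clm_apply (hasDerivAt_const t (y 0))).hasDerivWithinAt
      (s := Icc α β)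
    exact (h1.prodMk h2).congr_deriv (by simp [V])
  · simp [T.Φ_zero _ hx, T.P_zero _ hx]

theorem uIcc_subset {s t : ℝ} (ht : t ∈ Ioo (-T.ε) T.ε) (hst : s + t ∈ Ioo (-T.ε) T.ε) {r : ℝ}
    (hr : r ∈ uIcc 0 s) : r + t ∈ Ioo (-T.ε) T.ε := by
  rcases le_total 0 s with h | h
  · rw [uIcc_of_le h] at hr
    exact ⟨by linarith [ht.1, hr.1], by linarith [hst.2, hr.2]⟩
  · rw [uIcc_of_ge h] at hr
    exact ⟨by linarith [hst.1, hr.1], by linarith [ht.2, hr.2]⟩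

/-- Group law of the flow and cocycle law of the fundamental solution: as functions of `s`, both
sides solve the same equation with the same value at `s = 0`. -/
theorem add_apply (hX : ContDiff ℝ ∞ X) (ha : ContDiff ℝ ∞ a) {x : E}
    (hx : x ∈ Metric.ball x₀ T.r) {s t : ℝ} (hs : s ∈ Ioo (-T.ε) T.ε) (ht : t ∈ Ioo (-T.ε) T.ε)
    (hst : s + t ∈ Ioo (-T.ε) T.ε) (hxt : T.Φ t x ∈ Metric.ball x₀ T.r) :
    T.Φ (s + t) x = T.Φ s (T.Φ t x) ∧
      ∀ y, T.P (s + t) x y = T.P s (T.Φ t x) (T.P t x y) := by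
  have h0 : (0 : ℝ) ∈ uIcc 0 s := left_mem_uIcc
  have hα : -T.ε < min 0 s := lt_min (by linarith [T.ε_pos]) hs.1
  have hβ : max 0 s < T.ε := max_lt T.ε_pos hs.2
  have hc0 : T.Φ (0 + t) x = T.Φ t x := by rw [zero_add]
  have main : ∀ y, T.Φ (s + t) x = T.Φ s (T.Φ t x) ∧
      T.P (s + t) x y = T.P s (T.Φ t x) (T.P t x y) := by
    intro y
    have key := T.eq_of_hasDerivWithinAt hX ha (c := fun r ↦ T.Φ (r + t) x)
      (y := fun r ↦ T.P (r + t) x y) hα hβ h0 (by simpa only [hc0] using hxt)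
      (fun r hr ↦ ?_) (fun r hr ↦ ?_) (right_mem_uIcc : s ∈ uIcc 0 s)
    · simpa only [zero_add] using key
    · exact ((T.hasDerivAt_Φ x hx _ (T.uIcc_subset ht hst hr)).comp_add_const r t).hasDerivWithinAt
    · exact (((T.hasDerivAt_P x hx _ (T.uIcc_subset ht hst hr)).comp_add_const r t).clm_apply
        (hasDerivAt_const r y)).hasDerivWithinAt.congr_deriv (by simp)
  exact ⟨(main 0).1, fun y ↦ (main y).2⟩

/-- A solution of the transport equation `Du(X) = a u` along a flow line is propagated by `P`. -/
theorem apply_eq_of_fderiv_eq (hX : ContDiff ℝ ∞ X) (ha : ContDiff ℝ ∞ a) {x : E}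
    (hx : x ∈ Metric.ball x₀ T.r) {u : E → F} {t : ℝ} (ht : t ∈ Ioo (-T.ε) T.ε)
    (hu : ∀ s ∈ uIcc 0 t, DifferentiableAt ℝ u (T.Φ s x) ∧
      fderiv ℝ u (T.Φ s x) (X (T.Φ s x)) = a (T.Φ s x) (u (T.Φ s x))) :
    u (T.Φ t x) = T.P t x (u x) := by
  have hα : -T.ε < min 0 t := lt_min (by linarith [T.ε_pos]) ht.1
  have hβ : max 0 t < T.ε := max_lt T.ε_pos ht.2
  have hs : ∀ s ∈ uIcc 0 t, s ∈ Ioo (-T.ε) T.ε := fun s hs ↦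
    ⟨hα.trans_le hs.1, hs.2.trans_lt hβ⟩
  have key := T.eq_of_hasDerivWithinAt hX ha (c := fun r ↦ T.Φ r x)
    (y := fun r ↦ u (T.Φ r x)) hα hβ left_mem_uIcc (by simpa only [T.Φ_zero x hx] using hx)
    (fun r hr ↦ (T.hasDerivAt_Φ x hx r (hs r hr)).hasDerivWithinAt) (fun r hr ↦ ?_)
    (right_mem_uIcc : t ∈ uIcc 0 t)
  · simpa only [T.Φ_zero x hx] using key.2
  · have h1 := (hu r hr).1.hasFDerivAt.comp_hasDerivAt r (T.hasDerivAt_Φ x hx r (hs r hr))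
    rw [(hu r hr).2] at h1
    exact h1.hasDerivWithinAt

/-- A function propagated by `P` along backward flow lines solves the transport equation. -/
theorem fderiv_eq_of_apply_eq {x : E} (hx : x ∈ Metric.ball x₀ T.r) {u : E → F}
    (hu : DifferentiableAt ℝ u x) {δ : ℝ} (hδ : 0 < δ)
    (h : ∀ s ∈ Icc 0 δ, u (T.Φ (-s) x) = T.P (-s) x (u x)) :
    fderiv ℝ u x (X x) = a x (u x) := by
  have hΦ0 := T.Φ_zero x hx
  have h1 : HasDerivAt (fun s : ℝ ↦ u (T.Φ s x)) (fderiv ℝ u x (X x)) 0 := by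
    have h2 := T.hasDerivAt_Φ x hx 0 T.zero_mem
    have hu' : HasFDerivAt u (fderiv ℝ u x) (T.Φ 0 x) := by rw [hΦ0]; exact hu.hasFDerivAt
    have h3 := hu'.comp_hasDerivAt 0 h2
    rwa [hΦ0] at h3
  have h2 : HasDerivAt (fun s : ℝ ↦ T.P s x (u x)) (a x (u x)) 0 := by
    have h3 := (T.hasDerivAt_P x hx 0 T.zero_mem).clm_apply (hasDerivAt_const 0 (u x))
    simpa [hΦ0, T.P_zero x hx] using h3
  -- The propagation law is available for backward times only, so the two derivatives at 0 are
  -- compared on the one-sided interval.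
  have h3 : HasDerivWithinAt (fun s : ℝ ↦ u (T.Φ s x)) (a x (u x)) (Icc (-δ) 0) 0 := by
    refine h2.hasDerivWithinAt.congr (fun s hs ↦ ?_) ?_
    · simpa using h (-s) ⟨by linarith [hs.2], by linarith [hs.1]⟩
    · simp [hΦ0, T.P_zero x hx]
  exact (uniqueDiffOn_Icc (by linarith) 0 ⟨by linarith, le_rfl⟩).eq_deriv _
    h1.hasDerivWithinAt h3

end LocalTransport

end Transport

/-! ### Weighted pullbacks by a contraction and smoothness of their Neumann series -/

section WeightedPullback

universe u v w

open Asymptotics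

set_option linter.unusedSectionVars false

variable {E : Type u} [NormedAddCommGroup E] [NormedSpace ℝ E] [FiniteDimensional ℝ E]

/-- If a smooth function vanishes to order `2 * M` at the origin, then its derivative vanishes to
order `M`. -/
theorem isBigO_fderiv_of_isBigO {G : Type w} [NormedAddCommGroup G] [NormedSpace ℝ G] {g : E → G}
    (hg : ContDiff ℝ ∞ g) {M : ℕ} (hM : 1 ≤ M)
    (h : g =O[𝓝 0] fun x ↦ ‖x‖ ^ (2 * M)) : fderiv ℝ g =O[𝓝 0] fun x ↦ ‖x‖ ^ M := by
  have hg' : ContDiff ℝ ∞ (fderiv ℝ g) := hg.fderiv_right (by simp)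
  obtain ⟨K, hK⟩ := (hg'.contDiffOn (s := Metric.closedBall (0 : E) 2)).exists_lipschitzOnWith
    (by simp) (convex_closedBall _ _) (isCompact_closedBall _ _)
  obtain ⟨C, hC0, hC⟩ := h.exists_nonneg
  have hC := hC.bound
  rw [Metric.eventually_nhds_iff_ball] at hC
  obtain ⟨δ, hδ, hCδ⟩ := hC
  have hbd : ∀ x : E, ‖x‖ < δ → ‖g x‖ ≤ C * ‖x‖ ^ (2 * M) := by
    intro x hx
    simpa using hCδ x (by simpa using hx)
  have hD0 : fderiv ℝ g 0 = 0 := by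
    have h1 : g =O[𝓝 0] fun x ↦ ‖x - 0‖ ^ (2 * M) := by simpa using h
    exact (h1.hasFDerivAt (by omega)).fderiv
  refine IsBigO.of_bound (C * 4 ^ M + C + K) ?_
  have hmin : 0 < min (δ / 2) 1 := lt_min (by positivity) one_pos
  filter_upwards [Metric.ball_mem_nhds (0 : E) hmin] with x hx
  rw [mem_ball_zero_iff, lt_min_iff] at hx
  rw [norm_pow, norm_norm]
  by_cases hx0 : x = 0
  · rw [hx0, hD0, norm_zero]
    positivity
  have hxpos : 0 < ‖x‖ := norm_pos_iff.2 hx0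
  -- Increments of length `ρ = ‖x‖ ^ M` balance the two errors: the values of `g` near `x` are O(ρ²)
  -- by hypothesis and the second order Taylor remainder is O(ρ²) as well. So the derivative applied
  -- to such an increment is O(ρ²), and its norm is O(ρ).
  set ρ : ℝ := ‖x‖ ^ M with hρ
  have hρpos : 0 < ρ := by positivity
  have hρx : ρ ≤ ‖x‖ := pow_le_of_le_one hxpos.le hx.2.le (by omega)
  refine ContinuousLinearMap.opNorm_le_bound _ (by positivity) fun y ↦ ?_
  by_cases hy0 : y = 0
  · simp [hy0]
  have hypos : 0 < ‖y‖ := norm_pos_iff.2 hy0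
  set k : E := (ρ / ‖y‖) • y with hk
  have hknorm : ‖k‖ = ρ := by
    rw [hk, norm_smul, Real.norm_of_nonneg (by positivity)]
    field_simp
  have hxk : ‖x + k‖ ≤ 2 * ‖x‖ := (norm_add_le _ _).trans (by rw [hknorm]; linarith)
  have htaylor : ‖g (x + k) - g x - fderiv ℝ g x k‖ ≤ K * ρ * ρ := by
    have hseg : ∀ z ∈ segment ℝ x (x + k), ‖fderiv ℝ g z - fderiv ℝ g x‖ ≤ K * ρ := by
      intro z hz
      have hz1 : ‖z - x‖ ≤ ρ := by
        rw [segment_eq_image'] at hz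
        obtain ⟨s, hs, rfl⟩ := hz
        simp only [add_sub_cancel_left, norm_smul, Real.norm_of_nonneg hs.1, hknorm]
        exact mul_le_of_le_one_left hρpos.le hs.2
      have hz2 : z ∈ Metric.closedBall (0 : E) 2 := by
        rw [mem_closedBall_zero_iff]
        calc ‖z‖ = ‖(z - x) + x‖ := by rw [sub_add_cancel]
          _ ≤ ‖z - x‖ + ‖x‖ := norm_add_le _ _
          _ ≤ 2 := by linarith
      have hx2 : x ∈ Metric.closedBall (0 : E) 2 := by
        rw [mem_closedBall_zero_iff]; linarith
      have := hK.dist_le_mul z hz2 x hx2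
      rw [dist_eq_norm, dist_eq_norm] at this
      exact this.trans (by gcongr)
    have key := (convex_segment (𝕜 := ℝ) x (x + k)).norm_image_sub_le_of_norm_hasFDerivWithin_le'
      (f := g) (fun z _ ↦ (hg.differentiable (by simp) z).hasFDerivAt.hasFDerivWithinAt) hseg
      (left_mem_segment ℝ _ _) (right_mem_segment ℝ _ _)
    rwa [add_sub_cancel_left, hknorm] at key
  have h1 : ‖g (x + k)‖ ≤ C * 4 ^ M * (ρ * ρ) := by
    refine (hbd _ (hxk.trans_lt (by linarith))).trans ?_
    calc C * ‖x + k‖ ^ (2 * M) ≤ C * (2 * ‖x‖) ^ (2 * M) := by gcongr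
      _ = C * 4 ^ M * (ρ * ρ) := by
        rw [hρ, mul_pow, pow_mul 2 2 M, two_mul M, pow_add]; ring
  have h2 : ‖g x‖ ≤ C * (ρ * ρ) := by
    refine (hbd _ (by linarith)).trans (le_of_eq ?_)
    rw [hρ, two_mul M, pow_add]
  have h3 : ‖fderiv ℝ g x k‖ ≤ (C * 4 ^ M + C + K) * ρ * ρ := by
    calc ‖fderiv ℝ g x k‖ = ‖(g (x + k) - g x) - (g (x + k) - g x - fderiv ℝ g x k)‖ := by
          rw [sub_sub_cancel]
      _ ≤ ‖g (x + k)‖ + ‖g x‖ + ‖g (x + k) - g x - fderiv ℝ g x k‖ :=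
          (norm_sub_le _ _).trans (by gcongr; exact norm_sub_le _ _)
      _ ≤ _ := by linarith
  have h4 : fderiv ℝ g x k = (ρ / ‖y‖) • fderiv ℝ g x y := by rw [hk, map_smul]
  rw [h4, norm_smul, Real.norm_of_nonneg (by positivity), div_mul_eq_mul_div,
    div_le_iff₀ hypos] at h3
  have h5 : ρ * ‖fderiv ℝ g x y‖ ≤ ρ * ((C * 4 ^ M + C + K) * ρ * ‖y‖) := by linarith
  exact le_of_mul_le_mul_left h5 hρpos

/-- The operator `v ↦ R · (v ∘ φ)` on vector valued functions. -/
def weightedPullback {G : Type w} [NormedAddCommGroup G] [NormedSpace ℝ G] (φ : E → E)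
    (R : E → G →L[ℝ] G) (v : E → G) : E → G := fun x ↦ R x (v (φ x))

section

variable {G : Type w} [NormedAddCommGroup G] [NormedSpace ℝ G] {φ : E → E} {R : E → G →L[ℝ] G}

theorem weightedPullback_iterate_succ (v : E → G) (n : ℕ) (x : E) :
    (weightedPullback φ R)^[n + 1] v x = R x ((weightedPullback φ R)^[n] v (φ x)) := by
  rw [Function.iterate_succ_apply']
  rfl

theorem contDiff_weightedPullback_iterate (hφ : ContDiff ℝ ∞ φ) (hR : ContDiff ℝ ∞ R) {g : E → G}
    (hg : ContDiff ℝ ∞ g) (n : ℕ) : ContDiff ℝ ∞ ((weightedPullback φ R)^[n] g) := by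
  induction n with
  | zero => exact hg
  | succ n ih =>
    rw [Function.iterate_succ_apply']
    exact hR.clm_apply (ih.comp hφ)

theorem norm_weightedPullback_iterate_le {O : Set E} (hφO : MapsTo φ O O) {C : ℝ} (hC : 0 ≤ C)
    (hR : ∀ x ∈ O, ‖R x‖ ≤ C) (g : E → G) (n : ℕ) {x : E} (hx : x ∈ O) :
    ‖(weightedPullback φ R)^[n] g x‖ ≤ C ^ n * ‖g (φ^[n] x)‖ := by
  induction n generalizing x with
  | zero => simp
  | succ n ih =>
    rw [weightedPullback_iterate_succ, Function.iterate_succ_apply, pow_succ', mul_assoc]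
    exact ((R x).le_opNorm _).trans
      (mul_le_mul (hR x hx) (ih (hφO hx)) (norm_nonneg _) hC)

theorem weightedPullback_iterate_add (g h : E → G) (n : ℕ) (x : E) :
    (weightedPullback φ R)^[n] (g + h) x =
      (weightedPullback φ R)^[n] g x + (weightedPullback φ R)^[n] h x := by
  induction n generalizing x with
  | zero => rfl
  | succ n ih => simp only [weightedPullback_iterate_succ, ih, map_add]

/-- Iterates of the weighted pullback by a contraction decay geometrically on functions vanishing
to sufficiently high order. -/
theorem exists_norm_weightedPullback_iterate_le {O : Set E} (hO : Bornology.IsBounded O)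
    (hφO : MapsTo φ O O) {C θ : ℝ} (hθ0 : 0 ≤ θ) (hθ1 : θ < 1)
    (hφ : ∀ n, ∀ x ∈ O, ‖φ^[n] x‖ ≤ C * θ ^ n) (hR : Continuous R) :
    ∃ N : ℕ, ∀ g : E → G, Continuous g → (g =O[𝓝 0] fun x ↦ ‖x‖ ^ N) →
      ∃ K, ∀ n, ∀ x ∈ O, ‖(weightedPullback φ R)^[n] g x‖ ≤ K * (1 / 2) ^ n := by
  obtain ⟨r, hr0, hr⟩ := hO.subset_closedBall_lt 0 (0 : E)
  obtain ⟨CR, hCR⟩ := ((isCompact_closedBall (0 : E) r).image hR).isBounded.exists_norm_le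
  have hRO : ∀ x ∈ O, ‖R x‖ ≤ max CR 1 := fun x hx ↦
    (hCR _ (mem_image_of_mem R (hr hx))).trans (le_max_left _ _)
  set C' := max CR 1
  have hC'pos : 0 < C' := one_pos.trans_le (le_max_right _ _)
  -- Each iteration costs a factor `C'` from the weight and gains `θ ^ N` on functions that are
  -- O(‖x‖ ^ N). `N` is chosen so that the product is at most 1/2.
  obtain ⟨N, hN⟩ := exists_pow_lt_of_lt_one (show 0 < 1 / 2 / C' by positivity) hθ1
  have hN' : C' * θ ^ N ≤ 1 / 2 := by
    rw [lt_div_iff₀ hC'pos] at hN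
    linarith
  refine ⟨N, fun g hg hgO ↦ ?_⟩
  obtain ⟨Cg, hCg0, hCg⟩ := hgO.exists_nonneg
  have hCg := hCg.bound
  rw [Metric.eventually_nhds_iff_ball] at hCg
  obtain ⟨δ, hδ, hCδ⟩ := hCg
  obtain ⟨Mg, hMg⟩ := ((isCompact_closedBall (0 : E) r).image hg).isBounded.exists_norm_le
  have hMg0 : 0 ≤ Mg := (norm_nonneg _).trans
    (hMg _ (mem_image_of_mem g (Metric.mem_closedBall_self hr0.le)))
  have hgbd : ∀ x ∈ O, ‖g x‖ ≤ (Cg + Mg / δ ^ N) * ‖x‖ ^ N := by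
    intro x hx
    by_cases hxδ : ‖x‖ < δ
    · have h1 : ‖g x‖ ≤ Cg * ‖x‖ ^ N := by simpa using hCδ x (by simpa using hxδ)
      refine h1.trans ?_
      gcongr
      have : 0 ≤ Mg / δ ^ N := by positivity
      linarith
    · rw [not_lt] at hxδ
      have h1 : δ ^ N ≤ ‖x‖ ^ N := by gcongr
      calc ‖g x‖ ≤ Mg := hMg _ (mem_image_of_mem g (hr hx))
        _ = Mg / δ ^ N * δ ^ N := by field_simp
        _ ≤ Mg / δ ^ N * ‖x‖ ^ N := by gcongr
        _ ≤ _ := by gcongr; linarith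
  have hφn : ∀ n, ∀ x ∈ O, φ^[n] x ∈ O := fun n x hx ↦ hφO.iterate n hx
  by_cases hOne : O.Nonempty
  swap
  · exact ⟨0, fun n x hx ↦ (hOne ⟨x, hx⟩).elim⟩
  obtain ⟨x₁, hx₁⟩ := hOne
  have hC0 : 0 ≤ C := by
    have := hφ 0 x₁ hx₁
    simp only [Function.iterate_zero, id, pow_zero, mul_one] at this
    exact (norm_nonneg _).trans this
  refine ⟨(Cg + Mg / δ ^ N) * C ^ N, fun n x hx ↦ ?_⟩
  calc ‖(weightedPullback φ R)^[n] g x‖ ≤ C' ^ n * ‖g (φ^[n] x)‖ :=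
        norm_weightedPullback_iterate_le hφO hC'pos.le hRO g n hx
    _ ≤ C' ^ n * ((Cg + Mg / δ ^ N) * (C * θ ^ n) ^ N) := by
        gcongr
        refine (hgbd _ (hφn n x hx)).trans ?_
        gcongr
        exact hφ n x hx
    _ = (Cg + Mg / δ ^ N) * C ^ N * (C' * θ ^ N) ^ n := by
        rw [mul_pow, mul_pow, ← pow_mul, ← pow_mul, mul_comm n N]; ring
    _ ≤ (Cg + Mg / δ ^ N) * C ^ N * (1 / 2) ^ n := by gcongr

/-- The weight of the pullback operator induced on pairs `(v, Dv)`. -/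
def prolongedWeight (φ : E → E) (R : E → G →L[ℝ] G) (x : E) :
    (G × (E →L[ℝ] G)) →L[ℝ] (G × (E →L[ℝ] G)) :=
  ((R x).comp (ContinuousLinearMap.fst ℝ _ _)).prod
    ((((ContinuousLinearMap.compL ℝ E E G).flip (fderiv ℝ φ x)).comp
      ((ContinuousLinearMap.compL ℝ E G G) (R x))).comp (ContinuousLinearMap.snd ℝ _ _) +
      ((fderiv ℝ R x).flip).comp (ContinuousLinearMap.fst ℝ _ _))

theorem prolongedWeight_apply (x : E) (y : G × (E →L[ℝ] G)) :
    prolongedWeight φ R x y =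
      (R x y.1, ((R x).comp y.2).comp (fderiv ℝ φ x) + (fderiv ℝ R x).flip y.1) := rfl

theorem contDiff_prolongedWeight [FiniteDimensional ℝ G] (hφ : ContDiff ℝ ∞ φ) (hR : ContDiff ℝ ∞ R) :
    ContDiff ℝ ∞ (prolongedWeight φ R) := by
  have hφ' : ContDiff ℝ ∞ (fderiv ℝ φ) := hφ.fderiv_right (by simp)
  have hR' : ContDiff ℝ ∞ (fderiv ℝ R) := hR.fderiv_right (by simp)
  rw [contDiff_clm_apply_iff]
  intro y
  simp only [prolongedWeight_apply]
  refine (hR.clm_apply contDiff_const).prodMk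
    (((hR.clm_comp contDiff_const).clm_comp hφ').add ?_)
  rw [contDiff_clm_apply_iff]
  intro z
  exact (hR'.clm_apply contDiff_const).clm_apply contDiff_const

/-- Product and chain rule: differentiating `R x (v (φ x))` yields an expression linear in the value
and the derivative of `v` at `φ x`. Differentiation thus stays within the class of weighted
pullbacks by the same `φ`, and a C^k statement for all weights can be proved by induction on k. -/
theorem weightedPullback_prolonged_iterate (hφ : ContDiff ℝ ∞ φ) (hR : ContDiff ℝ ∞ R) {g : E → G}
    (hg : ContDiff ℝ ∞ g) (n : ℕ) (x : E) :
    (weightedPullback φ (prolongedWeight φ R))^[n] (fun x ↦ (g x, fderiv ℝ g x)) x =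
      ((weightedPullback φ R)^[n] g x, fderiv ℝ ((weightedPullback φ R)^[n] g) x) := by
  induction n generalizing x with
  | zero => rfl
  | succ n ih =>
    rw [weightedPullback_iterate_succ, ih, prolongedWeight_apply]
    refine Prod.ext (weightedPullback_iterate_succ _ _ _).symm ?_
    have h1 : (weightedPullback φ R)^[n + 1] g =
        fun x ↦ R x (((weightedPullback φ R)^[n] g) (φ x)) := by
      funext y; exact weightedPullback_iterate_succ _ _ _
    have hn := contDiff_weightedPullback_iterate hφ hR hg n
    have h2 : HasFDerivAt (fun x ↦ ((weightedPullback φ R)^[n] g) (φ x)) _ x :=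
      (hn.differentiable (by simp) (φ x)).hasFDerivAt.comp x
        (hφ.differentiable (by simp) x).hasFDerivAt
    have h3 := ((hR.differentiable (by simp) x).hasFDerivAt.clm_apply h2).fderiv
    rw [h1, h3]
    rfl

/-- The prolonged series consists of the terms of the original series together with their
derivatives. Its geometric convergence justifies termwise differentiation, and its C^k regularity
makes the derivative of the sum C^k. -/
theorem contDiffOn_succ_tsum_weightedPullback [FiniteDimensional ℝ G] {O : Set E}
    (hOb : Bornology.IsBounded O)
    (hOo : IsOpen O) (hOc : IsPreconnected O)
    (hφO : MapsTo φ O O) {C θ : ℝ} (hθ0 : 0 ≤ θ) (hθ1 : θ < 1)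
    (hφn : ∀ n, ∀ x ∈ O, ‖φ^[n] x‖ ≤ C * θ ^ n) (hφ : ContDiff ℝ ∞ φ) (hR : ContDiff ℝ ∞ R) {k : ℕ}
    (ih : ∃ N : ℕ, ∀ g : E → G × (E →L[ℝ] G), ContDiff ℝ ∞ g → (g =O[𝓝 0] fun x ↦ ‖x‖ ^ N) →
      ContDiffOn ℝ k (fun x ↦ ∑' n, (weightedPullback φ (prolongedWeight φ R))^[n] g x) O) :
    ∃ N : ℕ, ∀ g : E → G, ContDiff ℝ ∞ g → (g =O[𝓝 0] fun x ↦ ‖x‖ ^ N) →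
      ContDiffOn ℝ (k + 1) (fun x ↦ ∑' n, (weightedPullback φ R)^[n] g x) O := by
  have : CompleteSpace G := FiniteDimensional.complete ℝ G
  obtain ⟨N₁, hN₁⟩ := ih
  obtain ⟨N₂, hN₂⟩ := exists_norm_weightedPullback_iterate_le (G := G × (E →L[ℝ] G)) hOb hφO hθ0 hθ1
    hφn (contDiff_prolongedWeight hφ hR).continuous
  have hmono : ∀ {a b : ℕ}, a ≤ b → (fun x : E ↦ ‖x‖ ^ b) =O[𝓝 0] fun x ↦ ‖x‖ ^ a := by
    intro a b hab
    refine IsBigO.of_bound 1 ?_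
    filter_upwards [Metric.ball_mem_nhds (0 : E) one_pos] with x hx
    rw [mem_ball_zero_iff] at hx
    rw [norm_pow, norm_pow, norm_norm, one_mul]
    exact pow_le_pow_of_le_one (norm_nonneg _) hx.le hab
  -- `N₁` secures the regularity of the prolonged series and `N₂` its convergence. The order `2 * M`
  -- is demanded of `g` because its derivative is only known to vanish to half the order.
  set M := max (max N₁ N₂) 1
  refine ⟨2 * M, fun g hg hgO ↦ ?_⟩
  have hgd := isBigO_fderiv_of_isBigO hg (le_max_right _ _) hgO
  have hg' : ContDiff ℝ ∞ (fun x ↦ (g x, fderiv ℝ g x)) := hg.prodMk (hg.fderiv_right (by simp))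
  have hg'O : (fun x ↦ (g x, fderiv ℝ g x)) =O[𝓝 0] fun x ↦ ‖x‖ ^ M :=
    (hgO.trans (hmono (by omega))).prod_left hgd
  have hM1 : N₁ ≤ M := (le_max_left _ _).trans (le_max_left _ _)
  have hM2 : N₂ ≤ M := (le_max_right _ _).trans (le_max_left _ _)
  have hsm := hN₁ _ hg' (hg'O.trans (hmono hM1))
  obtain ⟨K, hK⟩ := hN₂ _ hg'.continuous (hg'O.trans (hmono hM2))
  have hsum : Summable fun n : ℕ ↦ K * (1 / 2 : ℝ) ^ n :=
    (summable_geometric_two).mul_left K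
  have hK1 : ∀ n, ∀ x ∈ O, ‖(weightedPullback φ R)^[n] g x‖ ≤ K * (1 / 2) ^ n := by
    intro n x hx
    have := hK n x hx
    rw [weightedPullback_prolonged_iterate hφ hR hg] at this
    exact (norm_fst_le _).trans this
  have hK2 : ∀ n, ∀ x ∈ O, ‖fderiv ℝ ((weightedPullback φ R)^[n] g) x‖ ≤ K * (1 / 2) ^ n := by
    intro n x hx
    have := hK n x hx
    rw [weightedPullback_prolonged_iterate hφ hR hg] at this
    exact (norm_snd_le _).trans this
  have hder : ∀ x ∈ O, HasFDerivAt (fun x ↦ ∑' n, (weightedPullback φ R)^[n] g x)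
      (∑' n, fderiv ℝ ((weightedPullback φ R)^[n] g) x) x := by
    intro x hx
    refine hasFDerivAt_tsum_of_isPreconnected hsum hOo hOc (fun n y _ ↦ ?_) hK2 hx ?_ hx
    · exact ((contDiff_weightedPullback_iterate hφ hR hg n).differentiable
        (by simp) y).hasFDerivAt
    · exact Summable.of_norm_bounded hsum fun n ↦ hK1 n x hx
  rw [contDiffOn_succ_iff_fderiv_of_isOpen hOo]
  refine ⟨fun x hx ↦ (hder x hx).differentiableAt.differentiableWithinAt, by simp, ?_⟩
  refine (contDiff_snd.comp_contDiffOn hsm).congr fun x hx ↦ ?_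
  rw [(hder x hx).fderiv]
  have hs : Summable fun n ↦ (weightedPullback φ (prolongedWeight φ R))^[n]
      (fun x ↦ (g x, fderiv ℝ g x)) x := Summable.of_norm_bounded hsum fun n ↦ hK n x hx
  have := (ContinuousLinearMap.snd ℝ G (E →L[ℝ] G)).map_tsum hs
  simp only [ContinuousLinearMap.coe_snd'] at this
  rw [Function.comp_apply, this]
  simp only [weightedPullback_prolonged_iterate hφ hR hg]

end

/-- `G` lives in `Type (max u v)` so that the prolonged space `G × (E →L[ℝ] G)` lies in the same
universe and the induction can generalize over `G`. -/
theorem contDiffOn_tsum_weightedPullback_aux {φ : E → E} {O : Set E} (hOb : Bornology.IsBounded O)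
    (hOo : IsOpen O) (hOc : IsPreconnected O)
    (hφO : MapsTo φ O O) {C θ : ℝ} (hθ0 : 0 ≤ θ) (hθ1 : θ < 1)
    (hφn : ∀ n, ∀ x ∈ O, ‖φ^[n] x‖ ≤ C * θ ^ n) (hφ : ContDiff ℝ ∞ φ) (k : ℕ)
    {G : Type (max u v)} [NormedAddCommGroup G] [NormedSpace ℝ G] [FiniteDimensional ℝ G]
    {R : E → G →L[ℝ] G} (hR : ContDiff ℝ ∞ R) :
    ∃ N : ℕ, ∀ g : E → G, ContDiff ℝ ∞ g → (g =O[𝓝 0] fun x ↦ ‖x‖ ^ N) →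
      ContDiffOn ℝ k (fun x ↦ ∑' n, (weightedPullback φ R)^[n] g x) O := by
  induction k generalizing G with
  | zero =>
    have : CompleteSpace G := FiniteDimensional.complete ℝ G
    obtain ⟨N, hN⟩ := exists_norm_weightedPullback_iterate_le hOb hφO hθ0 hθ1 hφn hR.continuous
    refine ⟨N, fun g hg hgO ↦ ?_⟩
    obtain ⟨K, hK⟩ := hN g hg.continuous hgO
    refine contDiffOn_zero.2 (continuousOn_tsum (fun n ↦ ?_) (summable_geometric_two.mul_left K) hK)
    exact (contDiff_weightedPullback_iterate hφ hR hg n).continuous.continuousOn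
  | succ k ih =>
    exact_mod_cast contDiffOn_succ_tsum_weightedPullback hOb hOo hOc hφO hθ0 hθ1 hφn hφ hR
      (ih (contDiff_prolongedWeight hφ hR))

/-- The series `∑ Tⁿ g`, for `T` the weighted pullback by a contraction, is of class `C^k` if `g`
vanishes to sufficiently high order. -/
theorem contDiffOn_tsum_weightedPullback {φ : E → E} {O : Set E} (hOb : Bornology.IsBounded O)
    (hOo : IsOpen O) (hOc : IsPreconnected O)
    (hφO : MapsTo φ O O) {C θ : ℝ} (hθ0 : 0 ≤ θ) (hθ1 : θ < 1)
    (hφn : ∀ n, ∀ x ∈ O, ‖φ^[n] x‖ ≤ C * θ ^ n) (hφ : ContDiff ℝ ∞ φ) (k : ℕ)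
    {G : Type v} [NormedAddCommGroup G] [NormedSpace ℝ G] [FiniteDimensional ℝ G]
    {R : E → G →L[ℝ] G} (hR : ContDiff ℝ ∞ R) :
    ∃ N : ℕ, ∀ g : E → G, ContDiff ℝ ∞ g → (g =O[𝓝 0] fun x ↦ ‖x‖ ^ N) →
      ContDiffOn ℝ k (fun x ↦ ∑' n, (weightedPullback φ R)^[n] g x) O := by
  -- One explicit prolongation lifts `G` from `Type v` to the universe required by the induction;
  -- the extra derivative gained is discarded.
  obtain ⟨N, hN⟩ := contDiffOn_succ_tsum_weightedPullback hOb hOo hOc hφO hθ0 hθ1 hφn hφ hR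
    (contDiffOn_tsum_weightedPullback_aux.{u, v} hOb hOo hOc hφO hθ0 hθ1 hφn hφ k
      (contDiff_prolongedWeight hφ hR))
  exact ⟨N, fun g hg hgO ↦ (hN g hg hgO).of_le (by exact_mod_cast Nat.le_succ k)⟩

end WeightedPullback

/-! ### Solving an eigenvalue equation for a triangular operator, up to finite level -/

section TriangularOperator

variable {𝒮 ι Λ : Type*} [AddCommGroup 𝒮] [Module ℂ 𝒮] [LinearOrder Λ] [WellFoundedLT Λ]

/-- An operator `L` which is triangular, with diagonal `ev`, with respect to a family of
functionals `ℓ` ordered by `rank`; the functionals of bounded `level` are finitely many and have a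
dual family `mono`. -/
structure IsTriangular (L : Module.End ℂ 𝒮) (ℓ : ι → Module.Dual ℂ 𝒮) (rank : ι → Λ)
    (level : ι → ℕ) (ev : ι → ℂ) (mono : ι → 𝒮) : Prop where
  apply_eq : ∀ i u, (∀ j, rank j < rank i → ℓ j u = 0) → ℓ i (L u) = ev i * ℓ i u
  level_le : ∀ i j, rank j < rank i → level j ≤ level i
  finite_level : ∀ N, {i | level i ≤ N}.Finite
  mono_self : ∀ i, ℓ i (mono i) = 1
  mono_ne : ∀ i j, i ≠ j → ℓ i (mono j) = 0

namespace IsTriangular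

variable {L : Module.End ℂ 𝒮} {ℓ : ι → Module.Dual ℂ 𝒮} {rank : ι → Λ}
    {level : ι → ℕ} {ev : ι → ℂ} {mono : ι → 𝒮}

/-- A solution of `L u = lam u` up to a given level is determined by its resonant coefficients. -/
theorem eq_zero (h : IsTriangular L ℓ rank level ev mono) {lam : ℂ} {N : ℕ} {u : 𝒮}
    (hu : ∀ i, level i ≤ N → ℓ i (L u) = lam * ℓ i u)
    (hres : ∀ i, level i ≤ N → ev i = lam → ℓ i u = 0) :
    ∀ i, level i ≤ N → ℓ i u = 0 := by
  intro i
  induction hr : rank i using WellFoundedLT.induction generalizing i with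
  | ind r ih =>
    intro hi
    by_cases hev : ev i = lam
    · exact hres i hi hev
    have h1 := h.apply_eq i u fun j hj ↦
      ih (rank j) (hr ▸ hj) j rfl ((h.level_le i j hj).trans hi)
    rw [hu i hi] at h1
    have h2 : (ev i - lam) * ℓ i u = 0 := by rw [sub_mul, h1, sub_self]
    exact (mul_eq_zero.1 h2).resolve_left (sub_ne_zero.2 hev)

/-- Starting from the last resonant index, the equation `L u = lam u` can be solved up to any given
level. -/
theorem exists_eq (h : IsTriangular L ℓ rank level ev mono) {r : ι}
    (hmax : ∀ i, ev i = ev r → rank i ≤ rank r) (N : ℕ) :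
    ∃ u : 𝒮, ℓ r u = 1 ∧ (∀ i, rank i ≤ rank r → i ≠ r → ℓ i u = 0) ∧
      ∀ i, level i ≤ N → ℓ i (L u) = ev r * ℓ i u := by
  classical
  -- Ansatz: `mono r` plus a combination of the `mono i` for the finitely many `i` of level at most
  -- `N` beyond `r`. Maximality of `r` makes these indices nonresonant, so the square system for the
  -- coefficients is triangular with nonzero diagonal. It is injective, hence solvable.
  have hfin : {i | level i ≤ N ∧ rank r < rank i}.Finite :=
    (h.finite_level N).subset fun i hi ↦ hi.1
  let S := hfin.toFinset
  have hS : ∀ i, i ∈ S ↔ level i ≤ N ∧ rank r < rank i := fun i ↦ hfin.mem_toFinset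
  let lc : (S → ℂ) →ₗ[ℂ] 𝒮 := Fintype.linearCombination ℂ (fun i : S ↦ mono i)
  have hlc_apply : ∀ (c : S → ℂ) (i : ι), ℓ i (lc c) = if hi : i ∈ S then c ⟨i, hi⟩ else 0 := by
    intro c i
    simp only [lc, Fintype.linearCombination_apply, map_sum, map_smul, smul_eq_mul]
    split_ifs with hi
    · rw [Finset.sum_eq_single ⟨i, hi⟩]
      · rw [h.mono_self, mul_one]
      · intro j _ hj
        rw [h.mono_ne, mul_zero]
        exact fun hij ↦ hj (Subtype.ext hij.symm)
      · simp
    · refine Finset.sum_eq_zero fun j _ ↦ ?_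
      rw [h.mono_ne, mul_zero]
      exact fun hij ↦ hi (hij ▸ j.2)
  let T : (S → ℂ) →ₗ[ℂ] (S → ℂ) :=
    LinearMap.pi fun i ↦ (ℓ i - 0) ∘ₗ (L - ev r • LinearMap.id) ∘ₗ lc
  have hT : ∀ c i, T c i = ℓ i (L (lc c)) - ev r * ℓ i (lc c) := by
    intro c i
    simp [T]
  have hinj : Function.Injective T := by
    rw [← LinearMap.ker_eq_bot, LinearMap.ker_eq_bot']
    intro c hc
    have key : ∀ i : ι, ℓ i (lc c) = 0 := by
      intro i
      induction hr : rank i using WellFoundedLT.induction generalizing i with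
      | ind ρ ih =>
        by_cases hi : i ∈ S
        · have h1 := h.apply_eq i (lc c) fun j hj ↦ ih (rank j) (hr ▸ hj) j rfl
          have h2 := hT c ⟨i, hi⟩
          rw [hc, Pi.zero_apply] at h2
          simp only at h2
          rw [h1, ← sub_mul] at h2
          refine (mul_eq_zero.1 h2.symm).resolve_left (sub_ne_zero.2 fun hev ↦ ?_)
          exact absurd (hmax i hev) (not_le.2 ((hS i).1 hi).2)
        · rw [hlc_apply, dif_neg hi]
    funext i
    have := key i
    rw [hlc_apply, dif_pos i.2] at this
    exact this
  obtain ⟨c, hc⟩ := (LinearMap.injective_iff_surjective.1 hinj)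
    fun i ↦ -(ℓ i (L (mono r)) - ev r * ℓ i (mono r))
  have hrS : r ∉ S := fun hr ↦ lt_irrefl _ ((hS r).1 hr).2
  have hlow : ∀ i, rank i ≤ rank r → i ≠ r → ℓ i (mono r + lc c) = 0 := by
    intro i hi hir
    have hiS : i ∉ S := fun h' ↦ absurd hi (not_le.2 ((hS i).1 h').2)
    rw [map_add, h.mono_ne i r hir, hlc_apply, dif_neg hiS, add_zero]
  have hone : ℓ r (mono r + lc c) = 1 := by
    rw [map_add, h.mono_self, hlc_apply, dif_neg hrS, add_zero]
  refine ⟨mono r + lc c, hone, hlow, fun i hi ↦ ?_⟩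
  by_cases hri : rank r < rank i
  · have hiS : i ∈ S := (hS i).2 ⟨hi, hri⟩
    have h1 := congrFun hc ⟨i, hiS⟩
    rw [hT] at h1
    simp only [map_add] at h1 ⊢
    linear_combination h1
  · rw [not_lt] at hri
    rw [h.apply_eq i]
    · by_cases hir : i = r
      · rw [hir]
      · rw [hlow i hri hir, mul_zero, mul_zero]
    · intro j hj
      refine hlow j (hj.le.trans hri) ?_
      rintro rfl
      exact absurd hri (not_le.2 hj)

end IsTriangular

end TriangularOperator

/-! ### Complex frames, iterated derivatives and smooth coefficient families -/

section Jets

set_option linter.unusedSectionVars false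

variable {E : Type*} [NormedAddCommGroup E] [NormedSpace ℝ E] [FiniteDimensional ℝ E]
  {F : Type*} [NormedAddCommGroup F] [NormedSpace ℂ F] [FiniteDimensional ℂ F]

/-- A complex basis of the complexification of `E`, given by the real and imaginary parts of its
elements, with its dual basis, in which `B` is triangular with diagonal `μ`. -/
structure FlagFrame {ι : Type*} [Fintype ι] [DecidableEq ι] (B : E →L[ℝ] E) (μ : ι → ℂ) where
  vec : ι → E × E
  coord : ι → E →L[ℝ] ℂ
  ord : ι → ℕ
  sum_re : ∀ x, ∑ i, ((coord i x).re • (vec i).1 - (coord i x).im • (vec i).2) = x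
  sum_im : ∀ x, ∑ i, ((coord i x).re • (vec i).2 + (coord i x).im • (vec i).1) = 0
  dual : ∀ l i, coord l (vec i).1 + Complex.I * coord l (vec i).2 = if l = i then 1 else 0
  diag : ∀ i, coord i (B (vec i).1) + Complex.I * coord i (B (vec i).2) = μ i
  triangular : ∀ l i, l ≠ i → ¬ ord l < ord i →
    coord l (B (vec i).1) + Complex.I * coord l (B (vec i).2) = 0

/-- A basis of `F` with its dual basis, in which `A` is triangular with diagonal `ρ`. -/
structure FiberFlag {κ : Type*} [Fintype κ] [DecidableEq κ] (A : F →ₗ[ℂ] F) (ρ : κ → ℂ) where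
  vec : κ → F
  coord : κ → F →ₗ[ℂ] ℂ
  ord : κ → ℕ
  sum_coord : ∀ y, ∑ i, coord i y • vec i = y
  dual : ∀ l i, coord l (vec i) = if l = i then 1 else 0
  diag : ∀ i, coord i (A (vec i)) = ρ i
  triangular : ∀ l i, l ≠ i → ¬ ord i < ord l → coord l (A (vec i)) = 0

variable (E F) in
/-- The complex vector space of smooth functions on `E` with values in `F`. -/
def smoothFunctions : Submodule ℂ (E → F) where
  carrier := {u | ContDiff ℝ ∞ u}
  add_mem' hu hv := by
    rw [mem_ofPred_eq] at *
    exact hu.add hv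
  zero_mem' := by
    rw [mem_ofPred_eq]
    exact contDiff_const
  smul_mem' c _ hu := by
    rw [mem_ofPred_eq] at *
    exact hu.const_smul c

theorem contDiff_coe (u : smoothFunctions E F) : ContDiff ℝ ∞ (u : E → F) := u.2

/-- The derivative of a function in a complex direction. -/
def complexDeriv {G : Type*} [NormedAddCommGroup G] [NormedSpace ℂ G] (v : E × E) (u : E → G)
    (x : E) : G :=
  fderiv ℝ u x v.1 + Complex.I • fderiv ℝ u x v.2

theorem contDiff_complexDeriv {G : Type*} [NormedAddCommGroup G] [NormedSpace ℂ G] (v : E × E)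
    {u : E → G} (hu : ContDiff ℝ ∞ u) : ContDiff ℝ ∞ (complexDeriv v u) := by
  have hu' : ContDiff ℝ ∞ (fderiv ℝ u) := hu.fderiv_right (by simp)
  exact (hu'.clm_apply contDiff_const).add ((hu'.clm_apply contDiff_const).const_smul _)

theorem complexDeriv_congr {G : Type*} [NormedAddCommGroup G] [NormedSpace ℂ G] (v : E × E)
    {u u' : E → G} {x : E} (h : u =ᶠ[𝓝 x] u') : complexDeriv v u =ᶠ[𝓝 x] complexDeriv v u' := by
  filter_upwards [h.fderiv (𝕜 := ℝ)] with y hy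
  simp only [complexDeriv, hy]

/-- `complexDeriv` as an operator on smooth functions. -/
def derivOp (v : E × E) : Module.End ℂ (smoothFunctions E F) where
  toFun u := ⟨complexDeriv v u, contDiff_complexDeriv v u.2⟩
  map_add' u u' := by
    ext x
    have h1 := ((contDiff_coe u).differentiable (by simp)) x
    have h2 := ((contDiff_coe u').differentiable (by simp)) x
    simp only [complexDeriv, Submodule.coe_add, fderiv_add h1 h2, Pi.add_apply,
      add_apply, smul_add]
    abel
  map_smul' c u := by
    ext x
    have h1 := ((contDiff_coe u).differentiable (by simp)) x
    have h2 : fderiv ℝ ((c • u : smoothFunctions E F) : E → F) x = c • fderiv ℝ (u : E → F) x :=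
      fderiv_const_smul h1 c
    have h3 : ∀ a, fderiv ℝ ((c • u : smoothFunctions E F) : E → F) x a =
        c • fderiv ℝ (u : E → F) x a := fun a ↦ by rw [h2]; rfl
    simp only [complexDeriv, h3]
    simp only [Submodule.coe_smul, Pi.smul_apply, RingHom.id_apply, complexDeriv, smul_add,
      smul_comm c Complex.I]

theorem derivOp_apply (v : E × E) (u : smoothFunctions E F) (x : E) :
    (derivOp v u : E → F) x = fderiv ℝ (u : E → F) x v.1 + Complex.I • fderiv ℝ (u : E → F) x v.2 :=
  rfl

theorem fderiv_derivOp (v : E × E) (u : smoothFunctions E F) (x a : E) :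
    fderiv ℝ (derivOp v u : E → F) x a = fderiv ℝ (fderiv ℝ (u : E → F)) x a v.1 +
      Complex.I • fderiv ℝ (fderiv ℝ (u : E → F)) x a v.2 := by
  have hu' : ContDiff ℝ ∞ (fderiv ℝ (u : E → F)) := (contDiff_coe u).fderiv_right (by simp)
  have h := (hu'.differentiable (by simp) x).hasFDerivAt
  have h1 := (h.clm_apply (hasFDerivAt_const v.1 x)).add
    ((h.clm_apply (hasFDerivAt_const v.2 x)).const_smul Complex.I)
  have h2 : HasFDerivAt (derivOp v u : E → F) _ x := h1
  rw [h2.fderiv]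
  simp

theorem derivOp_comm (v w : E × E) (u : smoothFunctions E F) :
    derivOp v (derivOp w u) = derivOp w (derivOp v u) := by
  ext x
  have hsym : IsSymmSndFDerivAt ℝ (u : E → F) x :=
    ((contDiff_coe u).contDiffAt).isSymmSndFDerivAt
      (by simpa using (ENat.LEInfty.out : (2 : WithTop ℕ∞) ≤ ∞))
  rw [derivOp_apply, derivOp_apply, fderiv_derivOp, fderiv_derivOp, fderiv_derivOp, fderiv_derivOp,
    hsym.eq v.1 w.1, hsym.eq v.1 w.2, hsym.eq v.2 w.1, hsym.eq v.2 w.2]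
  simp only [smul_add]
  abel

variable (E F) in
/-- Families of endomorphisms of `F` depending smoothly on a point of `E`. -/
def SmoothEnd : Type _ := {g : E → F →ₗ[ℂ] F // ∀ y, ContDiff ℝ ∞ fun x ↦ g x y}

/-- A smooth family of endomorphisms as a smooth function with values in real endomorphisms. -/
def SmoothEnd.toCLM (g : SmoothEnd E F) (x : E) : F →L[ℝ] F :=
  haveI : FiniteDimensional ℝ F := FiniteDimensional.complexToReal F
  LinearMap.toContinuousLinearMap ((g.1 x).restrictScalars ℝ)

theorem SmoothEnd.toCLM_apply (g : SmoothEnd E F) (x : E) (y : F) : g.toCLM x y = g.1 x y := rfl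

theorem SmoothEnd.contDiff_toCLM (g : SmoothEnd E F) : ContDiff ℝ ∞ g.toCLM := by
  have : FiniteDimensional ℝ F := FiniteDimensional.complexToReal F
  rw [contDiff_clm_apply_iff]
  exact g.2

/-- Multiplication of smooth functions by a smooth family of endomorphisms. -/
def mulOp (g : SmoothEnd E F) : Module.End ℂ (smoothFunctions E F) where
  toFun u := ⟨fun x ↦ g.1 x (u.1 x), g.contDiff_toCLM.clm_apply u.2⟩
  map_add' u u' := by ext x; simp
  map_smul' c u := by ext x; simp

theorem mulOp_apply (g : SmoothEnd E F) (u : smoothFunctions E F) (x : E) :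
    (mulOp g u : E → F) x = g.1 x ((u : E → F) x) := rfl

theorem fderiv_smoothEnd_apply (g : SmoothEnd E F) (y : F) (x a : E) :
    fderiv ℝ (fun x ↦ g.1 x y) x a = fderiv ℝ g.toCLM x a y := by
  have h := (g.contDiff_toCLM.differentiable (by simp) x).hasFDerivAt
  have h1 : HasFDerivAt (fun x ↦ g.1 x y) _ x := h.clm_apply (hasFDerivAt_const y x)
  rw [h1.fderiv]
  simp

/-- The derivative of a smooth family of endomorphisms in a complex direction. -/
def derivEnd (v : E × E) (g : SmoothEnd E F) : SmoothEnd E F :=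
  ⟨fun x ↦
    { toFun := fun y ↦ complexDeriv v (fun x ↦ g.1 x y) x
      map_add' := fun y z ↦ by
        simp only [complexDeriv, fderiv_smoothEnd_apply g]
        simp only [map_add, smul_add]
        abel
      map_smul' := fun c y ↦ by
        have h1 : ∀ a, fderiv ℝ (fun x ↦ g.1 x (c • y)) x a = c • fderiv ℝ (fun x ↦ g.1 x y) x a := by
          intro a
          have h2 : (fun x ↦ g.1 x (c • y)) = fun x ↦ c • g.1 x y := by
            funext x; exact map_smul _ _ _
          rw [h2, fderiv_fun_const_smul ((g.2 y).differentiable (by simp) x)]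
          rfl
        simp only [complexDeriv, h1, RingHom.id_apply, smul_add, smul_comm c Complex.I] },
    fun y ↦ contDiff_complexDeriv v (g.2 y)⟩

theorem derivEnd_apply (v : E × E) (g : SmoothEnd E F) (x : E) (y : F) :
    (derivEnd v g).1 x y = complexDeriv v (fun x ↦ g.1 x y) x := rfl

theorem derivOp_mulOp (v : E × E) (g : SmoothEnd E F) (u : smoothFunctions E F) :
    derivOp v (mulOp g u) = mulOp (derivEnd v g) u + mulOp g (derivOp v u) := by
  ext x
  have h := (g.contDiff_toCLM.differentiable (by simp) x).hasFDerivAt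
  have h1 : HasFDerivAt (mulOp g u : E → F) _ x :=
    h.clm_apply ((contDiff_coe u).differentiable (by simp) x).hasFDerivAt
  rw [derivOp_apply, h1.fderiv]
  simp only [Submodule.coe_add, Pi.add_apply, mulOp_apply, derivOp_apply, derivEnd_apply,
    complexDeriv, fderiv_smoothEnd_apply, add_apply,
    ContinuousLinearMap.comp_apply, ContinuousLinearMap.flip_apply, g.toCLM_apply, map_add,
    map_smul, smul_add]
  abel

/-- Multiplication by a smooth function, as a smooth family of endomorphisms. -/
def scalarEnd (F : Type*) [NormedAddCommGroup F] [NormedSpace ℂ F] (ξ : E → ℂ)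
    (hξ : ContDiff ℝ ∞ ξ) : SmoothEnd E F :=
  ⟨fun x ↦ ξ x • LinearMap.id, fun y ↦ by
    exact hξ.smul contDiff_const⟩

theorem derivEnd_scalarEnd (v : E × E) (ξ : E → ℂ) (hξ : ContDiff ℝ ∞ ξ) (x : E) :
    (derivEnd v (scalarEnd F ξ hξ)).1 x = complexDeriv v ξ x • LinearMap.id := by
  ext y
  have h1 : ∀ a, fderiv ℝ (fun x ↦ (scalarEnd F ξ hξ).1 x y) x a = fderiv ℝ ξ x a • y := by
    intro a
    have h2 : HasFDerivAt (fun x ↦ (scalarEnd F ξ hξ).1 x y) _ x :=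
      (hξ.differentiable (by simp) x).hasFDerivAt.smul (hasFDerivAt_const y x)
    rw [h2.fderiv]
    simp
  rw [derivEnd_apply, LinearMap.smul_apply, LinearMap.id_apply]
  simp only [complexDeriv, h1, add_smul, smul_eq_mul, mul_smul]

section Iterated

variable {ι : Type*}

/-- Composition with the derivative in the complex direction `v i`. -/
def derivStep (v : ι → E × E) (i : ι) (Z : Module.End ℂ (smoothFunctions E F)) :
    Module.End ℂ (smoothFunctions E F) := derivOp (v i) * Z

/-- Symmetry of second derivatives; it makes the fold over an unordered multiset in `iterDeriv` well
defined. -/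
instance leftCommutative_derivStep (v : ι → E × E) :
    LeftCommutative (derivStep (F := F) v) :=
  ⟨fun i j Z ↦ by ext u : 1; exact derivOp_comm _ _ _⟩

/-- The iterated derivative in the complex directions `v i`, for `i` in a multiset. -/
def iterDeriv (v : ι → E × E) (w : Multiset ι) : Module.End ℂ (smoothFunctions E F) :=
  w.foldr (derivStep v) 1

variable (v : ι → E × E)

@[simp] theorem iterDeriv_zero : iterDeriv (F := F) v 0 = 1 := rfl

@[simp] theorem iterDeriv_cons (i : ι) (w : Multiset ι) :
    iterDeriv (F := F) v (i ::ₘ w) = derivOp (v i) * iterDeriv v w :=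
  Multiset.foldr_cons _ _ _ _

theorem iterDeriv_cons' (i : ι) (w : Multiset ι) :
    iterDeriv (F := F) v (i ::ₘ w) = iterDeriv v w * derivOp (v i) := by
  induction w using Multiset.induction_on with
  | empty => rfl
  | cons j w ih =>
    rw [Multiset.cons_swap, iterDeriv_cons, ih, iterDeriv_cons, mul_assoc]

theorem iterDeriv_congr {u u' : smoothFunctions E F} {x : E} (h : (u : E → F) =ᶠ[𝓝 x] u')
    (w : Multiset ι) : (iterDeriv v w u : E → F) =ᶠ[𝓝 x] iterDeriv v w u' := by
  induction w using Multiset.induction_on with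
  | empty => exact h
  | cons j w ih =>
    rw [iterDeriv_cons]
    exact complexDeriv_congr _ ih

end Iterated

end Jets

/-! ### The operator on jets at the zero of the vector field -/

section TransportJets

set_option linter.unusedSectionVars false

variable {E : Type*} [NormedAddCommGroup E] [NormedSpace ℝ E] [FiniteDimensional ℝ E]
  {F : Type*} [NormedAddCommGroup F] [NormedSpace ℂ F] [FiniteDimensional ℂ F]

/-- The operator `u ↦ Du(X) + A u` on smooth functions. -/
def fieldOp (X : E → E) (hX : ContDiff ℝ ∞ X) (A : SmoothEnd E F) :
    Module.End ℂ (smoothFunctions E F) where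
  toFun u := ⟨fun x ↦ fderiv ℝ (u : E → F) x (X x) + A.1 x ((u : E → F) x),
    (((contDiff_coe u).fderiv_right (by simp)).clm_apply hX).add (mulOp A u).2⟩
  map_add' u u' := by
    ext x
    have h1 := ((contDiff_coe u).differentiable (by simp)) x
    have h2 := ((contDiff_coe u').differentiable (by simp)) x
    simp only [Submodule.coe_add, fderiv_add h1 h2, Pi.add_apply, add_apply, map_add]
    abel
  map_smul' c u := by
    ext x
    have h1 := ((contDiff_coe u).differentiable (by simp)) x
    have h3 : ∀ a, fderiv ℝ ((c • u : smoothFunctions E F) : E → F) x a =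
        c • fderiv ℝ (u : E → F) x a := fun a ↦ by
      have h2 : fderiv ℝ ((c • u : smoothFunctions E F) : E → F) x = c • fderiv ℝ (u : E → F) x :=
        fderiv_const_smul h1 c
      rw [h2]; rfl
    simp only [h3]
    simp only [Submodule.coe_smul, Pi.smul_apply, RingHom.id_apply, smul_add, map_smul]

theorem fieldOp_apply (X : E → E) (hX : ContDiff ℝ ∞ X) (A : SmoothEnd E F)
    (u : smoothFunctions E F) (x : E) : (fieldOp X hX A u : E → F) x =
      fderiv ℝ (u : E → F) x (X x) + A.1 x ((u : E → F) x) := rfl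

variable {ι κ : Type*} [Fintype ι] [DecidableEq ι] [Fintype κ] [DecidableEq κ]

/-- The complex linear extension of `T` to the complexification of `E`, evaluated on the expansion
of `x` in the complex frame. The vanishing imaginary part of that expansion is added with the factor
`I`. -/
theorem FlagFrame.map_eq_sum {B : E →L[ℝ] E} {μ : ι → ℂ} (fr : FlagFrame B μ)
    {G : Type*} [NormedAddCommGroup G] [NormedSpace ℂ G] (T : E →L[ℝ] G) (x : E) :
    T x = ∑ i, fr.coord i x • (T (fr.vec i).1 + Complex.I • T (fr.vec i).2) := by
  have h1 := congrArg T (fr.sum_re x)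
  have h2 := congrArg (fun y ↦ Complex.I • T y) (fr.sum_im x)
  simp only [map_sum, map_sub, map_add, map_smul, map_zero, smul_zero, Finset.smul_sum] at h1 h2
  rw [← h1, ← add_zero (∑ i, _), ← h2, ← Finset.sum_add_distrib]
  refine Finset.sum_congr rfl fun i _ ↦ ?_
  conv_rhs => rw [← Complex.re_add_im (fr.coord i x)]
  have e1 : ∀ (r : ℝ) (y : G), r • y = (r : ℂ) • y := fun r y ↦ rfl
  simp only [e1, smul_add, add_smul, smul_smul, add_mul]
  have e2 : ((fr.coord i x).im : ℂ) * Complex.I * Complex.I = -((fr.coord i x).im : ℂ) := by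
    rw [mul_assoc, Complex.I_mul_I]; ring
  rw [e2, neg_smul, mul_comm Complex.I ((fr.coord i x).re : ℂ),
    mul_comm Complex.I ((fr.coord i x).im : ℂ)]
  abel

section

variable {X : E → E} {hX : ContDiff ℝ ∞ X} {A : SmoothEnd E F} {μ : ι → ℂ}
  (fr : FlagFrame (fderiv ℝ X 0) μ)

/-- The components of the vector field in the complex frame. -/
def FlagFrame.component (X : E → E) (l : ι) (x : E) : ℂ := fr.coord l (X x)

theorem FlagFrame.contDiff_component (hX : ContDiff ℝ ∞ X) (l : ι) :
    ContDiff ℝ ∞ (fr.component X l) := (fr.coord l).contDiff.comp hX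

theorem FlagFrame.fieldOp_eq : fieldOp X hX A =
    ∑ l, mulOp (scalarEnd F _ (fr.contDiff_component hX l)) * derivOp (fr.vec l) + mulOp A := by
  ext u x
  rw [fieldOp_apply, fr.map_eq_sum (fderiv ℝ (u : E → F) x) (X x)]
  simp only [LinearMap.add_apply, LinearMap.sum_apply, Submodule.coe_add, Pi.add_apply, mulOp_apply,
    Submodule.coe_sum, Finset.sum_apply, Module.End.mul_apply]
  rfl

theorem FlagFrame.complexDeriv_component (hX : ContDiff ℝ ∞ X) (i l : ι) :
    complexDeriv (fr.vec i) (fr.component X l) 0 =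
      fr.coord l (fderiv ℝ X 0 (fr.vec i).1) +
        Complex.I * fr.coord l (fderiv ℝ X 0 (fr.vec i).2) := by
  have h : HasFDerivAt (fr.component X l) ((fr.coord l).comp (fderiv ℝ X 0)) 0 :=
    (fr.coord l).hasFDerivAt.comp 0 (hX.differentiable (by simp) 0).hasFDerivAt
  rw [complexDeriv, h.fderiv]
  rfl

/-- The span of the differential operators `g ∂^w` that are of order less than `k`, or of order `k`
with `g` vanishing at the origin or the weight of `w` less than `s`. -/
def lowerOrder (v : ι → E × E) (ord : ι → ℕ) (k s : ℕ) :
    Submodule ℂ (Module.End ℂ (smoothFunctions E F)) :=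
  Submodule.span ℂ {Z | ∃ (g : SmoothEnd E F) (w : Multiset ι), Z = mulOp g * iterDeriv v w ∧
    (w.card < k ∨ w.card = k ∧ (g.1 0 = 0 ∨ (w.map ord).sum < s))}

theorem mulOp_mul_iterDeriv_mem_lowerOrder {v : ι → E × E} {ord : ι → ℕ} {k s : ℕ}
    (g : SmoothEnd E F) (w : Multiset ι)
    (h : w.card < k ∨ w.card = k ∧ (g.1 0 = 0 ∨ (w.map ord).sum < s)) :
    mulOp g * iterDeriv v w ∈ lowerOrder (F := F) v ord k s :=
  Submodule.subset_span ⟨g, w, rfl, h⟩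

/-- Leibniz rule: the new derivative either falls on the coefficient, which leaves an operator of
order at most `k`, or is added to `w`, which keeps the coefficient and raises order and weight in
step. -/
theorem derivOp_mul_mem_lowerOrder {v : ι → E × E} {ord : ι → ℕ} {k s : ℕ}
    {Z : Module.End ℂ (smoothFunctions E F)} (hZ : Z ∈ lowerOrder v ord k s) (i : ι) :
    derivOp (v i) * Z ∈ lowerOrder v ord (k + 1) (ord i + s) := by
  induction hZ using Submodule.span_induction with
  | mem Z hZ =>
    obtain ⟨g, w, rfl, h⟩ := hZ
    have h1 : derivOp (v i) * (mulOp g * iterDeriv v w) =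
        mulOp (derivEnd (v i) g) * iterDeriv v w + mulOp g * iterDeriv v (i ::ₘ w) := by
      ext1 u
      rw [iterDeriv_cons]
      exact derivOp_mulOp (v i) g (iterDeriv v w u)
    rw [h1]
    refine add_mem (mulOp_mul_iterDeriv_mem_lowerOrder _ _ (Or.inl ?_))
      (mulOp_mul_iterDeriv_mem_lowerOrder _ _ ?_)
    · rcases h with h | h
      · exact h.trans (Nat.lt_succ_self k)
      · rw [h.1]; exact Nat.lt_succ_self k
    · rw [Multiset.card_cons, Multiset.map_cons, Multiset.sum_cons]
      rcases h with h | ⟨h, h'⟩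
      · exact Or.inl (by omega)
      · exact Or.inr ⟨by omega, h'.imp id fun h'' ↦ by omega⟩
  | zero => rw [mul_zero]; exact zero_mem _
  | add Z Z' _ _ h h' => rw [mul_add]; exact add_mem h h'
  | smul c Z _ h => rw [mul_smul_comm]; exact Submodule.smul_mem _ c h

/-- The difference of two smooth families of endomorphisms at least in the form needed here. -/
def SmoothEnd.subScalar (g : SmoothEnd E F) (c : ℂ) : SmoothEnd E F :=
  ⟨fun x ↦ g.1 x - c • LinearMap.id, fun y ↦ (g.2 y).sub contDiff_const⟩

theorem mulOp_subScalar (g : SmoothEnd E F) (c : ℂ) :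
    mulOp (g.subScalar c) = mulOp g - c • 1 := by
  ext u x
  rfl

/-- The commutator of ∂_i with the operator is Σ_l (∂_i X_l) ∂_l + ∂_i A. At the origin the matrix
∂_i X_l is triangular with diagonal μ. After μ_i ∂_i is removed, the remaining first order terms
have a coefficient vanishing at 0 or a direction `l` of smaller `ord`; ∂_i A has lower order. -/
theorem mul_iterDeriv_commutator_mem (hX : ContDiff ℝ ∞ X) (A : SmoothEnd E F) (i : ι)
    (w : Multiset ι) :
    (derivOp (fr.vec i) * fieldOp X hX A - fieldOp X hX A * derivOp (fr.vec i) -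
      μ i • derivOp (fr.vec i)) * iterDeriv fr.vec w ∈
      lowerOrder fr.vec fr.ord (w.card + 1) (fr.ord i + (w.map fr.ord).sum) := by
  set g : ι → SmoothEnd E F := fun l ↦
    derivEnd (fr.vec i) (scalarEnd F _ (fr.contDiff_component hX l)) with hg
  have hcomm : derivOp (fr.vec i) * fieldOp X hX A - fieldOp X hX A * derivOp (fr.vec i) =
      ∑ l, mulOp (g l) * derivOp (fr.vec l) + mulOp (derivEnd (fr.vec i) A) := by
    rw [fr.fieldOp_eq, mul_add, add_mul, Finset.mul_sum, Finset.sum_mul]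
    have h1 : ∀ l, derivOp (fr.vec i) * (mulOp (scalarEnd F _ (fr.contDiff_component hX l)) *
        derivOp (fr.vec l)) = mulOp (g l) * derivOp (fr.vec l) +
        mulOp (scalarEnd F _ (fr.contDiff_component hX l)) * derivOp (fr.vec l) *
          derivOp (fr.vec i) := by
      intro l
      ext1 u
      refine (derivOp_mulOp _ _ _).trans ?_
      rw [derivOp_comm]
      rfl
    have h2 : derivOp (fr.vec i) * mulOp A =
        mulOp (derivEnd (fr.vec i) A) + mulOp A * derivOp (fr.vec i) := by
      ext1 u
      exact derivOp_mulOp _ _ _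
    simp only [h1, h2, Finset.sum_add_distrib]
    abel
  have hg0 : ∀ l, (g l).1 0 = (fr.coord l (fderiv ℝ X 0 (fr.vec i).1) +
        Complex.I * fr.coord l (fderiv ℝ X 0 (fr.vec i).2)) • LinearMap.id := by
    intro l
    rw [hg, ← fr.complexDeriv_component hX]
    exact derivEnd_scalarEnd _ _ _ _
  have hsplit : (derivOp (fr.vec i) * fieldOp X hX A - fieldOp X hX A * derivOp (fr.vec i) -
      μ i • derivOp (fr.vec i)) * iterDeriv fr.vec w =
      mulOp ((g i).subScalar (μ i)) * iterDeriv fr.vec (i ::ₘ w) +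
      ∑ l ∈ Finset.univ.erase i, mulOp (g l) * iterDeriv fr.vec (l ::ₘ w) +
      mulOp (derivEnd (fr.vec i) A) * iterDeriv fr.vec w := by
    rw [hcomm, ← Finset.add_sum_erase Finset.univ _ (Finset.mem_univ i), mulOp_subScalar]
    ext1 u
    simp only [iterDeriv_cons, Module.End.mul_apply, LinearMap.add_apply, LinearMap.sub_apply,
      LinearMap.sum_apply, LinearMap.smul_apply, Module.End.one_apply]
    abel
  rw [hsplit]
  refine add_mem (add_mem (mulOp_mul_iterDeriv_mem_lowerOrder _ _ (Or.inr ⟨by simp, Or.inl ?_⟩))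
    (Submodule.sum_mem _ fun l hl ↦ mulOp_mul_iterDeriv_mem_lowerOrder _ _
      (Or.inr ⟨by simp, ?_⟩))) (mulOp_mul_iterDeriv_mem_lowerOrder _ _ (Or.inl (by simp)))
  · change (g i).1 0 - μ i • LinearMap.id = 0
    rw [hg0, fr.diag, sub_self]
  · by_cases hli : fr.ord l < fr.ord i
    · right
      rw [Multiset.map_cons, Multiset.sum_cons]
      omega
    · left
      rw [hg0, fr.triangular l i (Finset.ne_of_mem_erase hl) hli, zero_smul]

/-- Passing from w to i ::ₘ w, the error is ∂_i composed with the error for w, plus the commutator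
error of ∂_i composed with ∂^w. The scalars μ_i add up along the way. -/
theorem iterDeriv_mul_fieldOp_mem (hX : ContDiff ℝ ∞ X) (A : SmoothEnd E F) (w : Multiset ι) :
    iterDeriv fr.vec w * fieldOp X hX A - fieldOp X hX A * iterDeriv fr.vec w -
      (w.map μ).sum • iterDeriv fr.vec w ∈
      lowerOrder fr.vec fr.ord w.card (w.map fr.ord).sum := by
  induction w using Multiset.induction_on with
  | empty =>
    have h : iterDeriv fr.vec 0 * fieldOp X hX A - fieldOp X hX A * iterDeriv fr.vec 0 -
        ((0 : Multiset ι).map μ).sum • iterDeriv fr.vec 0 = 0 := by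
      ext1 u
      simp [iterDeriv_zero, LinearMap.sub_apply]
    rw [h]
    exact zero_mem _
  | cons i w ih =>
    have h1 := derivOp_mul_mem_lowerOrder ih i
    have h2 := mul_iterDeriv_commutator_mem fr hX A i w
    rw [Multiset.card_cons, Multiset.map_cons, Multiset.sum_cons, Multiset.map_cons,
      Multiset.sum_cons]
    convert add_mem h1 h2 using 1
    ext1 u
    simp only [iterDeriv_cons, Module.End.mul_apply, LinearMap.add_apply, LinearMap.sub_apply,
      LinearMap.smul_apply, map_sub, map_smul, add_smul]
    abel

theorem apply_zero_of_mem_lowerOrder {v : ι → E × E} {ord : ι → ℕ} {k s : ℕ}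
    {Z : Module.End ℂ (smoothFunctions E F)} (hZ : Z ∈ lowerOrder v ord k s)
    {u : smoothFunctions E F}
    (hu : ∀ w : Multiset ι, (w.card < k ∨ w.card = k ∧ (w.map ord).sum < s) →
      (iterDeriv v w u : E → F) 0 = 0) : (Z u : E → F) 0 = 0 := by
  induction hZ using Submodule.span_induction with
  | mem Z hZ =>
    obtain ⟨g, w, rfl, h⟩ := hZ
    rw [Module.End.mul_apply, mulOp_apply]
    rcases h with h | ⟨h, h' | h'⟩
    · rw [hu w (Or.inl h), map_zero]
    · rw [h', LinearMap.zero_apply]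
    · rw [hu w (Or.inr ⟨h, h'⟩), map_zero]
  | zero => rfl
  | add Z Z' _ _ h h' => rw [LinearMap.add_apply, Submodule.coe_add, Pi.add_apply, h, h', add_zero]
  | smul c Z _ h => rw [LinearMap.smul_apply, Submodule.coe_smul, Pi.smul_apply, h, smul_zero]

/-- The leading part of the action of `fieldOp` on jets at the zero of the vector field. -/
theorem iterDeriv_fieldOp_apply_zero (hX : ContDiff ℝ ∞ X) (hX0 : X 0 = 0) (A : SmoothEnd E F)
    (w : Multiset ι) {u : smoothFunctions E F}
    (hu : ∀ w' : Multiset ι, (w'.card < w.card ∨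
      w'.card = w.card ∧ (w'.map fr.ord).sum < (w.map fr.ord).sum) →
      (iterDeriv fr.vec w' u : E → F) 0 = 0) :
    (iterDeriv fr.vec w (fieldOp X hX A u) : E → F) 0 =
      A.1 0 ((iterDeriv fr.vec w u : E → F) 0) +
        (w.map μ).sum • (iterDeriv fr.vec w u : E → F) 0 := by
  have h := apply_zero_of_mem_lowerOrder (iterDeriv_mul_fieldOp_mem fr hX A w) hu
  -- Since `X 0 = 0`, the derivative part of the operator applied to ∂^w u drops out at the origin
  -- and only A(0) survives.
  simp only [LinearMap.sub_apply, LinearMap.smul_apply, Module.End.mul_apply, Submodule.coe_sub,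
    Submodule.coe_smul, Pi.sub_apply, Pi.smul_apply, fieldOp_apply, hX0, map_zero, zero_add] at h
  rwa [sub_sub, sub_eq_zero] at h

end

section Monomials

variable {B : E →L[ℝ] E} {μ : ι → ℂ} (fr : FlagFrame B μ)

/-- The vector valued monomial with exponent a multiset. -/
def FlagFrame.monomial (w : Multiset ι) (y : F) : smoothFunctions E F :=
  ⟨fun x ↦ (w.map fun i ↦ fr.coord i x).prod • y, by
    have h : ContDiff ℝ ∞ (fun x ↦ (w.map fun i ↦ fr.coord i x).prod) := by
      induction w using Multiset.induction_on with
      | empty => simpa using contDiff_const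
      | cons i w ih =>
        simp only [Multiset.map_cons, Multiset.prod_cons]
        exact (fr.coord i).contDiff.mul ih
    exact h.smul contDiff_const⟩

theorem FlagFrame.monomial_apply (w : Multiset ι) (y : F) (x : E) :
    (fr.monomial w y : E → F) x = (w.map fun i ↦ fr.coord i x).prod • y := rfl

theorem FlagFrame.monomial_cons (i : ι) (w : Multiset ι) (y : F) :
    fr.monomial (i ::ₘ w) y =
      mulOp (scalarEnd F (fr.coord i) (fr.coord i).contDiff) (fr.monomial w y) := by
  ext x
  rw [fr.monomial_apply, Multiset.map_cons, Multiset.prod_cons, mul_smul]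
  rfl

theorem FlagFrame.derivOp_monomial (i : ι) (w : Multiset ι) (y : F) :
    derivOp (fr.vec i) (fr.monomial w y) = (w.count i : ℂ) • fr.monomial (w.erase i) y := by
  induction w using Multiset.induction_on with
  | empty =>
    ext x
    have : (fr.monomial 0 y : E → F) = fun _ ↦ y := by
      funext x; simp [fr.monomial_apply]
    simp [derivOp_apply, this]
  | cons l w ih =>
    have h0 : mulOp (derivEnd (fr.vec i) (scalarEnd F (fr.coord l) (fr.coord l).contDiff))
        (fr.monomial w y) = (if l = i then (1 : ℂ) else 0) • fr.monomial w y := by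
      ext x
      rw [mulOp_apply, derivEnd_scalarEnd, complexDeriv, (fr.coord l).hasFDerivAt.fderiv,
        smul_eq_mul, fr.dual l i]
      rfl
    rw [fr.monomial_cons, derivOp_mulOp, ih, h0, map_smul]
    by_cases hli : l = i
    · subst hli
      rw [Multiset.count_cons_self, Multiset.erase_cons_head, if_pos rfl, ← fr.monomial_cons]
      by_cases hw : l ∈ w
      · rw [Multiset.cons_erase hw, ← add_smul, Nat.cast_add, Nat.cast_one, add_comm]
      · rw [Multiset.count_eq_zero_of_notMem hw]
        simp
    · rw [if_neg hli, zero_smul, zero_add, Multiset.count_cons_of_ne (Ne.symm hli),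
        Multiset.erase_cons_tail _ hli, fr.monomial_cons]

/-- Evaluated at the origin, monomials and iterated derivatives are dual up to the nonzero product
of factorials of the multiplicities. Each derivative removes one factor and multiplies by its
multiplicity. -/
theorem FlagFrame.iterDeriv_monomial (w' w : Multiset ι) :
    (w' ≠ w → ∀ y : F, (iterDeriv fr.vec w' (fr.monomial w y) : E → F) 0 = 0) ∧
    (w' = w → ∃ c : ℂ, c ≠ 0 ∧
      ∀ y : F, (iterDeriv fr.vec w' (fr.monomial w y) : E → F) 0 = c • y) := by
  induction w' using Multiset.induction_on generalizing w with
  | empty =>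
    constructor
    · intro hw y
      obtain ⟨i, hi⟩ := Multiset.exists_mem_of_ne_zero hw.symm
      rw [iterDeriv_zero, Module.End.one_apply, fr.monomial_apply, Multiset.prod_eq_zero, zero_smul]
      exact Multiset.mem_map.2 ⟨i, hi, map_zero _⟩
    · rintro rfl
      refine ⟨1, one_ne_zero, fun y ↦ ?_⟩
      simp [fr.monomial_apply]
  | cons i w' ih =>
    have h : ∀ y : F, (iterDeriv fr.vec (i ::ₘ w') (fr.monomial w y) : E → F) 0 =
        (w.count i : ℂ) • (iterDeriv fr.vec w' (fr.monomial (w.erase i) y) : E → F) 0 := by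
      intro y
      rw [iterDeriv_cons', Module.End.mul_apply, fr.derivOp_monomial, map_smul]
      rfl
    constructor
    · intro hw y
      rw [h]
      by_cases hi : i ∈ w
      · rw [(ih (w.erase i)).1, smul_zero]
        intro hw'
        exact hw (by rw [hw', Multiset.cons_erase hi])
      · rw [Multiset.count_eq_zero_of_notMem hi, Nat.cast_zero, zero_smul]
    · rintro rfl
      obtain ⟨c, hc, hcy⟩ := (ih ((i ::ₘ w').erase i)).2 (by simp)
      refine ⟨(Multiset.count i (i ::ₘ w') : ℂ) * c, mul_ne_zero ?_ hc, fun y ↦ ?_⟩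
      · rw [Multiset.count_cons_self]
        exact Nat.cast_ne_zero.2 (Nat.succ_ne_zero _)
      · rw [h, hcy, mul_smul]

end Monomials

/-- The functional `u ↦ e_j^*((∂^w u)(0))`. -/
def jetCoord (v : ι → E × E) (c : κ → F →ₗ[ℂ] ℂ) (i : Multiset ι × κ) :
    Module.Dual ℂ (smoothFunctions E F) :=
  c i.2 ∘ₗ (LinearMap.proj (0 : E)) ∘ₗ (smoothFunctions E F).subtype ∘ₗ iterDeriv v i.1

theorem jetCoord_apply (v : ι → E × E) (c : κ → F →ₗ[ℂ] ℂ) (i : Multiset ι × κ)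
    (u : smoothFunctions E F) : jetCoord v c i u = c i.2 ((iterDeriv v i.1 u : E → F) 0) := rfl

/-- The order in which the jet coordinates are solved for. -/
def jetRank (ordE : ι → ℕ) (ordF : κ → ℕ) (i : Multiset ι × κ) : ℕ ×ₗ ℕ ×ₗ ℕ :=
  toLex (i.1.card, toLex ((i.1.map ordE).sum, ordF i.2))

theorem jetRank_lt {ordE : ι → ℕ} {ordF : κ → ℕ} {i j : Multiset ι × κ} :
    jetRank ordE ordF j < jetRank ordE ordF i ↔ j.1.card < i.1.card ∨ j.1.card = i.1.card ∧
      ((j.1.map ordE).sum < (i.1.map ordE).sum ∨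
        (j.1.map ordE).sum = (i.1.map ordE).sum ∧ ordF j.2 < ordF i.2) := by
  simp [jetRank, Prod.Lex.toLex_lt_toLex]

theorem FiberFlag.eq_zero {A : F →ₗ[ℂ] F} {ρ : κ → ℂ} (ff : FiberFlag A ρ) {y : F}
    (h : ∀ j, ff.coord j y = 0) : y = 0 := by
  rw [← ff.sum_coord y]
  exact Finset.sum_eq_zero fun j _ ↦ by rw [h, zero_smul]

theorem finite_setOf_card_le (N : ℕ) : {i : Multiset ι × κ | i.1.card ≤ N}.Finite := by
  have h1 : {w : Multiset ι | w.card ≤ N}.Finite := by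
    refine Set.Finite.of_finite_image (f := fun w i ↦ Multiset.count i w) ?_ ?_
    · refine (Set.Finite.pi' (fun _ : ι ↦ Set.finite_Iic N)).subset ?_
      rintro _ ⟨w, hw, rfl⟩ i
      exact (Multiset.count_le_card i w).trans hw
    · intro w _ w' _ h
      exact Multiset.ext.2 fun i ↦ congrFun h i
  exact (h1.prod (Set.finite_univ (α := κ))).subset fun i hi ↦ ⟨hi, mem_univ _⟩

/-- On jets at the zero of the vector field, `fieldOp` is triangular. -/
theorem exists_isTriangular_fieldOp {X : E → E} (hX : ContDiff ℝ ∞ X) (hX0 : X 0 = 0)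
    (A : SmoothEnd E F) {μ : ι → ℂ} (fr : FlagFrame (fderiv ℝ X 0) μ) {ρ : κ → ℂ}
    (ff : FiberFlag (A.1 0) ρ) :
    ∃ mono, IsTriangular (fieldOp X hX A) (jetCoord fr.vec ff.coord) (jetRank fr.ord ff.ord)
      (fun i ↦ i.1.card) (fun i ↦ (i.1.map μ).sum + ρ i.2) mono := by
  choose c hc hcy using fun w ↦ (fr.iterDeriv_monomial (F := F) w w).2 rfl
  refine ⟨fun i ↦ (c i.1)⁻¹ • fr.monomial i.1 (ff.vec i.2), ?_, ?_, finite_setOf_card_le, ?_, ?_⟩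
  · intro i u hu
    have h1 : ∀ w' : Multiset ι, (w'.card < i.1.card ∨
        w'.card = i.1.card ∧ (w'.map fr.ord).sum < (i.1.map fr.ord).sum) →
        (iterDeriv fr.vec w' u : E → F) 0 = 0 := by
      intro w' hw'
      refine ff.eq_zero fun j ↦ ?_
      refine hu (w', j) (jetRank_lt.2 ?_)
      exact hw'.imp id fun h ↦ ⟨h.1, Or.inl h.2⟩
    rw [jetCoord_apply, jetCoord_apply, iterDeriv_fieldOp_apply_zero fr hX hX0 A i.1 h1, map_add,
      map_smul, smul_eq_mul, add_mul, add_comm]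
    congr 1
    -- In the expansion of `y` along the fibre flag, the coordinates of smaller `ord` vanish because
    -- their jet index has smaller rank. Those of larger or equal `ord` are killed by triangularity
    -- of A(0), except for the diagonal one.
    set y := (iterDeriv fr.vec i.1 u : E → F) 0
    conv_lhs => rw [← ff.sum_coord y]
    rw [map_sum, map_sum, Finset.sum_eq_single i.2]
    · rw [map_smul, map_smul, ff.diag, smul_eq_mul, mul_comm]
    · intro j _ hj
      rw [map_smul, map_smul, smul_eq_mul]
      by_cases hord : ff.ord j < ff.ord i.2
      · have := hu (i.1, j) (jetRank_lt.2 (Or.inr ⟨rfl, Or.inr ⟨rfl, hord⟩⟩))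
        rw [jetCoord_apply] at this
        rw [this, zero_mul]
      · rw [ff.triangular i.2 j hj.symm hord, mul_zero]
    · simp
  · intro i j h
    rcases jetRank_lt.1 h with h | h
    · exact h.le
    · exact h.1.le
  · intro i
    rw [map_smul, jetCoord_apply, hcy, map_smul, ff.dual, if_pos rfl, smul_eq_mul, smul_eq_mul,
      mul_one, inv_mul_cancel₀ (hc _)]
  · intro i j hij
    rw [map_smul, jetCoord_apply]
    by_cases hw : i.1 = j.1
    · rw [hw, hcy, map_smul, ff.dual, if_neg, smul_zero, smul_zero]
      exact fun h ↦ hij (Prod.ext hw h)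
    · rw [(fr.iterDeriv_monomial i.1 j.1).1 hw, map_zero, smul_zero]

/-- A smooth function all of whose derivatives of order less than `N` vanish at the origin vanishes
there to order `N`. -/
theorem isBigO_of_iterDeriv_eq_zero {B : E →L[ℝ] E} {μ : ι → ℂ} (fr : FlagFrame B μ) (N : ℕ)
    (u : smoothFunctions E F)
    (h : ∀ w : Multiset ι, w.card < N → (iterDeriv fr.vec w u : E → F) 0 = 0) :
    (u : E → F) =O[𝓝 0] fun x ↦ ‖x‖ ^ N := by
  induction N generalizing u with
  | zero =>
    simp only [pow_zero]
    exact (contDiff_coe u).continuous.continuousAt.norm.isBoundedUnder_le.isBigO_one ℝ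
  | succ N ih =>
    have h1 : ∀ i, (derivOp (fr.vec i) u : E → F) =O[𝓝 0] fun x ↦ ‖x‖ ^ N := by
      intro i
      refine ih _ fun w hw ↦ ?_
      have := h (i ::ₘ w) (by simpa using hw)
      rwa [iterDeriv_cons'] at this
    -- The frame derivatives control the whole real derivative. The induction hypothesis applies to
    -- each of them, and the mean value inequality on the segment from 0 gains one order.
    have h2 : fderiv ℝ (u : E → F) =O[𝓝 0] fun x ↦ ‖x‖ ^ N := by
      have h3 : ∀ x, ‖fderiv ℝ (u : E → F) x‖ ≤
          ∑ i, ‖fr.coord i‖ * ‖(derivOp (fr.vec i) u : E → F) x‖ := by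
        intro x
        refine ContinuousLinearMap.opNorm_le_bound _ (by positivity) fun y ↦ ?_
        rw [fr.map_eq_sum (fderiv ℝ (u : E → F) x) y, Finset.sum_mul]
        refine (norm_sum_le _ _).trans (Finset.sum_le_sum fun i _ ↦ ?_)
        rw [norm_smul, mul_right_comm]
        exact mul_le_mul_of_nonneg_right ((fr.coord i).le_opNorm y) (norm_nonneg _)
      refine (Asymptotics.IsBigO.of_norm_le (g := fun x ↦
        ∑ i, ‖fr.coord i‖ * ‖(derivOp (fr.vec i) u : E → F) x‖) h3).trans ?_
      exact Asymptotics.IsBigO.fun_sum fun i _ ↦ (h1 i).norm_left.const_mul_left _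
    obtain ⟨C, hC0, hC⟩ := h2.exists_nonneg
    have hC := hC.bound
    rw [Metric.eventually_nhds_iff_ball] at hC
    obtain ⟨δ, hδ, hCδ⟩ := hC
    refine Asymptotics.IsBigO.of_bound C ?_
    filter_upwards [Metric.ball_mem_nhds (0 : E) hδ] with x hx
    have hu0 : (u : E → F) 0 = 0 := h 0 (by simp)
    have hseg : ∀ z ∈ segment ℝ 0 x, ‖fderiv ℝ (u : E → F) z‖ ≤ C * ‖x‖ ^ N := by
      intro z hz
      have hzx : ‖z‖ ≤ ‖x‖ := by
        rw [segment_eq_image'] at hz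
        obtain ⟨s, hs, rfl⟩ := hz
        simp only [zero_add, sub_zero, norm_smul, Real.norm_of_nonneg hs.1]
        exact mul_le_of_le_one_left (norm_nonneg _) hs.2
      have := hCδ z (by rw [mem_ball_zero_iff] at hx ⊢; exact hzx.trans_lt hx)
      rw [norm_pow, norm_norm] at this
      exact this.trans (by gcongr)
    have key := (convex_segment (𝕜 := ℝ) (0 : E) x).norm_image_sub_le_of_norm_hasFDerivWithin_le
      (f := (u : E → F)) (fun z _ ↦
        ((contDiff_coe u).differentiable (by simp) z).hasFDerivAt.hasFDerivWithinAt) hseg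
      (left_mem_segment ℝ _ _) (right_mem_segment ℝ _ _)
    rw [hu0, sub_zero, sub_zero] at key
    rw [norm_pow, norm_norm, pow_succ, ← mul_assoc]
    exact key

end TransportJets

/-! ### Triangular bases with a prescribed diagonal -/

section Triangularization

/-- An endomorphism of a finite-dimensional complex vector space is (lower) triangular in a suitable
basis. -/
theorem exists_basis_triangular {W : Type*} [AddCommGroup W] [Module ℂ W] [FiniteDimensional ℂ W]
    (f : Module.End ℂ W) {n : ℕ} (hn : Module.finrank ℂ W = n) :
    ∃ b : Module.Basis (Fin n) ℂ W, ∀ i j, i < j → b.repr (f (b j)) i = 0 := by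
  induction n generalizing W with
  | zero => exact ⟨Module.finBasisOfFinrankEq ℂ W hn, fun i ↦ i.elim0⟩
  | succ n ih =>
    have hnt : Nontrivial W := Module.nontrivial_of_finrank_pos (R := ℂ) (by omega)
    -- An eigenvector ξ of the transpose has an `f`-invariant kernel of codimension one. A
    -- triangular basis of the kernel is completed by a vector placed in front of it.
    obtain ⟨c, hc⟩ := Module.End.exists_eigenvalue (Module.Dual.transpose (R := ℂ) f)
    obtain ⟨ξ, hξ⟩ := hc.exists_hasEigenvector
    have hξf : ∀ x, ξ (f x) = c * ξ x := fun x ↦ LinearMap.congr_fun hξ.apply_eq_smul x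
    obtain ⟨y, hy⟩ : ∃ y, ξ y ≠ 0 := by
      by_contra! h
      exact hξ.2 (LinearMap.ext h)
    have hinv : ∀ x ∈ LinearMap.ker ξ, f x ∈ LinearMap.ker ξ := by
      intro x hx
      rw [LinearMap.mem_ker] at hx ⊢
      rw [hξf, hx, mul_zero]
    have hdim : Module.finrank ℂ (LinearMap.ker ξ) = n := by
      have h1 := LinearMap.finrank_range_add_finrank_ker ξ
      have h2 : LinearMap.range ξ = ⊤ := LinearMap.range_eq_top.2
        (LinearMap.surjective (fun h ↦ hy (by rw [h]; rfl)))
      rw [h2, finrank_top, Module.finrank_self, hn] at h1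
      omega
    obtain ⟨b, hb⟩ := ih (f.restrict hinv) hdim
    have hli : ∀ (a : ℂ), ∀ x ∈ LinearMap.ker ξ, a • y + x = 0 → a = 0 := by
      intro a x hx h
      have h1 := congrArg ξ h
      rw [map_add, map_smul, LinearMap.mem_ker.1 hx, add_zero, map_zero, smul_eq_mul] at h1
      exact (mul_eq_zero.1 h1).resolve_right hy
    have hsp : ∀ z : W, ∃ a : ℂ, z + a • y ∈ LinearMap.ker ξ := by
      intro z
      refine ⟨-(ξ z / ξ y), ?_⟩
      rw [LinearMap.mem_ker, map_add, map_smul, smul_eq_mul, neg_mul, div_mul_cancel₀ _ hy,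
        add_neg_cancel]
    let b' := Module.Basis.mkFinCons y b hli hsp
    have hb'0 : b' 0 = y := by simp [b', Module.Basis.coe_mkFinCons]
    have hb's : ∀ j, b' (Fin.succ j) = b j := fun j ↦ by
      simp [b', Module.Basis.coe_mkFinCons]
    have hrepr : ∀ x : LinearMap.ker ξ, (b'.repr x : Fin (n + 1) → ℂ) =
        Fin.cons 0 (b.repr x : Fin n → ℂ) := by
      intro x
      have h1 : (x : W) = ∑ i : Fin (n + 1), (Fin.cons 0 (b.repr x : Fin n → ℂ) :
          Fin (n + 1) → ℂ) i • b' i := by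
        rw [Fin.sum_univ_succ]
        simp only [Fin.cons_zero, zero_smul, zero_add, Fin.cons_succ, hb's]
        conv_lhs => rw [← b.sum_repr x, Submodule.coe_sum]
        rfl
      rw [h1, Module.Basis.repr_sum_self]
    refine ⟨b', fun i j hij ↦ ?_⟩
    obtain ⟨j, rfl⟩ := Fin.exists_succ_eq.2 (Fin.ne_zero_of_lt hij)
    have h1 : f (b' j.succ) = (f.restrict hinv (b j) : W) := by rw [hb's]; rfl
    rw [h1, hrepr]
    refine Fin.cases ?_ (fun i hij ↦ ?_) i hij
    · intro _; rfl
    · rw [Fin.cons_succ]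
      exact hb i j (Fin.succ_lt_succ_iff.1 hij)

theorem exists_equiv_of_map_univ_eq {α β γ : Type*} [Fintype α] [Fintype β] {f : α → γ} {g : β → γ}
    (h : Finset.univ.val.map f = Finset.univ.val.map g) : ∃ e : α ≃ β, ∀ a, g (e a) = f a := by
  classical
  have h1 : ∀ c, Fintype.card {a // f a = c} = Fintype.card {b // g b = c} := by
    intro c
    have h2 := congrArg (Multiset.count c) h
    rw [Multiset.count_map, Multiset.count_map] at h2
    rw [Fintype.card_subtype, Fintype.card_subtype]
    simpa only [eq_comm, Finset.card_def, Finset.filter_val] using h2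
  exact ⟨Equiv.ofFiberEquiv fun c ↦ Fintype.equivOfCardEq (h1 c),
    fun a ↦ Equiv.ofFiberEquiv_map _ a⟩

/-- Triangular form with a prescribed enumeration of the eigenvalues along the diagonal. -/
theorem exists_basis_triangular_diag {W : Type*} [AddCommGroup W] [Module ℂ W]
    [FiniteDimensional ℂ W] (f : Module.End ℂ W) {n : ℕ} (hn : Module.finrank ℂ W = n)
    {μ : Fin n → ℂ} (hμ : Finset.univ.val.map μ = (LinearMap.charpoly f).roots) :
    ∃ (b : Module.Basis (Fin n) ℂ W) (ord : Fin n → ℕ), (∀ i, b.repr (f (b i)) i = μ i) ∧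
      ∀ i j, i ≠ j → ¬ ord j < ord i → b.repr (f (b j)) i = 0 := by
  obtain ⟨b, hb⟩ := exists_basis_triangular f hn
  have h1 : (LinearMap.charpoly f).roots = Finset.univ.val.map fun i ↦ b.repr (f (b i)) i := by
    rw [← LinearMap.charpoly_toMatrix f b, ← Matrix.charpoly_transpose,
      Matrix.charpoly_of_isUpperTriangular]
    · rw [Finset.prod_eq_multiset_prod]
      simp only [Matrix.transpose_apply, LinearMap.toMatrix_apply]
      exact Polynomial.roots_multiset_prod_X_sub_C
        (Finset.univ.val.map fun i ↦ b.repr (f (b i)) i) ▸ by rw [Multiset.map_map]; rfl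
    · intro i j hij
      rw [Matrix.transpose_apply, LinearMap.toMatrix_apply]
      exact hb j i hij
  -- The diagonal is a rearrangement of `μ`. After reindexing it equals `μ`, and `ord` records the
  -- positions in the triangular basis.
  obtain ⟨e, he⟩ := exists_equiv_of_map_univ_eq (hμ.trans h1)
  refine ⟨b.reindex e.symm, fun i ↦ (e i : ℕ), fun i ↦ ?_, fun i j hij hord ↦ ?_⟩
  · simp [he]
  · simp only [Module.Basis.reindex_apply, Equiv.symm_symm, Module.Basis.repr_reindex_apply]
    refine hb _ _ (lt_of_le_of_ne (not_lt.1 hord) fun h ↦ hij (e.injective h))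

theorem nonempty_fiberFlag {F : Type*} [NormedAddCommGroup F] [NormedSpace ℂ F]
    [FiniteDimensional ℂ F] (A : F →ₗ[ℂ] F) {m : ℕ} (hm : Module.finrank ℂ F = m) {ρ : Fin m → ℂ}
    (hρ : Finset.univ.val.map ρ = (LinearMap.charpoly A).roots) : Nonempty (FiberFlag A ρ) := by
  obtain ⟨b, ord, hd, ht⟩ := exists_basis_triangular_diag A hm hρ
  exact ⟨{
    vec := b
    coord := fun i ↦ b.coord i
    ord := ord
    sum_coord := fun y ↦ b.sum_repr y
    dual := fun l i ↦ by simp [Finsupp.single_apply, eq_comm]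
    diag := hd
    triangular := ht }⟩

/-- A real matrix of `B` is triangularized over ℂ on ℂ^n. There `inc` embeds `E` as the real
vectors, while `reV` and `imV` return the real and imaginary parts of a complex vector as elements
of `E`; these describe the complex basis vectors without forming a tensor product. -/
theorem nonempty_flagFrame {E : Type*} [NormedAddCommGroup E] [NormedSpace ℝ E]
    [FiniteDimensional ℝ E] (B : E →L[ℝ] E) {n : ℕ} (hn : Module.finrank ℝ E = n) {μ : Fin n → ℂ}
    (hμ : Finset.univ.val.map μ = (LinearMap.charpoly B.toLinearMap).aroots ℂ) :
    Nonempty (FlagFrame B μ) := by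
  let e := Module.finBasisOfFinrankEq ℝ E hn
  let M := LinearMap.toMatrix e e B.toLinearMap
  let f : Module.End ℂ (Fin n → ℂ) := Matrix.toLin' (M.map (algebraMap ℝ ℂ))
  have hf : (LinearMap.charpoly f).roots = (LinearMap.charpoly B.toLinearMap).aroots ℂ := by
    rw [Matrix.charpoly_toLin', Matrix.charpoly_map, LinearMap.charpoly_toMatrix]
  obtain ⟨b, ord, hd, ht⟩ := exists_basis_triangular_diag f (by simp) (hμ.trans hf.symm)
  let reV : (Fin n → ℂ) →ₗ[ℝ] E :=
    ∑ k, (Complex.reLm.comp (LinearMap.proj (R := ℝ) k)).smulRight (e k)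
  let imV : (Fin n → ℂ) →ₗ[ℝ] E :=
    ∑ k, (Complex.imLm.comp (LinearMap.proj (R := ℝ) k)).smulRight (e k)
  have hreV : ∀ z, reV z = ∑ k, (z k).re • e k := fun z ↦ by simp [reV, LinearMap.sum_apply]
  have himV : ∀ z, imV z = ∑ k, (z k).im • e k := fun z ↦ by simp [imV, LinearMap.sum_apply]
  let inc : E →ₗ[ℝ] (Fin n → ℂ) := LinearMap.pi fun k ↦ Complex.ofRealCLM.toLinearMap.comp (e.coord k)
  have hinc : ∀ x k, inc x k = (e.repr x k : ℂ) := fun x k ↦ rfl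
  have hre : ∀ z k, e.repr (reV z) k = (z k).re := fun z k ↦ by
    rw [hreV, e.repr_sum_self]
  have him : ∀ z k, e.repr (imV z) k = (z k).im := fun z k ↦ by
    rw [himV, e.repr_sum_self]
  have hsplit : ∀ z, inc (reV z) + Complex.I • inc (imV z) = z := by
    intro z
    funext k
    rw [Pi.add_apply, Pi.smul_apply, hinc, hinc, hre, him, smul_eq_mul, mul_comm,
      Complex.re_add_im]
  have hincB : ∀ x, inc (B x) = f (inc x) := by
    intro x
    funext k
    have h1 : e.repr (B x) k = ∑ l, M k l * e.repr x l := by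
      have := congrFun (LinearMap.toMatrix_mulVec_repr e e B.toLinearMap x) k
      exact this.symm
    simp only [f, Matrix.toLin'_apply, Matrix.mulVec, dotProduct, hinc, h1, Matrix.map_apply]
    push_cast
    rfl
  have hreinc : ∀ x, reV (inc x) = x := by
    intro x
    rw [hreV]
    simp only [hinc, Complex.ofReal_re]
    exact e.sum_repr x
  have himinc : ∀ x, imV (inc x) = 0 := by
    intro x
    rw [himV]
    simp only [hinc, Complex.ofReal_im, zero_smul, Finset.sum_const_zero]
  have hre_smul : ∀ (c : ℂ) z, reV (c • z) = c.re • reV z - c.im • imV z := by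
    intro c z
    simp only [hreV, himV, Finset.smul_sum, ← Finset.sum_sub_distrib, smul_smul, ← sub_smul]
    simp
  have him_smul : ∀ (c : ℂ) z, imV (c • z) = c.re • imV z + c.im • reV z := by
    intro c z
    simp only [hreV, himV, Finset.smul_sum, ← Finset.sum_add_distrib, smul_smul, ← add_smul]
    simp
  have hcoord : ∀ l z z', b.repr z l + Complex.I * b.repr z' l =
      b.repr (z + Complex.I • z') l := fun l z z' ↦ by simp
  exact ⟨{
    vec := fun i ↦ (reV (b i), imV (b i))
    coord := fun i ↦ LinearMap.toContinuousLinearMap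
      (((b.coord i).restrictScalars ℝ).comp inc)
    -- The order is reversed: derivatives transform by the transpose of `B`, so `FlagFrame` asks for
    -- the opposite triangularity to `FiberFlag`.
    ord := fun i ↦ Finset.univ.sup ord - ord i
    sum_re := fun x ↦ by
      change ∑ i, ((b.repr (inc x) i).re • reV (b i) - (b.repr (inc x) i).im • imV (b i)) = x
      simp only [← hre_smul]
      rw [← map_sum, b.sum_repr, hreinc]
    sum_im := fun x ↦ by
      change ∑ i, ((b.repr (inc x) i).re • imV (b i) + (b.repr (inc x) i).im • reV (b i)) = 0
      simp only [← him_smul]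
      rw [← map_sum, b.sum_repr, himinc]
    dual := fun l i ↦ by
      change b.repr (inc (reV (b i))) l + Complex.I * b.repr (inc (imV (b i))) l = _
      rw [hcoord, hsplit, b.repr_self, Finsupp.single_apply]
      simp only [eq_comm]
    diag := fun i ↦ by
      change b.repr (inc (B (reV (b i)))) i + Complex.I * b.repr (inc (B (imV (b i)))) i = _
      rw [hincB, hincB, hcoord, ← map_smul, ← map_add, hsplit, hd]
    triangular := fun l i hli hord ↦ by
      change b.repr (inc (B (reV (b i)))) l + Complex.I * b.repr (inc (B (imV (b i)))) l = _
      rw [hincB, hincB, hcoord, ← map_smul, ← map_add, hsplit]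
      refine ht l i hli fun h ↦ hord ?_
      have h1 := Finset.le_sup (f := ord) (Finset.mem_univ l)
      omega }⟩

end Triangularization

/-! ### A Lyapunov function at the source -/

section Lyapunov

variable {E : Type*} [NormedAddCommGroup E] [NormedSpace ℝ E] [FiniteDimensional ℝ E]
  {ι : Type*} [Fintype ι] [DecidableEq ι]

/-- A linear map `W` such that `‖W x‖` grows exponentially along the linear flow of `B`. -/
theorem FlagFrame.exists_lyapunov {B : E →L[ℝ] E} {μ : ι → ℂ} (fr : FlagFrame B μ)
    (hμ : ∀ i, 0 < (μ i).re) :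
    ∃ (W : E →L[ℝ] EuclideanSpace ℂ ι) (c : ℝ), 0 < c ∧ Function.Injective W ∧
      ∀ x, c * ‖W x‖ ^ 2 ≤ inner ℝ (W x) (W (B x)) := by
  obtain ⟨c, hc, hcμ⟩ : ∃ c : ℝ, 0 < c ∧ ∀ i, c ≤ (μ i).re := by
    cases isEmpty_or_nonempty ι
    · exact ⟨1, one_pos, fun i ↦ isEmptyElim i⟩
    · obtain ⟨i, hi⟩ := Finite.exists_min fun i ↦ (μ i).re
      exact ⟨(μ i).re, hμ i, hi⟩
  let τ : ι → ι → ℂ := fun i l ↦ fr.coord i (B (fr.vec l).1) + Complex.I • fr.coord i (B (fr.vec l).2)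
  have hτ : ∀ i x, fr.coord i (B x) = ∑ l, fr.coord l x * τ i l := fun i x ↦
    fr.map_eq_sum ((fr.coord i).comp B) x
  obtain ⟨K, hK⟩ : ∃ K : ℝ, ∀ i l, ‖τ i l‖ ≤ K := by
    obtain ⟨K, hK⟩ := (Set.finite_range fun p : ι × ι ↦ ‖τ p.1 p.2‖).bddAbove
    exact ⟨K, fun i l ↦ hK ⟨(i, l), rfl⟩⟩
  -- An off-diagonal entry (i, l) is nonzero only if `ord i < ord l`. Rescaling the coordinate `i`
  -- by `L ^ ord i` therefore divides the off-diagonal part by at least `L`. This `L` makes its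
  -- total contribution at most `c / 2`, half of the diagonal growth.
  set L : ℝ := max 1 (2 * |K| * Fintype.card ι / c) with hL
  have hL1 : 1 ≤ L := le_max_left _ _
  have hL0 : 0 < L := by positivity
  have hLK : |K| / L * Fintype.card ι ≤ c / 2 := by
    have h1 : 2 * |K| * Fintype.card ι / c ≤ L := le_max_right _ _
    rw [div_le_iff₀ hc] at h1
    rw [div_mul_eq_mul_div, div_le_iff₀ hL0]
    linarith
  let W : E →L[ℝ] EuclideanSpace ℂ ι :=
    (PiLp.continuousLinearEquiv 2 ℝ fun _ : ι ↦ ℂ).symm.toContinuousLinearMap.comp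
      (ContinuousLinearMap.pi fun i ↦ L ^ fr.ord i • fr.coord i)
  have hW : ∀ x i, W x i = (L ^ fr.ord i : ℝ) • fr.coord i x := fun x i ↦ rfl
  refine ⟨W, c / 2, by positivity, ?_, ?_⟩
  · rw [injective_iff_map_eq_zero]
    intro x hx
    rw [← fr.sum_re x]
    refine Finset.sum_eq_zero fun i _ ↦ ?_
    have h1 : fr.coord i x = 0 := by
      have h2 := hW x i
      rw [hx] at h2
      exact (smul_eq_zero.1 h2.symm).resolve_left (by positivity)
    rw [h1]
    simp
  · intro x
    have hinner : inner ℝ (W x) (W (B x)) = ∑ i, inner ℝ (W x i) (W (B x) i) := PiLp.inner_apply _ _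
    have hi : ∀ i, c * ‖W x i‖ ^ 2 - |K| / L * (‖W x i‖ * ∑ l, ‖W x l‖) ≤
        inner ℝ (W x i) (W (B x) i) := by
      intro i
      have h1 : W (B x) i = μ i * W x i +
          ∑ l ∈ Finset.univ.erase i, (L ^ fr.ord i : ℝ) • (fr.coord l x * τ i l) := by
        rw [hW, hτ, Finset.smul_sum, ← Finset.add_sum_erase Finset.univ _ (Finset.mem_univ i)]
        congr 1
        have h2 : τ i i = μ i := fr.diag i
        rw [h2, hW, mul_smul_comm, mul_comm]
      have h3 : ‖∑ l ∈ Finset.univ.erase i, (L ^ fr.ord i : ℝ) • (fr.coord l x * τ i l)‖ ≤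
          |K| / L * ∑ l, ‖W x l‖ := by
        refine (norm_sum_le _ _).trans ?_
        rw [Finset.mul_sum]
        refine (Finset.sum_le_sum fun l hl ↦ ?_).trans
          (Finset.sum_le_sum_of_subset_of_nonneg (Finset.subset_univ _) fun l _ _ ↦ by positivity)
        rw [norm_smul, norm_mul, Real.norm_of_nonneg (by positivity)]
        by_cases hord : fr.ord i < fr.ord l
        · rw [hW, norm_smul, Real.norm_of_nonneg (by positivity)]
          have h4 : L ^ fr.ord i * L ≤ L ^ fr.ord l := by
            rw [← pow_succ]
            exact pow_le_pow_right₀ hL1 hord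
          rw [div_mul_eq_mul_div, le_div_iff₀ hL0]
          calc L ^ fr.ord i * (‖fr.coord l x‖ * ‖τ i l‖) * L
              = (L ^ fr.ord i * L) * ‖fr.coord l x‖ * ‖τ i l‖ := by ring
            _ ≤ L ^ fr.ord l * ‖fr.coord l x‖ * |K| := by
              gcongr
              exact (hK i l).trans (le_abs_self K)
            _ = _ := by ring
        · have h5 : τ i l = 0 := fr.triangular i l (Finset.ne_of_mem_erase hl).symm hord
          rw [h5, norm_zero, mul_zero, mul_zero]
          positivity
      rw [h1, inner_add_right]
      have h6 : inner ℝ (W x i) (μ i * W x i) = (μ i).re * ‖W x i‖ ^ 2 := by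
        rw [Complex.inner, mul_assoc, Complex.mul_conj, ← Complex.sq_norm,
          Complex.re_mul_ofReal]
      rw [h6]
      have h7 := abs_le.1 (abs_real_inner_le_norm (W x i)
        (∑ l ∈ Finset.univ.erase i, (L ^ fr.ord i : ℝ) • (fr.coord l x * τ i l)))
      have h8 := mul_le_mul_of_nonneg_left h3 (norm_nonneg (W x i))
      have h9 := mul_le_mul_of_nonneg_right (hcμ i) (sq_nonneg ‖W x i‖)
      linarith [h7.1]
    have hsum := Finset.sum_le_sum fun i (_ : i ∈ Finset.univ) ↦ hi i
    rw [← hinner, Finset.sum_sub_distrib, ← Finset.mul_sum, ← Finset.mul_sum, ← Finset.sum_mul,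
      ← sq] at hsum
    have hnorm : ‖W x‖ ^ 2 = ∑ i, ‖W x i‖ ^ 2 := EuclideanSpace.norm_sq_eq _
    rw [← hnorm] at hsum
    have h10 : (∑ i, ‖W x i‖) ^ 2 ≤ Fintype.card ι * ‖W x‖ ^ 2 := by
      rw [hnorm]
      exact sq_sum_le_card_mul_sum_sq
    have h11 : |K| / L * (∑ i, ‖W x i‖) ^ 2 ≤ c / 2 * ‖W x‖ ^ 2 := by
      refine (mul_le_mul_of_nonneg_left h10 (by positivity)).trans ?_
      rw [← mul_assoc]
      exact mul_le_mul_of_nonneg_right hLK (sq_nonneg _)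
    linarith

/-- A Lyapunov function `‖W x‖` near a source at the origin of the vector field `X`. -/
structure SourceRegion (ι : Type*) [Fintype ι] (X : E → E) where
  W : E →L[ℝ] EuclideanSpace ℂ ι
  r : ℝ
  c : ℝ
  K : ℝ
  r_pos : 0 < r
  c_pos : 0 < c
  K_pos : 0 < K
  norm_le : ∀ x, ‖x‖ ≤ K * ‖W x‖
  growth : ∀ x, ‖W x‖ < r → c * ‖W x‖ ^ 2 ≤ inner ℝ (W x) (W (X x))

/-- The nonlinear remainder of `X` is o(‖x‖), so on a small sublevel set it consumes at most half of
the growth rate of the linear part. -/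
theorem FlagFrame.nonempty_sourceRegion {X : E → E} (hX : ContDiff ℝ ∞ X) (hX0 : X 0 = 0)
    {μ : ι → ℂ} (fr : FlagFrame (fderiv ℝ X 0) μ) (hμ : ∀ i, 0 < (μ i).re) :
    Nonempty (SourceRegion ι X) := by
  obtain ⟨W, c, hc, hW, hWc⟩ := fr.exists_lyapunov hμ
  obtain ⟨K, hK, hKW⟩ := W.toLinearMap.exists_antilipschitzWith (LinearMap.ker_eq_bot.2 hW)
  have hK' : (0 : ℝ) < K := hK
  have hnorm : ∀ x, ‖x‖ ≤ K * ‖W x‖ := fun x ↦ hKW.le_mul_norm (map_zero W) x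
  have hd := (hX.differentiable (by simp) 0).hasFDerivAt
  rw [hasFDerivAt_iff_isLittleO_nhds_zero] at hd
  have hε : 0 < c / 2 / ((‖W‖ + 1) * K) := by positivity
  have h1 := hd.def hε
  rw [Metric.eventually_nhds_iff_ball] at h1
  obtain ⟨δ, hδ, h1⟩ := h1
  refine ⟨⟨W, δ / K, c / 2, K, by positivity, by positivity, hK', hnorm, fun x hx ↦ ?_⟩⟩
  have hxδ : x ∈ Metric.ball (0 : E) δ := by
    rw [mem_ball_zero_iff]
    rw [lt_div_iff₀ hK'] at hx
    linarith [hnorm x]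
  have h2 := h1 x hxδ
  rw [zero_add, hX0, sub_zero] at h2
  have h3 : W (X x) = W (fderiv ℝ X 0 x) + W (X x - fderiv ℝ X 0 x) := by
    rw [← map_add, add_sub_cancel]
  rw [h3, inner_add_right]
  have h4 := (abs_le.1 (abs_real_inner_le_norm (W x) (W (X x - fderiv ℝ X 0 x)))).1
  have h5 : ‖W (X x - fderiv ℝ X 0 x)‖ ≤ c / 2 * ‖W x‖ := by
    calc ‖W (X x - fderiv ℝ X 0 x)‖ ≤ (‖W‖ + 1) * (c / 2 / ((‖W‖ + 1) * K) * (K * ‖W x‖)) := by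
          refine (W.le_opNorm _).trans ?_
          gcongr
          · linarith
          · exact h2.trans (by gcongr; exact hnorm x)
      _ = c / 2 * ‖W x‖ := by field_simp
  have h6 := mul_le_mul_of_nonneg_left h5 (norm_nonneg (W x))
  have h7 := hWc x
  nlinarith

set_option linter.unusedSectionVars false in
-- The growth condition says exactly that ‖W γ(t)‖² exp(-2ct) is nondecreasing. Read backwards in
-- time, this is exponential contraction towards the source.
theorem SourceRegion.norm_le_exp_mul {ι : Type*} [Fintype ι] {X : E → E} (S : SourceRegion ι X)
    {γ : ℝ → E} {a b : ℝ} (hab : a ≤ b)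
    (hγ : ∀ t ∈ Icc a b, HasDerivWithinAt γ (X (γ t)) (Icc a b) t)
    (hr : ∀ t ∈ Icc a b, ‖S.W (γ t)‖ < S.r) :
    ‖S.W (γ a)‖ ≤ Real.exp (-S.c * (b - a)) * ‖S.W (γ b)‖ := by
  let h : ℝ → ℝ := fun t ↦ ‖S.W (γ t)‖ ^ 2 * Real.exp (-2 * S.c * t)
  have hd : ∀ t ∈ Icc a b, HasDerivWithinAt h
      (2 * inner ℝ (S.W (γ t)) (S.W (X (γ t))) * Real.exp (-2 * S.c * t) +
        ‖S.W (γ t)‖ ^ 2 * (Real.exp (-2 * S.c * t) * (-2 * S.c))) (Icc a b) t := by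
    intro t ht
    have h1 : HasDerivWithinAt (fun t ↦ S.W (γ t)) (S.W (X (γ t))) (Icc a b) t :=
      S.W.hasFDerivAt.comp_hasDerivWithinAt t (hγ t ht)
    have h2 : HasDerivAt (fun t ↦ Real.exp (-2 * S.c * t)) (Real.exp (-2 * S.c * t) * (-2 * S.c)) t := by
      have := (hasDerivAt_id t).const_mul (-2 * S.c)
      rw [mul_one] at this
      exact this.exp
    exact h1.norm_sq.mul h2.hasDerivWithinAt
  have hmono : MonotoneOn h (Icc a b) := by
    refine monotoneOn_of_deriv_nonneg (convex_Icc a b)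
      (fun t ht ↦ (hd t ht).continuousWithinAt) ?_ ?_
    · intro t ht
      rw [interior_Icc] at ht ⊢
      exact ((hd t (Ioo_subset_Icc_self ht)).mono Ioo_subset_Icc_self).differentiableWithinAt
    · intro t ht
      rw [interior_Icc] at ht
      rw [((hd t (Ioo_subset_Icc_self ht)).hasDerivAt (Icc_mem_nhds ht.1 ht.2)).deriv]
      have h1 := S.growth (γ t) (hr t (Ioo_subset_Icc_self ht))
      have h2 := mul_le_mul_of_nonneg_right h1 (Real.exp_pos (-2 * S.c * t)).le
      linarith
  have h1 := hmono (left_mem_Icc.2 hab) (right_mem_Icc.2 hab) hab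
  have h2 : ‖S.W (γ a)‖ ^ 2 ≤ (Real.exp (-S.c * (b - a)) * ‖S.W (γ b)‖) ^ 2 := by
    have h3 := mul_le_mul_of_nonneg_right h1 (Real.exp_pos (2 * S.c * a)).le
    simp only [h] at h3
    rw [mul_assoc (_ ^ 2), ← Real.exp_add, mul_assoc (_ ^ 2), ← Real.exp_add] at h3
    have e1 : -2 * S.c * a + 2 * S.c * a = 0 := by ring
    have e2 : -2 * S.c * b + 2 * S.c * a = -S.c * (b - a) + -S.c * (b - a) := by ring
    rw [e1, e2, Real.exp_zero, mul_one, Real.exp_add] at h3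
    linarith
  exact le_of_sq_le_sq h2 (by positivity)

end Lyapunov

/-! ### From approximate to exact smooth fixed points of a weighted pullback -/

section FixedPoint

variable {E : Type*} [NormedAddCommGroup E]

theorem isBigO_norm_pow_of_le {m n : ℕ} (h : m ≤ n) :
    (fun x : E ↦ ‖x‖ ^ n) =O[𝓝 0] fun x ↦ ‖x‖ ^ m := by
  refine Asymptotics.IsBigO.of_bound 1 ?_
  filter_upwards [Metric.ball_mem_nhds (0 : E) one_pos] with x hx
  rw [mem_ball_zero_iff] at hx
  rw [norm_pow, norm_norm, norm_pow, norm_norm, one_mul]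
  exact pow_le_pow_of_le_one (norm_nonneg _) hx.le h

variable [NormedSpace ℝ E] [FiniteDimensional ℝ E] {G : Type*} [NormedAddCommGroup G] [NormedSpace ℝ G]
  {φ : E → E} {R : E → G →L[ℝ] G}

theorem weightedPullback_iterate_sub (g h : E → G) (n : ℕ) (x : E) :
    (weightedPullback φ R)^[n] (g - h) x =
      (weightedPullback φ R)^[n] g x - (weightedPullback φ R)^[n] h x := by
  have h1 := weightedPullback_iterate_add (φ := φ) (R := R) (g - h) h n x
  rw [sub_add_cancel] at h1
  rw [h1, add_sub_cancel_right]

theorem weightedPullback_iterate_eq_add_sum (u : E → G) (n : ℕ) (x : E) :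
    (weightedPullback φ R)^[n] u x = u x +
      ∑ i ∈ Finset.range n, (weightedPullback φ R)^[i] (weightedPullback φ R u - u) x := by
  induction n with
  | zero => simp
  | succ n ih =>
    rw [Finset.sum_range_succ, ← add_assoc, ← ih, weightedPullback_iterate_sub,
      Function.iterate_succ_apply, add_sub_cancel]

/-- A compatible family of approximate fixed points of a weighted pullback by a contraction, of
arbitrarily high order, comes from a smooth fixed point. -/
theorem exists_tendsto_weightedPullback [FiniteDimensional ℝ G] {O : Set E}
    (hOb : Bornology.IsBounded O) (hOo : IsOpen O) (h0 : 0 ∈ O) (hOc : IsPreconnected O)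
    (hφO : MapsTo φ O O) {C θ : ℝ} (hC : 0 < C) (hθ0 : 0 ≤ θ) (hθ1 : θ < 1)
    (hφn : ∀ n, ∀ x ∈ O, ‖φ^[n] x‖ ≤ C * θ ^ n * ‖x‖) (hφ : ContDiff ℝ ∞ φ)
    (hR : ContDiff ℝ ∞ R) {u : ℕ → E → G} (hu : ∀ N, ContDiff ℝ ∞ (u N))
    (hTu : ∀ N, (weightedPullback φ R (u N) - u N) =O[𝓝 0] fun x ↦ ‖x‖ ^ (N + 1))
    (huu : ∀ N N', N ≤ N' → (u N' - u N) =O[𝓝 0] fun x ↦ ‖x‖ ^ (N + 1)) :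
    ∃ (v : E → G) (N₀ : ℕ), ContDiffOn ℝ ∞ v O ∧
      (∀ g : E → G, Continuous g → (g =O[𝓝 0] fun x ↦ ‖x‖ ^ N₀) →
        ∀ x ∈ O, Tendsto (fun n ↦ (weightedPullback φ R)^[n] g x) atTop (𝓝 0)) ∧
      ∀ N, N₀ ≤ N →
        (∀ x ∈ O, Tendsto (fun n ↦ (weightedPullback φ R)^[n] (u N) x) atTop (𝓝 (v x))) ∧
        (v - u N) =O[𝓝 0] fun x ↦ ‖x‖ ^ (N + 1) := by
  obtain ⟨r, hr0, hr⟩ := hOb.subset_closedBall_lt 0 (0 : E)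
  have hφn' : ∀ n, ∀ x ∈ O, ‖φ^[n] x‖ ≤ C * r * θ ^ n := by
    intro n x hx
    have h1 : ‖x‖ ≤ r := mem_closedBall_zero_iff.1 (hr hx)
    calc ‖φ^[n] x‖ ≤ C * θ ^ n * ‖x‖ := hφn n x hx
      _ ≤ C * θ ^ n * r := by gcongr
      _ = _ := by ring
  obtain ⟨N₀, hN₀⟩ := exists_norm_weightedPullback_iterate_le hOb hφO hθ0 hθ1 hφn' hR.continuous
  obtain ⟨CR, hCR⟩ :=
    ((isCompact_closedBall (0 : E) r).image hR.continuous).isBounded.exists_norm_le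
  have hRO : ∀ x ∈ O, ‖R x‖ ≤ max CR 1 := fun x hx ↦
    (hCR _ (mem_image_of_mem R (hr hx))).trans (le_max_left _ _)
  set C' := max CR 1
  have hC'pos : 0 < C' := one_pos.trans_le (le_max_right _ _)
  -- `N₀` gives bounds that are uniform on `O`; `N₁` serves the final estimate, where the decay is
  -- measured relative to ‖x‖ ^ (N + 1).
  obtain ⟨N₁, hN₁⟩ := exists_pow_lt_of_lt_one (show 0 < 1 / 2 / C' by positivity) hθ1
  have hgeo : Summable fun n : ℕ ↦ (1 / 2 : ℝ) ^ n := summable_geometric_two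
  set w : ℕ → E → G := fun N ↦ weightedPullback φ R (u N) - u N with hw
  have hwc : ∀ N, ContDiff ℝ ∞ (w N) := fun N ↦
    (contDiff_weightedPullback_iterate hφ hR (hu N) 1).sub (hu N)
  have hsum : ∀ N, N₀ ≤ N → ∀ x ∈ O, Summable fun n ↦ (weightedPullback φ R)^[n] (w N) x := by
    intro N hN x hx
    obtain ⟨K, hK⟩ := hN₀ (w N) (hwc N).continuous
      ((hTu N).trans (isBigO_norm_pow_of_le (by omega)))
    exact Summable.of_norm_bounded (hgeo.mul_left K) fun n ↦ hK n x hx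
  have hzero : ∀ g : E → G, Continuous g → (g =O[𝓝 0] fun x ↦ ‖x‖ ^ N₀) →
      ∀ x ∈ O, Tendsto (fun n ↦ (weightedPullback φ R)^[n] g x) atTop (𝓝 0) := by
    intro g hg hgO x hx
    obtain ⟨K, hK⟩ := hN₀ g hg hgO
    refine squeeze_zero_norm (fun n ↦ hK n x hx) ?_
    simpa using hgeo.tendsto_atTop_zero.const_mul K
  have hlim : ∀ N, N₀ ≤ N → ∀ x ∈ O, Tendsto (fun n ↦ (weightedPullback φ R)^[n] (u N) x) atTop
      (𝓝 (u N x + ∑' n, (weightedPullback φ R)^[n] (w N) x)) := by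
    intro N hN x hx
    simp only [weightedPullback_iterate_eq_add_sum (u N)]
    exact tendsto_const_nhds.add (hsum N hN x hx).hasSum.tendsto_sum_nat
  -- By telescoping, Tⁿ u = u + Σ_{i<n} Tⁱ(T u - u), so this is the limit of Tⁿ (u N₀). Every `N ≥
  -- N₀` leads to the same limit, because Tⁿ (u N - u N₀) tends to 0.
  set v : E → G := fun x ↦ u N₀ x + ∑' n, (weightedPullback φ R)^[n] (w N₀) x with hv
  have hlim' : ∀ N, N₀ ≤ N → ∀ x ∈ O,
      Tendsto (fun n ↦ (weightedPullback φ R)^[n] (u N) x) atTop (𝓝 (v x)) := by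
    intro N hN x hx
    have h1 := hzero (u N - u N₀) ((hu N).sub (hu N₀)).continuous
      ((huu N₀ N hN).trans (isBigO_norm_pow_of_le (by omega))) x hx
    have h2 := (hlim N₀ le_rfl x hx).add h1
    simp only [weightedPullback_iterate_sub, add_sub_cancel, add_zero] at h2
    exact h2
  have hveq : ∀ N, N₀ ≤ N → ∀ x ∈ O,
      v x = u N x + ∑' n, (weightedPullback φ R)^[n] (w N) x := fun N hN x hx ↦
    tendsto_nhds_unique (hlim' N hN x hx) (hlim N hN x hx)
  refine ⟨v, max N₀ N₁, ?_, fun g hg hgO ↦ hzero g hg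
    (hgO.trans (isBigO_norm_pow_of_le (le_max_left _ _))), fun N hN ↦
    ⟨hlim' N (le_trans (le_max_left _ _) hN), ?_⟩⟩
  · rw [contDiffOn_infty]
    intro k
    -- The order of vanishing required for C^k depends on `k`. Since `v` has the same representation
    -- for every `N ≥ N₀`, `N` may be taken as large as `k` demands.
    obtain ⟨M, hM⟩ := contDiffOn_tsum_weightedPullback hOb hOo hOc hφO hθ0 hθ1 hφn' hφ k hR
    have h1 := hM (w (max N₀ M)) (hwc _) ((hTu _).trans (isBigO_norm_pow_of_le
      ((le_max_right N₀ M).trans (Nat.le_succ _))))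
    refine (((hu (max N₀ M)).contDiffOn.of_le ?_).add h1).congr
      fun x hx ↦ hveq _ (le_max_left _ _) x hx
    exact_mod_cast le_top
  · have hN0 : N₀ ≤ N := le_trans (le_max_left _ _) hN
    have hθN : C' * θ ^ (N + 1) ≤ 1 / 2 := by
      have h1 : θ ^ (N + 1) ≤ θ ^ N₁ := pow_le_pow_of_le_one hθ0 hθ1.le
        ((le_max_right N₀ N₁).trans (hN.trans (Nat.le_succ _)))
      have h2 := h1.trans hN₁.le
      rw [le_div_iff₀ hC'pos] at h2
      linarith
    obtain ⟨D, hD0, hD⟩ := (hTu N).exists_nonneg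
    have hD := hD.bound
    rw [Metric.eventually_nhds_iff_ball] at hD
    obtain ⟨δ, hδ, hDδ⟩ := hD
    have hcont : ∀ᶠ x : E in 𝓝 0, C * ‖x‖ < δ := by
      have : Tendsto (fun x : E ↦ C * ‖x‖) (𝓝 0) (𝓝 (C * ‖(0 : E)‖)) :=
        (continuous_const.mul continuous_norm).tendsto 0
      rw [norm_zero, mul_zero] at this
      exact this.eventually_lt_const hδ
    refine Asymptotics.IsBigO.of_bound (D * C ^ (N + 1) * 2) ?_
    filter_upwards [hOo.mem_nhds h0, hcont] with x hx hxδ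
    rw [Pi.sub_apply, hveq N hN0 x hx, add_sub_cancel_left, norm_pow, norm_norm]
    have hterm : ∀ n, ‖(weightedPullback φ R)^[n] (w N) x‖ ≤
        D * C ^ (N + 1) * ‖x‖ ^ (N + 1) * (1 / 2) ^ n := by
      intro n
      have h1 := norm_weightedPullback_iterate_le hφO hC'pos.le hRO (w N) n hx
      have h2 : ‖φ^[n] x‖ < δ := by
        refine (hφn n x hx).trans_lt (lt_of_le_of_lt ?_ hxδ)
        have : θ ^ n ≤ 1 := pow_le_one₀ hθ0 hθ1.le
        calc C * θ ^ n * ‖x‖ ≤ C * 1 * ‖x‖ := by gcongr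
          _ = C * ‖x‖ := by ring
      have h3 := hDδ (φ^[n] x) (mem_ball_zero_iff.2 h2)
      rw [norm_pow, norm_norm] at h3
      have h4 : ‖φ^[n] x‖ ^ (N + 1) ≤ (C * θ ^ n * ‖x‖) ^ (N + 1) := by
        gcongr
        exact hφn n x hx
      calc ‖(weightedPullback φ R)^[n] (w N) x‖ ≤ C' ^ n * (D * (C * θ ^ n * ‖x‖) ^ (N + 1)) :=
            h1.trans (by gcongr; exact h3.trans (by gcongr))
        _ = D * C ^ (N + 1) * ‖x‖ ^ (N + 1) * (C' * θ ^ (N + 1)) ^ n := by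
            rw [mul_pow, mul_pow, mul_pow, ← pow_mul, ← pow_mul, mul_comm n (N + 1)]
            ring
        _ ≤ _ := by gcongr
    refine (tsum_of_norm_bounded (hasSum_geometric_two.mul_left _) hterm).trans (le_of_eq ?_)
    ring

end FixedPoint

/-! ### Cutoff functions -/

section Cutoff

variable {E : Type*} [NormedAddCommGroup E] [NormedSpace ℝ E] [FiniteDimensional ℝ E]

/-- A smooth cutoff function which is `1` on `ball x₀ (r / 2)` and turns every function which is
smooth on `ball x₀ r` into a globally smooth function. -/
theorem exists_smooth_cutoff (G : Type*) [NormedAddCommGroup G] [NormedSpace ℝ G] (x₀ : E) {r : ℝ}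
    (hr : 0 < r) : ∃ χ : E → ℝ, ContDiff ℝ ∞ χ ∧ (∀ x ∈ Metric.ball x₀ (r / 2), χ x = 1) ∧
      ∀ f : E → G, ContDiffOn ℝ ∞ f (Metric.ball x₀ r) → ContDiff ℝ ∞ fun x ↦ χ x • f x := by
  let b : ContDiffBump x₀ := ⟨r / 2, 3 * r / 4, by positivity, by linarith⟩
  refine ⟨b, b.contDiff, fun x hx ↦ b.one_of_mem_closedBall (Metric.ball_subset_closedBall hx),
    fun f hf ↦ ?_⟩
  rw [contDiff_iff_contDiffAt]
  intro x
  by_cases hx : x ∈ Metric.ball x₀ r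
  · exact b.contDiff.contDiffAt.smul (hf.contDiffAt (Metric.isOpen_ball.mem_nhds hx))
  · have h1 : x ∉ Metric.closedBall x₀ (3 * r / 4) := fun h ↦ hx
      (Metric.closedBall_subset_ball (by linarith) h)
    have h2 : (fun x ↦ b x • f x) =ᶠ[𝓝 x] fun _ ↦ 0 := by
      filter_upwards [Metric.isClosed_closedBall.isOpen_compl.mem_nhds h1] with y hy
      rw [b.zero_of_le_dist, zero_smul]
      exact (not_le.1 (mt Metric.mem_closedBall.2 hy)).le
    exact contDiffAt_const.congr_of_eventuallyEq h2

end Cutoff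

/-! ### Smooth solutions of the transport equation near the source -/

section LocalSolution

set_option linter.unusedSectionVars false

variable {E : Type*} [NormedAddCommGroup E] [NormedSpace ℝ E] [FiniteDimensional ℝ E]
  {F : Type*} [NormedAddCommGroup F] [NormedSpace ℝ F] [FiniteDimensional ℝ F]
  {ι : Type*} [Fintype ι] {X : E → E} {a : E → F →L[ℝ] F}

/-- A neighbourhood of a source, a sublevel set of the Lyapunov function, on which the flow is
defined for a short time and contracting in negative time. -/
structure FlowBox (S : SourceRegion ι X) (T : LocalTransport X a 0) where
  τ : ℝ
  ρ : ℝ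
  τ_pos : 0 < τ
  τ_lt : 2 * τ < T.ε
  ρ_pos : 0 < ρ
  ρ_le : ρ ≤ S.r
  mem_ball : ∀ x, ‖S.W x‖ < ρ → x ∈ Metric.ball 0 (T.r / 2)
  norm_le : ∀ x, ‖S.W x‖ < ρ → ∀ s ∈ Icc 0 (2 * τ),
    ‖S.W (T.Φ (-s) x)‖ ≤ Real.exp (-S.c * s) * ‖S.W x‖

/-- Continuity of the flow at (0, 0) keeps short backward trajectories in the region where the
Lyapunov estimate holds. Times up to `2 * τ` allow two transports of duration at most `τ` to be
composed, and `T.r / 2` is the radius on which the cutoff functions are 1. -/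
theorem nonempty_flowBox (S : SourceRegion ι X) (T : LocalTransport X a 0) :
    Nonempty (FlowBox S T) := by
  have h0 : (0 : E) ∈ Metric.ball (0 : E) T.r := Metric.mem_ball_self T.r_pos
  have hc : ContinuousAt (Function.uncurry T.Φ) (0, 0) :=
    T.continuousOn_Φ.continuousAt ((isOpen_Ioo.prod Metric.isOpen_ball).mem_nhds
      ⟨T.zero_mem, h0⟩)
  have hV : {x | ‖S.W x‖ < S.r} ∈ 𝓝 (Function.uncurry T.Φ (0, 0)) := by
    rw [Function.uncurry_apply_pair, T.Φ_zero 0 h0]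
    refine (isOpen_lt (S.W.continuous.norm) continuous_const).mem_nhds ?_
    rw [mem_ofPred_eq, map_zero, norm_zero]
    exact S.r_pos
  obtain ⟨δ, hδ, hball⟩ := Metric.eventually_nhds_iff_ball.1 (hc hV)
  set τ := min (T.ε / 4) (δ / 4) with hτ
  have hτ0 : 0 < τ := lt_min (by linarith [T.ε_pos]) (by linarith)
  set ρ := min S.r (min δ (T.r / 2) / S.K) with hρ
  have hK := S.K_pos
  have hr := T.r_pos
  have hρ0 : 0 < ρ := lt_min S.r_pos (div_pos (lt_min hδ (by linarith)) S.K_pos)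
  have hxρ : ∀ x, ‖S.W x‖ < ρ → ‖x‖ < min δ (T.r / 2) := by
    intro x hx
    have h1 : ‖S.W x‖ < min δ (T.r / 2) / S.K := hx.trans_le (min_le_right _ _)
    rw [lt_div_iff₀ hK] at h1
    linarith [S.norm_le x]
  refine ⟨⟨τ, ρ, hτ0, ?_, hρ0, min_le_left _ _, fun x hx ↦ ?_, fun x hx s hs ↦ ?_⟩⟩
  · have : τ ≤ T.ε / 4 := min_le_left _ _
    linarith [T.ε_pos]
  · rw [mem_ball_zero_iff]
    exact (hxρ x hx).trans_le (min_le_right _ _)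
  · have hxr : x ∈ Metric.ball (0 : E) T.r := by
      rw [mem_ball_zero_iff]
      linarith [(hxρ x hx).trans_le (min_le_right _ _)]
    have hτε : τ ≤ T.ε / 4 := min_le_left _ _
    have hτδ : τ ≤ δ / 4 := min_le_right _ _
    have key := S.norm_le_exp_mul (γ := fun t ↦ T.Φ t x) (a := -s) (b := 0) (by linarith [hs.1])
      (fun t ht ↦ (T.hasDerivAt_Φ x hxr t
        ⟨by linarith [ht.1, hs.2], by linarith [ht.2, T.ε_pos]⟩).hasDerivWithinAt)
      (fun t ht ↦ by
        refine hball (t, x) ?_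
        rw [Metric.mem_ball, Prod.dist_eq, max_lt_iff]
        refine ⟨?_, by simpa using (hxρ x hx).trans_le (min_le_left _ _)⟩
        rw [Real.dist_eq, sub_zero, abs_of_nonpos ht.2]
        linarith [ht.1, hs.2])
    rw [T.Φ_zero x hxr, zero_sub, neg_neg] at key
    exact key

namespace FlowBox

variable {S : SourceRegion ι X} {T : LocalTransport X a 0} (B : FlowBox S T)

/-- The underlying set of a flow box. -/
def carrier : Set E := S.W ⁻¹' Metric.ball 0 B.ρ

theorem mem_carrier {x : E} : x ∈ B.carrier ↔ ‖S.W x‖ < B.ρ := mem_ball_zero_iff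

theorem isOpen_carrier : IsOpen B.carrier := Metric.isOpen_ball.preimage S.W.continuous

theorem zero_mem_carrier : (0 : E) ∈ B.carrier := by
  rw [B.mem_carrier, map_zero, norm_zero]
  exact B.ρ_pos

theorem isBounded_carrier : Bornology.IsBounded B.carrier :=
  Metric.isBounded_ball.subset (fun x hx ↦ B.mem_ball x (B.mem_carrier.1 hx))

theorem isPreconnected_carrier : IsPreconnected B.carrier :=
  ((convex_ball (0 : EuclideanSpace ℂ ι) B.ρ).linear_preimage S.W.toLinearMap).isPreconnected

theorem mem_ball_of_mem {x : E} (hx : x ∈ B.carrier) : x ∈ Metric.ball 0 T.r :=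
  Metric.ball_subset_ball (by linarith [T.r_pos]) (B.mem_ball x (B.mem_carrier.1 hx))

theorem flow_mem {x : E} (hx : x ∈ B.carrier) {s : ℝ} (hs : s ∈ Icc 0 (2 * B.τ)) :
    T.Φ (-s) x ∈ B.carrier := by
  rw [B.mem_carrier] at hx ⊢
  refine (B.norm_le x hx s hs).trans_lt (lt_of_le_of_lt ?_ hx)
  refine mul_le_of_le_one_left (norm_nonneg _) (Real.exp_le_one_iff.2 ?_)
  nlinarith [S.c_pos, hs.1]

theorem norm_flow_le {x : E} (hx : x ∈ B.carrier) {s : ℝ} (hs : s ∈ Icc 0 (2 * B.τ)) :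
    ‖T.Φ (-s) x‖ ≤ S.K * ‖S.W‖ * ‖x‖ := by
  refine (S.norm_le _).trans ?_
  rw [mul_assoc]
  refine mul_le_mul_of_nonneg_left ?_ S.K_pos.le
  refine (B.norm_le x (B.mem_carrier.1 hx) s hs).trans (le_trans ?_ (S.W.le_opNorm x))
  refine mul_le_of_le_one_left (norm_nonneg _) (Real.exp_le_one_iff.2 ?_)
  nlinarith [S.c_pos, hs.1]

theorem mem_Ioo {s : ℝ} (hs : s ∈ Icc 0 (2 * B.τ)) : s ∈ Ioo (-T.ε) T.ε :=
  ⟨by linarith [hs.1, T.ε_pos], by linarith [hs.2, B.τ_lt]⟩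

theorem neg_mem_Ioo {s : ℝ} (hs : s ∈ Icc 0 (2 * B.τ)) : -s ∈ Ioo (-T.ε) T.ε :=
  ⟨by linarith [hs.2, B.τ_lt], by linarith [hs.1, T.ε_pos]⟩

/-- The transport from `Φ (-s) x` to `x`. -/
def transport (_B : FlowBox S T) (s : ℝ) (x : E) : F →L[ℝ] F := T.P s (T.Φ (-s) x)

theorem transport_apply (s : ℝ) (x : E) : B.transport s x = T.P s (T.Φ (-s) x) := rfl

theorem flow_neg_flow (hX : ContDiff ℝ ∞ X) (ha : ContDiff ℝ ∞ a)
    {x : E} (hx : x ∈ B.carrier) {s : ℝ} (hs : s ∈ Icc 0 (2 * B.τ)) :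
    T.Φ s (T.Φ (-s) x) = x ∧ ∀ y, B.transport s x (T.P (-s) x y) = y := by
  have h := T.add_apply hX ha (B.mem_ball_of_mem hx) (B.mem_Ioo hs) (B.neg_mem_Ioo hs)
    (by rw [add_neg_cancel]; exact T.zero_mem) (B.mem_ball_of_mem (B.flow_mem hx hs))
  rw [add_neg_cancel, T.Φ_zero x (B.mem_ball_of_mem hx), T.P_zero x (B.mem_ball_of_mem hx)] at h
  exact ⟨h.1.symm, fun y ↦ (h.2 y).symm⟩

theorem neg_transport (hX : ContDiff ℝ ∞ X) (ha : ContDiff ℝ ∞ a)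
    {x : E} (hx : x ∈ B.carrier) {s : ℝ} (hs : s ∈ Icc 0 (2 * B.τ)) (y : F) :
    T.P (-s) x (B.transport s x y) = y := by
  have hx' := B.mem_ball_of_mem (B.flow_mem hx hs)
  have h1 := (B.flow_neg_flow hX ha hx hs).1
  have h := (T.add_apply hX ha hx' (B.neg_mem_Ioo hs) (B.mem_Ioo hs)
    (by rw [neg_add_cancel]; exact T.zero_mem) (by rw [h1]; exact B.mem_ball_of_mem hx)).2 y
  rw [neg_add_cancel, T.P_zero _ hx', h1] at h
  exact h.symm

theorem flow_add (hX : ContDiff ℝ ∞ X) (ha : ContDiff ℝ ∞ a)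
    {x : E} (hx : x ∈ B.carrier) {s t : ℝ} (hs : s ∈ Icc 0 B.τ)
    (ht : t ∈ Icc 0 B.τ) : T.Φ (-s) (T.Φ (-t) x) = T.Φ (-(s + t)) x ∧
      ∀ y, B.transport t x (B.transport s (T.Φ (-t) x) y) = B.transport (s + t) x y := by
  have hτ := B.τ_pos
  have hs' : s ∈ Icc 0 (2 * B.τ) := ⟨hs.1, by linarith [hs.2]⟩
  have ht' : t ∈ Icc 0 (2 * B.τ) := ⟨ht.1, by linarith [ht.2]⟩
  have hst : s + t ∈ Icc 0 (2 * B.τ) := ⟨by linarith [hs.1, ht.1], by linarith [hs.2, ht.2]⟩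
  have h1 : T.Φ (-s) (T.Φ (-t) x) = T.Φ (-(s + t)) x := by
    have h := (T.add_apply hX ha (B.mem_ball_of_mem hx) (B.neg_mem_Ioo hs') (B.neg_mem_Ioo ht')
      (by rw [← neg_add]; exact B.neg_mem_Ioo hst) (B.mem_ball_of_mem (B.flow_mem hx ht'))).1
    rw [← h, neg_add]
  refine ⟨h1, fun y ↦ ?_⟩
  have h2 : T.Φ s (T.Φ (-(s + t)) x) = T.Φ (-t) x := by
    rw [← h1]
    exact (B.flow_neg_flow hX ha (B.flow_mem hx ht') hs').1
  have h3 := (T.add_apply hX ha (B.mem_ball_of_mem (B.flow_mem hx hst)) (B.mem_Ioo ht')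
    (B.mem_Ioo hs') (by rw [add_comm]; exact B.mem_Ioo hst)
    (by rw [h2]; exact B.mem_ball_of_mem (B.flow_mem hx ht'))).2 y
  rw [h2] at h3
  rw [B.transport_apply, B.transport_apply, B.transport_apply, h1, ← h3, add_comm t s]

/-- Weighted pullbacks are set up for globally smooth data, whereas flow and transport are smooth
only near 0. Cutoffs make them global without changing them on the box. -/
theorem exists_contDiff_flow {s : ℝ} (hs : s ∈ Icc 0 (2 * B.τ)) :
    ∃ (φ : E → E) (R : E → F →L[ℝ] F), ContDiff ℝ ∞ φ ∧ ContDiff ℝ ∞ R ∧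
      ∀ x ∈ B.carrier, φ x = T.Φ (-s) x ∧ R x = B.transport s x := by
  obtain ⟨χ, -, hχ1, hχ⟩ := exists_smooth_cutoff E (0 : E) T.r_pos
  obtain ⟨χ', -, hχ1', hχ'⟩ := exists_smooth_cutoff (F →L[ℝ] F) (0 : E) T.r_pos
  have hφ := hχ _ (T.contDiffOn_Φ _ (B.neg_mem_Ioo hs))
  have hP := hχ' _ (T.contDiffOn_P _ (B.mem_Ioo hs))
  refine ⟨_, _, hφ, hP.comp hφ, fun x hx ↦ ?_⟩
  have h1 : χ x • T.Φ (-s) x = T.Φ (-s) x := by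
    rw [hχ1 x (B.mem_ball x (B.mem_carrier.1 hx)), one_smul]
  refine ⟨h1, ?_⟩
  have h2 := B.flow_mem hx hs
  simp only [Function.comp_apply, h1]
  rw [hχ1' _ (B.mem_ball _ (B.mem_carrier.1 h2)), one_smul, B.transport_apply]

/-- An approximate solution of the transport equation is approximately propagated by the
transport. -/
theorem isBigO_transport_sub (hX : ContDiff ℝ ∞ X) (ha : ContDiff ℝ ∞ a)
    {u : E → F} (hu : ContDiff ℝ ∞ u) {N : ℕ}
    (hg : (fun x ↦ fderiv ℝ u x (X x) - a x (u x)) =O[𝓝 0] fun x ↦ ‖x‖ ^ N) {σ : ℝ}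
    (hσ : σ ∈ Icc 0 (2 * B.τ)) :
    (fun x ↦ B.transport σ x (u (T.Φ (-σ) x)) - u x) =O[𝓝 0] fun x ↦ ‖x‖ ^ N := by
  obtain ⟨D, hD0, hD⟩ := hg.exists_nonneg
  have hD := hD.bound
  rw [Metric.eventually_nhds_iff_ball] at hD
  obtain ⟨δ, hδ, hDδ⟩ := hD
  set C := S.K * ‖S.W‖ with hC
  have hC0 : 0 ≤ C := mul_nonneg S.K_pos.le (norm_nonneg _)
  have hcont : ∀ᶠ x : E in 𝓝 0, C * ‖x‖ < δ := by
    have : Tendsto (fun x : E ↦ C * ‖x‖) (𝓝 0) (𝓝 (C * ‖(0 : E)‖)) :=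
      (continuous_const.mul continuous_norm).tendsto 0
    rw [norm_zero, mul_zero] at this
    exact this.eventually_lt_const hδ
  obtain ⟨Ka, hKa⟩ := ((isCompact_closedBall (0 : E) T.r).image ha.continuous).isBounded.exists_norm_le
  set L := max Ka 1
  have hL0 : 0 < L := one_pos.trans_le (le_max_right _ _)
  obtain ⟨φ, R, hφ, hR, hφR⟩ := B.exists_contDiff_flow hσ
  obtain ⟨KR, hKR⟩ := ((isCompact_closedBall (0 : E) T.r).image hR.continuous).isBounded.exists_norm_le
  have hR0 : 0 ≤ KR := (norm_nonneg _).trans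
    (hKR _ (mem_image_of_mem R (Metric.mem_closedBall_self T.r_pos.le)))
  refine Asymptotics.IsBigO.of_bound (KR * (D * C ^ N / L * (Real.exp (L * σ) - 1))) ?_
  filter_upwards [B.isOpen_carrier.mem_nhds B.zero_mem_carrier, hcont] with x hx hxδ
  have hxr := B.mem_ball_of_mem hx
  -- `k` compares `u` along the backward flow line with the exact solution starting from `u x`. It
  -- vanishes at 0, and its derivative is bounded by `L * ‖k‖` plus the defect of `u`, which is
  -- O(‖x‖ ^ N) along the whole line. Grönwall's inequality bounds `k σ`, and the transport carries
  -- it back to `x`.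
  let k : ℝ → F := fun s ↦ u (T.Φ (-s) x) - T.P (-s) x (u x)
  let k' : ℝ → F := fun s ↦ -(fderiv ℝ u (T.Φ (-s) x) (X (T.Φ (-s) x)) -
    a (T.Φ (-s) x) (T.P (-s) x (u x)))
  have hk : ∀ s ∈ Icc 0 σ, HasDerivAt k (k' s) s := by
    intro s hs
    have hs' : s ∈ Icc 0 (2 * B.τ) := ⟨hs.1, hs.2.trans hσ.2⟩
    have h1 := (hasDerivAt_id s).neg
    have h2 := (T.hasDerivAt_Φ x hxr (-s) (B.neg_mem_Ioo hs')).scomp s h1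
    have h3 := (hu.differentiable (by simp) (T.Φ (-s) x)).hasFDerivAt.comp_hasDerivAt s h2
    have h4 := ((T.hasDerivAt_P x hxr (-s) (B.neg_mem_Ioo hs')).scomp s h1).clm_apply
      (hasDerivAt_const s (u x))
    refine (h3.sub h4).congr_deriv ?_
    simp [k']
    abel
  have hbound : ∀ s ∈ Ico 0 σ, ‖k' s‖ ≤ L * ‖k s‖ + D * (C * ‖x‖) ^ N := by
    intro s hs
    have hs' : s ∈ Icc 0 (2 * B.τ) := ⟨hs.1, hs.2.le.trans hσ.2⟩
    have h1 : k' s = -(a (T.Φ (-s) x) (k s) + (fderiv ℝ u (T.Φ (-s) x) (X (T.Φ (-s) x)) -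
      a (T.Φ (-s) x) (u (T.Φ (-s) x)))) := by
      simp only [k', k, map_sub]
      abel
    have hn := B.norm_flow_le hx hs'
    rw [h1, norm_neg]
    refine (norm_add_le _ _).trans (add_le_add ?_ ?_)
    · refine (ContinuousLinearMap.le_opNorm _ _).trans ?_
      gcongr
      exact (hKa _ (mem_image_of_mem a (Metric.ball_subset_closedBall
        (B.mem_ball_of_mem (B.flow_mem hx hs'))))).trans (le_max_left _ _)
    · refine (hDδ (T.Φ (-s) x) (mem_ball_zero_iff.2 (hn.trans_lt hxδ))).trans ?_
      rw [norm_pow, norm_norm]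
      gcongr
  have hk0 : ‖k 0‖ ≤ 0 := by
    simp [k, T.Φ_zero x hxr, T.P_zero x hxr]
  have key := norm_le_gronwallBound_of_norm_deriv_right_le
    (fun s hs ↦ (hk s hs).continuousAt.continuousWithinAt)
    (fun s hs ↦ (hk s (Ico_subset_Icc_self hs)).hasDerivWithinAt) hk0 hbound σ
    (right_mem_Icc.2 hσ.1)
  simp only [gronwallBound_of_K_ne_0 hL0.ne', zero_mul, zero_add, sub_zero] at key
  have h5 : B.transport σ x (u (T.Φ (-σ) x)) - u x = R x (k σ) := by
    rw [(hφR x hx).2, map_sub, (B.flow_neg_flow hX ha hx hσ).2]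
  rw [h5, norm_pow, norm_norm]
  calc ‖R x (k σ)‖ ≤ KR * (D * (C * ‖x‖) ^ N / L * (Real.exp (L * σ) - 1)) := by
        refine (ContinuousLinearMap.le_opNorm _ _).trans ?_
        gcongr
        exact hKR _ (mem_image_of_mem R (Metric.ball_subset_closedBall hxr))
    _ = _ := by rw [mul_pow]; ring

/-- A compatible family of approximate solutions of arbitrarily high order comes from a smooth
solution of the transport equation near the source. -/
theorem exists_solution (hX : ContDiff ℝ ∞ X) (ha : ContDiff ℝ ∞ a)
    {u : ℕ → E → F} (hu : ∀ N, ContDiff ℝ ∞ (u N))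
    (hg : ∀ N, (fun x ↦ fderiv ℝ (u N) x (X x) - a x (u N x)) =O[𝓝 0] fun x ↦ ‖x‖ ^ (N + 1))
    (huu : ∀ N N', N ≤ N' → (u N' - u N) =O[𝓝 0] fun x ↦ ‖x‖ ^ (N + 1)) :
    ∃ (v : E → F) (N₀ : ℕ), ContDiffOn ℝ ∞ v B.carrier ∧
      (∀ x ∈ B.carrier, fderiv ℝ v x (X x) = a x (v x)) ∧
      ∀ N, N₀ ≤ N → (v - u N) =O[𝓝 0] fun x ↦ ‖x‖ ^ (N + 1) := by
  have hτ := B.τ_pos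
  have hτ2 : B.τ ∈ Icc 0 (2 * B.τ) := ⟨hτ.le, by linarith⟩
  obtain ⟨φ, R, hφ, hR, hφR⟩ := B.exists_contDiff_flow hτ2
  have hmem := B.isOpen_carrier.mem_nhds B.zero_mem_carrier
  have hφO : MapsTo φ B.carrier B.carrier := fun x hx ↦ by
    rw [(hφR x hx).1]
    exact B.flow_mem hx hτ2
  set θ := Real.exp (-S.c * B.τ) with hθ
  have hθ1 : θ < 1 := Real.exp_lt_one_iff.2 (by nlinarith [S.c_pos])
  have hθ0 : 0 ≤ θ := (Real.exp_pos _).le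
  have hWn : ∀ n, ∀ x ∈ B.carrier, ‖S.W (φ^[n] x)‖ ≤ θ ^ n * ‖S.W x‖ := by
    intro n
    induction n with
    | zero => intro x _; simp
    | succ n ih =>
      intro x hx
      rw [Function.iterate_succ_apply]
      refine (ih (φ x) (hφO hx)).trans ?_
      rw [(hφR x hx).1, pow_succ, mul_assoc]
      exact mul_le_mul_of_nonneg_left (B.norm_le x (B.mem_carrier.1 hx) _ hτ2) (by positivity)
  have hφn : ∀ n, ∀ x ∈ B.carrier, ‖φ^[n] x‖ ≤ S.K * (‖S.W‖ + 1) * θ ^ n * ‖x‖ := by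
    intro n x hx
    have hK := S.K_pos
    calc ‖φ^[n] x‖ ≤ S.K * (θ ^ n * ((‖S.W‖ + 1) * ‖x‖)) := by
          refine (S.norm_le _).trans ?_
          gcongr
          refine (hWn n x hx).trans ?_
          gcongr
          refine (S.W.le_opNorm x).trans ?_
          gcongr
          linarith
      _ = _ := by ring
  have hTu : ∀ {σ : ℝ} {φ' : E → E} {R' : E → F →L[ℝ] F}, σ ∈ Icc 0 (2 * B.τ) →
      (∀ x ∈ B.carrier, φ' x = T.Φ (-σ) x ∧ R' x = B.transport σ x) → ∀ N,
      (weightedPullback φ' R' (u N) - u N) =O[𝓝 0] fun x ↦ ‖x‖ ^ (N + 1) := by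
    intro σ φ' R' hσ h N
    refine (B.isBigO_transport_sub hX ha (hu N) (hg N) hσ).congr' ?_ EventuallyEq.rfl
    filter_upwards [hmem] with x hx
    rw [Pi.sub_apply, weightedPullback, (h x hx).1, (h x hx).2]
  obtain ⟨v, N₀, hv, hzero, hN₀⟩ := exists_tendsto_weightedPullback B.isBounded_carrier
    B.isOpen_carrier B.zero_mem_carrier B.isPreconnected_carrier hφO
    (mul_pos S.K_pos (by positivity)) hθ0 hθ1 hφn hφ hR hu (hTu hτ2 hφR) huu
  -- The limit was built from the transport of duration `τ` alone, but a differential equation needs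
  -- invariance for all short durations σ. Transports commute, and the one of duration σ changes `u
  -- N₀` only by a function whose iterates tend to 0, so both sides have the same limit.
  have hfix : ∀ σ ∈ Icc 0 B.τ, ∀ x ∈ B.carrier, B.transport σ x (v (T.Φ (-σ) x)) = v x := by
    intro σ hσ x hx
    have hσ2 : σ ∈ Icc 0 (2 * B.τ) := ⟨hσ.1, by linarith [hσ.2]⟩
    obtain ⟨φ', R', hφ', hR', hφR'⟩ := B.exists_contDiff_flow hσ2
    have hcomm : ∀ n, ∀ (g : E → F), ∀ x ∈ B.carrier,
        B.transport σ x ((weightedPullback φ R)^[n] g (T.Φ (-σ) x)) =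
          (weightedPullback φ R)^[n] (weightedPullback φ' R' g) x := by
      intro n g
      induction n with
      | zero =>
        intro x hx
        simp only [Function.iterate_zero, id_eq, weightedPullback, (hφR' x hx).1, (hφR' x hx).2]
      | succ n ih =>
        intro x hx
        have h1 := B.flow_mem hx hσ2
        have h2 := B.flow_add hX ha hx (s := B.τ) ⟨hτ.le, le_rfl⟩ hσ
        have h3 := B.flow_add hX ha hx hσ (t := B.τ) ⟨hτ.le, le_rfl⟩
        rw [weightedPullback_iterate_succ, weightedPullback_iterate_succ, (hφR _ h1).1,
          (hφR _ h1).2, (hφR x hx).1, (hφR x hx).2, ← ih _ (B.flow_mem hx hτ2), h2.2, h2.1, h3.2,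
          h3.1, add_comm B.τ σ]
    have h1 := (hN₀ N₀ le_rfl).1 _ (B.flow_mem hx hσ2)
    have h2 := ((B.transport σ x).continuous.tendsto _).comp h1
    have h3 := (hN₀ N₀ le_rfl).1 x hx
    have h4 := hzero (weightedPullback φ' R' (u N₀) - u N₀)
      ((contDiff_weightedPullback_iterate hφ' hR' (hu N₀) 1).sub (hu N₀)).continuous
      ((hTu hσ2 hφR' N₀).trans (isBigO_norm_pow_of_le (Nat.le_succ _))) x hx
    have h5 := h3.add h4
    rw [add_zero] at h5
    refine tendsto_nhds_unique h2 (h5.congr fun n ↦ ?_)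
    rw [weightedPullback_iterate_sub, add_sub_cancel, Function.comp_apply, hcomm n _ x hx]
  refine ⟨v, N₀, hv, fun x hx ↦ ?_, fun N hN ↦ (hN₀ N hN).2⟩
  refine T.fderiv_eq_of_apply_eq (B.mem_ball_of_mem hx)
    ((hv.contDiffAt (B.isOpen_carrier.mem_nhds hx)).differentiableAt (by simp)) hτ fun s hs ↦ ?_
  have h1 := hfix s hs x hx
  rw [← h1, B.neg_transport hX ha hx ⟨hs.1, by linarith [hs.2]⟩]

end FlowBox

end LocalSolution

/-! ### Decay along flow lines and local eigenfunctions -/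

section LocalEigenfunction

set_option linter.unusedSectionVars false

/-- A solution of a linear equation along a curve emanating from the source vanishes if it decays
sufficiently fast. -/
theorem SourceRegion.eq_zero_of_decay {E : Type*} [NormedAddCommGroup E] [NormedSpace ℝ E]
    {F : Type*} [NormedAddCommGroup F] [NormedSpace ℝ F] {ι : Type*} [Fintype ι] {X : E → E}
    [FiniteDimensional ℝ E] {a : E → F →L[ℝ] F} (S : SourceRegion ι X) {c : ℝ → E} {y : ℝ → F}
    {T Ka D : ℝ} {N : ℕ} (hD0 : 0 ≤ D)
    (hc : ∀ t ≤ T, HasDerivWithinAt c (X (c t)) (Iic T) t)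
    (hy : ∀ t ≤ T, HasDerivWithinAt y (a (c t) (y t)) (Iic T) t)
    (hr : ∀ t ≤ T, ‖S.W (c t)‖ < S.r) (ha : ∀ t ≤ T, ‖a (c t)‖ ≤ Ka)
    (hD : ∀ t ≤ T, ‖y t‖ ≤ D * ‖c t‖ ^ N) (hN : Ka < S.c * N) : y T = 0 := by
  -- From `t` to `T` the solution grows at most by exp(Ka (T - t)), while `‖y t‖` is bounded by the
  -- `N`-th power of a quantity contracting like exp(-c (T - t)). As `Ka < c N`, the bound tends to
  -- 0 for t → -∞.
  have hbound : ∀ t ≤ T, ‖y T‖ ≤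
      D * (S.K * ‖S.W (c T)‖) ^ N * Real.exp ((Ka - S.c * N) * (T - t)) := by
    intro t ht
    have hsub : Icc t T ⊆ Iic T := fun s hs ↦ hs.2
    have h1 := S.norm_le_exp_mul ht (fun s hs ↦ (hc s hs.2).mono hsub) fun s hs ↦ hr s hs.2
    have h2 := norm_le_gronwallBound_of_norm_deriv_right_le (f := y)
      (f' := fun s ↦ a (c s) (y s)) (δ := ‖y t‖) (K := Ka) (ε := 0) (a := t) (b := T)
      (fun s hs ↦ ((hy s hs.2).mono hsub).continuousWithinAt)
      (fun s hs ↦ (((hy s hs.2.le).mono (fun z hz ↦ hz.2 : Icc s T ⊆ Iic T)).mono_of_mem_nhdsWithin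
        (Icc_mem_nhdsGE hs.2))) le_rfl
      (fun s hs ↦ by
        rw [add_zero]
        exact ((a (c s)).le_opNorm _).trans
          (mul_le_mul_of_nonneg_right (ha s hs.2.le) (norm_nonneg _))) T (right_mem_Icc.2 ht)
    rw [gronwallBound_ε0] at h2
    have hK := S.K_pos
    have h3 : ‖c t‖ ^ N ≤ (S.K * (Real.exp (-S.c * (T - t)) * ‖S.W (c T)‖)) ^ N := by
      gcongr
      exact (S.norm_le _).trans (by gcongr)
    calc ‖y T‖ ≤ D * (S.K * (Real.exp (-S.c * (T - t)) * ‖S.W (c T)‖)) ^ N *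
          Real.exp (Ka * (T - t)) := by
          refine h2.trans ?_
          gcongr
          exact (hD t ht).trans (by gcongr)
      _ = D * (S.K * ‖S.W (c T)‖) ^ N *
          (Real.exp (-S.c * (T - t)) ^ N * Real.exp (Ka * (T - t))) := by
          rw [mul_pow, mul_pow, mul_pow]; ring
      _ = _ := by
          rw [← Real.exp_nat_mul, ← Real.exp_add]
          congr 2
          ring
  have hlim : Tendsto (fun t : ℝ ↦ D * (S.K * ‖S.W (c T)‖) ^ N *
      Real.exp ((Ka - S.c * N) * (T - t))) atBot (𝓝 0) := by
    have h1 : Tendsto (fun t : ℝ ↦ (Ka - S.c * N) * (T - t)) atBot atBot := by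
      refine Tendsto.const_mul_atTop_of_neg (by linarith) ?_
      exact tendsto_atTop_add_const_left _ T tendsto_neg_atBot_atTop
    simpa using (Real.tendsto_exp_atBot.comp h1).const_mul (D * (S.K * ‖S.W (c T)‖) ^ N)
  have h0 : ‖y T‖ ≤ 0 := ge_of_tendsto hlim (by
    filter_upwards [Iic_mem_atBot T] with t ht using hbound t ht)
  exact norm_le_zero_iff.1 h0

variable {E : Type*} [NormedAddCommGroup E] [NormedSpace ℝ E] [FiniteDimensional ℝ E]
  {F : Type*} [NormedAddCommGroup F] [NormedSpace ℂ F] [FiniteDimensional ℂ F]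
  {ι κ : Type*} [Fintype ι] [DecidableEq ι] [Fintype κ] [DecidableEq κ]

/-- A number is resonant in finitely many ways only. -/
theorem finite_resonant {μ : ι → ℂ} (hμ : ∀ i, 0 < (μ i).re) (ρ : κ → ℂ) (lam : ℂ) :
    {i : Multiset ι × κ | (i.1.map μ).sum + ρ i.2 = lam}.Finite := by
  obtain ⟨c, hc, hcμ⟩ : ∃ c : ℝ, 0 < c ∧ ∀ i, c ≤ (μ i).re := by
    cases isEmpty_or_nonempty ι
    · exact ⟨1, one_pos, fun i ↦ isEmptyElim i⟩
    · obtain ⟨i, hi⟩ := Finite.exists_min fun i ↦ (μ i).re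
      exact ⟨(μ i).re, hμ i, hi⟩
  obtain ⟨b, hb⟩ := (Set.finite_range fun j : κ ↦ (lam - ρ j).re / c).bddAbove
  obtain ⟨N, hN⟩ := exists_nat_ge b
  refine (finite_setOf_card_le (ι := ι) (κ := κ) N).subset fun i hi ↦ ?_
  rw [mem_ofPred_eq] at hi ⊢
  have h1 : ∀ w : Multiset ι, (w.card : ℝ) * c ≤ ((w.map μ).sum).re := by
    intro w
    induction w using Multiset.induction_on with
    | empty => simp
    | cons i w ih =>
      rw [Multiset.card_cons, Multiset.map_cons, Multiset.sum_cons, Complex.add_re, Nat.cast_add,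
        Nat.cast_one, add_mul, one_mul]
      linarith [hcμ i]
  have h2 : ((i.1.map μ).sum).re = (lam - ρ i.2).re := by
    rw [← hi, add_sub_cancel_right]
  have h3 : (i.1.card : ℝ) ≤ (lam - ρ i.2).re / c := by
    rw [le_div_iff₀ hc, ← h2]
    exact h1 i.1
  exact_mod_cast (h3.trans (hb ⟨i.2, rfl⟩)).trans hN

/-- The power `2 ^ k` appears because `isBigO_fderiv_of_isBigO` halves the order of vanishing with
each derivative. The order is not sharp, but any finite order suffices for detecting a nonzero jet.
-/
theorem iterDeriv_eq_zero_of_isBigO {v : ι → E × E} (w : Multiset ι) {k : ℕ} (hk : w.card ≤ k)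
    (u : smoothFunctions E F) (h : (u : E → F) =O[𝓝 0] fun x ↦ ‖x‖ ^ (2 ^ k)) :
    (iterDeriv v w u : E → F) 0 = 0 := by
  induction w using Multiset.induction_on generalizing k u with
  | empty =>
    rw [iterDeriv_zero, Module.End.one_apply]
    exact h.eq_zero_imp.self_of_nhds (by simp)
  | cons i w ih =>
    obtain ⟨k, rfl⟩ : ∃ k', k = k' + 1 := ⟨k - 1, by
      rw [Multiset.card_cons] at hk; omega⟩
    rw [Multiset.card_cons] at hk
    rw [iterDeriv_cons', Module.End.mul_apply]
    refine ih (k := k) (by omega) _ ?_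
    rw [pow_succ, mul_comm] at h
    have h1 := isBigO_fderiv_of_isBigO (contDiff_coe u) (Nat.one_le_two_pow) h
    have h2 : (derivOp (v i) u : E → F) =O[𝓝 0] fderiv ℝ (u : E → F) := by
      refine Asymptotics.IsBigO.of_bound (‖(v i).1‖ + ‖(v i).2‖) (Eventually.of_forall fun x ↦ ?_)
      rw [derivOp_apply]
      refine (norm_add_le _ _).trans ?_
      rw [norm_smul, Complex.norm_I, one_mul, add_mul, mul_comm ‖(v i).1‖, mul_comm ‖(v i).2‖]
      exact add_le_add (ContinuousLinearMap.le_opNorm _ _) (ContinuousLinearMap.le_opNorm _ _)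
    exact h2.trans h1

/-- The coefficient of the transport equation equivalent to `Du(X) + A u = lam u`. -/
def SmoothEnd.coefficient (A : SmoothEnd E F) (lam : ℂ) (x : E) : F →L[ℝ] F :=
  lam • ContinuousLinearMap.id ℝ F - A.toCLM x

theorem SmoothEnd.coefficient_apply (A : SmoothEnd E F) (lam : ℂ) (x : E) (y : F) :
    A.coefficient lam x y = lam • y - A.1 x y := rfl

theorem SmoothEnd.contDiff_coefficient (A : SmoothEnd E F) (lam : ℂ) :
    ContDiff ℝ ∞ (A.coefficient lam) := contDiff_const.sub A.contDiff_toCLM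

theorem isBigO_of_jetCoord_eq_zero {B : E →L[ℝ] E} {μ : ι → ℂ} (fr : FlagFrame B μ)
    {A₀ : F →ₗ[ℂ] F} {ρ : κ → ℂ} (ff : FiberFlag A₀ ρ) {N : ℕ} {u : smoothFunctions E F}
    (h : ∀ i : Multiset ι × κ, i.1.card ≤ N → jetCoord fr.vec ff.coord i u = 0) :
    (u : E → F) =O[𝓝 0] fun x ↦ ‖x‖ ^ (N + 1) :=
  isBigO_of_iterDeriv_eq_zero fr (N + 1) u fun w hw ↦ ff.eq_zero fun j ↦
    h (w, j) (Nat.lt_succ_iff.1 hw)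

/-- Existence of an eigenfunction near the source, for a resonant value. -/
theorem exists_local_eigenfunction {X : E → E} (hX : ContDiff ℝ ∞ X) (hX0 : X 0 = 0)
    (A : SmoothEnd E F) {μ : ι → ℂ} (fr : FlagFrame (fderiv ℝ X 0) μ) {ρ : κ → ℂ}
    (ff : FiberFlag (A.1 0) ρ) (hμ : ∀ i, 0 < (μ i).re) (S : SourceRegion ι X) {lam : ℂ}
    (hlam : ∃ i : Multiset ι × κ, (i.1.map μ).sum + ρ i.2 = lam) :
    ∃ R, 0 < R ∧ R ≤ S.r ∧ ∃ v : E → F, ContDiffOn ℝ ∞ v (S.W ⁻¹' Metric.ball 0 R) ∧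
      (∀ x ∈ S.W ⁻¹' Metric.ball 0 R, fderiv ℝ v x (X x) + A.1 x (v x) = lam • v x) ∧
      ¬ v =ᶠ[𝓝 0] 0 := by
  obtain ⟨mono, htri⟩ := exists_isTriangular_fieldOp hX hX0 A fr ff
  -- A resonant index of maximal rank: no resonance lies beyond it, so nothing obstructs solving for
  -- the higher coefficients.
  obtain ⟨r, hr, hmax⟩ := Set.exists_max_image _ (jetRank fr.ord ff.ord)
    (finite_resonant hμ ρ lam) hlam
  rw [mem_ofPred_eq] at hr
  have hmax' : ∀ i : Multiset ι × κ, (i.1.map μ).sum + ρ i.2 = (r.1.map μ).sum + ρ r.2 →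
      jetRank fr.ord ff.ord i ≤ jetRank fr.ord ff.ord r := fun i hi ↦ hmax i (hi.trans hr)
  choose u hu1 hu0 hueq using fun N ↦ htri.exists_eq hmax' N
  simp only [hr] at hueq
  have ha := A.contDiff_coefficient lam
  obtain ⟨T⟩ := exists_localTransport hX ha 0
  obtain ⟨B⟩ := nonempty_flowBox S T
  have hg : ∀ N, (fun x ↦ fderiv ℝ (u N : E → F) x (X x) - A.coefficient lam x ((u N : E → F) x))
      =O[𝓝 0] fun x ↦ ‖x‖ ^ (N + 1) := by
    intro N
    have h1 := isBigO_of_jetCoord_eq_zero fr ff (N := N) (u := fieldOp X hX A (u N) - lam • u N)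
      fun i hi ↦ by rw [map_sub, map_smul, smul_eq_mul, hueq N i hi, sub_self]
    refine h1.congr_left fun x ↦ ?_
    rw [Submodule.coe_sub, Submodule.coe_smul, Pi.sub_apply, Pi.smul_apply, fieldOp_apply,
      A.coefficient_apply]
    abel
  -- The difference solves the equation up to level `N`. All its resonant coefficients vanish, since
  -- every resonant index has rank at most that of `r`, where the coefficients are prescribed
  -- independently of `N`.
  have huu : ∀ N N', N ≤ N' → ((u N' : E → F) - (u N : E → F)) =O[𝓝 0]
      fun x ↦ ‖x‖ ^ (N + 1) := by
    intro N N' hN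
    have h1 := htri.eq_zero (lam := lam) (N := N) (u := u N' - u N)
      (fun i hi ↦ by
        rw [map_sub, map_sub, hueq N i hi, hueq N' i (hi.trans hN), map_sub, mul_sub])
      (fun i _ hev ↦ by
        rw [map_sub]
        have hrank := hmax i hev
        by_cases hir : i = r
        · rw [hir, hu1, hu1, sub_self]
        · rw [hu0 N' i hrank hir, hu0 N i hrank hir, sub_self])
    exact isBigO_of_jetCoord_eq_zero fr ff (u := u N' - u N) h1
  obtain ⟨v, N₀, hv, hpde, hvu⟩ := B.exists_solution hX ha (fun N ↦ contDiff_coe (u N)) hg huu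
  refine ⟨B.ρ, B.ρ_pos, B.ρ_le, v, hv, fun x hx ↦ ?_, fun hv0 ↦ ?_⟩
  · rw [hpde x hx, A.coefficient_apply, sub_add_cancel]
  -- If `v` vanished near 0, then `u N` would vanish to order `2 ^ r.1.card`, enough to force its
  -- jet coordinate at `r` to be 0, whereas it equals 1.
  · set N := max N₀ (2 ^ r.1.card) with hN
    have h1 : (u N : E → F) =O[𝓝 0] fun x ↦ ‖x‖ ^ (2 ^ r.1.card) := by
      have h2 := (hvu N (le_max_left _ _)).trans
        (isBigO_norm_pow_of_le ((le_max_right N₀ (2 ^ r.1.card)).trans (Nat.le_succ _)))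
      refine h2.neg_left.congr' ?_ EventuallyEq.rfl
      filter_upwards [hv0] with x hx
      rw [Pi.sub_apply, hx, Pi.zero_apply, zero_sub, neg_neg]
    have h3 := iterDeriv_eq_zero_of_isBigO (v := fr.vec) r.1 le_rfl (u N) h1
    have h4 := hu1 N
    rw [jetCoord_apply, h3, map_zero] at h4
    exact zero_ne_one h4

end LocalEigenfunction

/-! ### Covariant derivatives in a trivialization -/

section CovariantDerivativeInTrivialization

set_option linter.unusedSectionVars false

variable {E : Type*} [NormedAddCommGroup E] [NormedSpace ℝ E]
  {M : Type*} [TopologicalSpace M] [ChartedSpace E M]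
  {G : Type*} [NormedAddCommGroup G] [NormedSpace ℝ G] [FiniteDimensional ℝ G]
  {W : M → Type*} [TopologicalSpace (TotalSpace G W)]
  [∀ x, AddCommGroup (W x)] [∀ x, Module ℝ (W x)] [∀ x, TopologicalSpace (W x)]
  [∀ x, IsTopologicalAddGroup (W x)] [∀ x, ContinuousSMul ℝ (W x)]
  [FiberBundle G W] [VectorBundle ℝ G W]

theorem IsCovariantDerivativeOn.apply_sum
    {cov : (Π x : M, W x) → (Π x : M, TangentSpace 𝓘(ℝ, E) x →L[ℝ] W x)}
    (hcov : IsCovariantDerivativeOn G cov univ) {ι : Type*} (t : Finset ι) {σ : ι → Π x : M, W x}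
    {x : M} (hσ : ∀ i ∈ t, MDifferentiableAt 𝓘(ℝ, E) (𝓘(ℝ, E).prod 𝓘(ℝ, G))
      (fun y ↦ TotalSpace.mk' G y (σ i y)) x) :
    cov (∑ i ∈ t, σ i) x = ∑ i ∈ t, cov (σ i) x := by
  classical
  induction t using Finset.induction_on with
  | empty => simpa using hcov.zero (mem_univ x)
  | insert i t hi ih =>
    rw [Finset.sum_insert hi, Finset.sum_insert hi, hcov.add (hσ i (Finset.mem_insert_self i t)),
      ih fun j hj ↦ hσ j (Finset.mem_insert_of_mem hj)]
    have := MDifferentiableAt.sum_section (s := t) (t := σ) (x₀ := x) (I := 𝓘(ℝ, E)) (F := G)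
      fun j hj ↦ hσ j (Finset.mem_insert_of_mem hj)
    simpa [Finset.sum_apply] using! this

variable [IsManifold 𝓘(ℝ, E) ∞ M] [ContMDiffVectorBundle ∞ G W 𝓘(ℝ, E)]
  {ι : Type*} [Fintype ι] (b : Module.Basis ι ℝ G)

theorem mvfderiv_clm_comp {H : Type*} [NormedAddCommGroup H] [NormedSpace ℝ H] (L : G →L[ℝ] H)
    {g : M → G} {y : M} (hg : MDifferentiableAt 𝓘(ℝ, E) 𝓘(ℝ, G) g y)
    (v : TangentSpace 𝓘(ℝ, E) y) :
    mvfderiv 𝓘(ℝ, E) (fun z ↦ L (g z)) y v = L (mvfderiv 𝓘(ℝ, E) g y v) := by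
  have h1 := (L.hasMFDerivAt (x := g y)).comp y hg.hasMFDerivAt
  have h2 : mfderiv 𝓘(ℝ, E) 𝓘(ℝ, H) (fun z ↦ L (g z)) y = _ := h1.mfderiv
  rw [mvfderiv, h2]
  rfl

/-- A covariant derivative in a local trivialization: the derivative of the coordinate expression
plus a zeroth order term. -/
theorem IsCovariantDerivativeOn.apply_trivialization
    {cov : (Π x : M, W x) → (Π x : M, TangentSpace 𝓘(ℝ, E) x →L[ℝ] W x)}
    (hcov : IsCovariantDerivativeOn G cov univ)
    (e : Trivialization G (TotalSpace.proj : TotalSpace G W → M)) [MemTrivializationAtlas e]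
    {y : M} (hy : y ∈ e.baseSet) {s : Π x : M, W x}
    (hs : MDifferentiableAt 𝓘(ℝ, E) (𝓘(ℝ, E).prod 𝓘(ℝ, G)) (fun y ↦ TotalSpace.mk' G y (s y)) y)
    (v : TangentSpace 𝓘(ℝ, E) y) :
    e.linearMapAt ℝ y (cov s y v) =
      mvfderiv 𝓘(ℝ, E) (fun z ↦ (e ⟨z, s z⟩).2) y v +
        ∑ i, b.repr (e ⟨y, s y⟩).2 i • e.linearMapAt ℝ y (cov (e.localFrame b i) y v) := by
  have : ContMDiffVectorBundle 1 G W 𝓘(ℝ, E) := ContMDiffVectorBundle.of_le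
    (ENat.LEInfty.out : (1 : WithTop ℕ∞) ≤ ∞)
  have hloc : MDifferentiableAt 𝓘(ℝ, E) 𝓘(ℝ, G) (fun z ↦ (e ⟨z, s z⟩).2) y :=
    (e.mdifferentiableAt_section_iff 𝓘(ℝ, E) s hy).1 hs
  -- Near `y` the section is Σ c_i times the local frame. In the Leibniz rule the derivatives of the
  -- c_i reassemble the derivative of the coordinate expression, and the rest is of order zero.
  let c : ι → M → ℝ := fun i z ↦ LinearMap.toContinuousLinearMap (b.coord i) (e ⟨z, s z⟩).2
  have hc : ∀ i, MDifferentiableAt 𝓘(ℝ, E) 𝓘(ℝ, ℝ) (c i) y := fun i ↦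
    ((LinearMap.toContinuousLinearMap (b.coord i)).hasMFDerivAt.comp y
      hloc.hasMFDerivAt).mdifferentiableAt
  have hframe : ∀ i, MDifferentiableAt 𝓘(ℝ, E) (𝓘(ℝ, E).prod 𝓘(ℝ, G))
      (fun y ↦ TotalSpace.mk' G y (e.localFrame b i y)) y := fun i ↦
    (contMDiffAt_localFrame_of_mem (I := 𝓘(ℝ, E)) 1 e b i hy).mdifferentiableAt (by simp)
  have hprod : ∀ i, MDifferentiableAt 𝓘(ℝ, E) (𝓘(ℝ, E).prod 𝓘(ℝ, G))
      (fun y ↦ TotalSpace.mk' G y ((c i • e.localFrame b i) y)) y := fun i ↦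
    (hc i).smul_section (hframe i)
  have heq : ∀ᶠ z in 𝓝 y, s z = (∑ i, c i • e.localFrame b i) z := by
    filter_upwards [e.open_baseSet.mem_nhds hy] with z hz
    rw [Finset.sum_apply]
    rw [e.eq_sum_localFrameCoeff_smul (I := 𝓘(ℝ, E)) (b := b) (s := s) hz]
    refine Finset.sum_congr rfl fun i _ ↦ ?_
    rw [Pi.smul_apply', e.localFrameCoeff_eq_coeff hz]
    rfl
  have hsum : MDifferentiableAt 𝓘(ℝ, E) (𝓘(ℝ, E).prod 𝓘(ℝ, G))
      (fun y ↦ TotalSpace.mk' G y ((∑ i, c i • e.localFrame b i) y)) y := by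
    have := MDifferentiableAt.sum_section (s := Finset.univ)
      (t := fun i ↦ c i • e.localFrame b i) (x₀ := y) (I := 𝓘(ℝ, E)) (F := G) fun i _ ↦ hprod i
    simpa [Finset.sum_apply] using! this
  rw [hcov.congr_of_eventuallyEq hs hsum univ_mem heq, hcov.apply_sum _ fun i _ ↦ hprod i]
  simp only [hcov.leibniz (hframe _) (hc _)]
  have hb : ∀ i, e.linearMapAt ℝ y (e.localFrame b i y) = b i := fun i ↦ by
    rw [e.localFrame_apply_of_mem_baseSet b hy, e.coe_linearMapAt_of_mem hy]
    simp [Bundle.Trivialization.basisAt, e.apply_mk_symm hy]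
  have hd : ∑ i, mvfderiv 𝓘(ℝ, E) (c i) y v • b i =
      mvfderiv 𝓘(ℝ, E) (fun z ↦ (e ⟨z, s z⟩).2) y v := by
    simp only [c, mvfderiv_clm_comp _ hloc]
    exact b.sum_repr _
  rw [← hd, sum_apply, map_sum, ← Finset.sum_add_distrib]
  refine Finset.sum_congr rfl fun i _ ↦ ?_
  rw [add_apply, smul_apply, ContinuousLinearMap.smulRight_apply, map_add, map_smul, map_smul, hb,
    add_comm]
  rfl

end CovariantDerivativeInTrivialization

/-! ### Charts centred at a point -/

section CenteredChart

set_option linter.unusedSectionVars false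

variable {E : Type*} [NormedAddCommGroup E] [NormedSpace ℝ E]
  {M : Type*} [TopologicalSpace M] [ChartedSpace E M] [IsManifold 𝓘(ℝ, E) ∞ M]

/-- A chart of a manifold modelled on `E` near `x₀`, a translate of a restriction of the preferred
chart, which maps `x₀` to the origin and whose domain is contained in `B`. -/
structure CenteredChart (x₀ : M) (B : Set M) where
  chart : OpenPartialHomeomorph M E
  apply_self : chart x₀ = 0
  mem_source : x₀ ∈ chart.source
  source_subset : chart.source ⊆ (chartAt E x₀).source
  source_subset' : chart.source ⊆ B
  contMDiffAt : ∀ y ∈ chart.source, ContMDiffAt 𝓘(ℝ, E) 𝓘(ℝ, E) ∞ chart y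
  contMDiffAt_symm : ∀ z ∈ chart.target, ContMDiffAt 𝓘(ℝ, E) 𝓘(ℝ, E) ∞ chart.symm z
  mvfderiv_eq : ∀ y ∈ chart.source, ∀ v : TangentSpace 𝓘(ℝ, E) y,
    mvfderiv 𝓘(ℝ, E) chart y v = (trivializationAt E (TangentSpace 𝓘(ℝ, E)) x₀ ⟨y, v⟩).2

/-- Translation does not change the derivative of the preferred chart, and that derivative is the
trivialization of the tangent bundle at `x₀`; this yields `mvfderiv_eq`. -/
theorem nonempty_centeredChart {x₀ : M} {B : Set M} (hB : IsOpen B) (hx₀ : x₀ ∈ B) :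
    Nonempty (CenteredChart (E := E) x₀ B) := by
  let f : E ≃ₜ E := Homeomorph.addRight (-(chartAt E x₀ x₀))
  let φ : OpenPartialHomeomorph M E := ((chartAt E x₀).transHomeomorph f).restrOpen B hB
  have hφ : ∀ y, φ y = chartAt E x₀ y + -(chartAt E x₀ x₀) := fun y ↦ rfl
  have hφs : ∀ z, φ.symm z = (chartAt E x₀).symm (z + chartAt E x₀ x₀) := fun z ↦ by
    change (chartAt E x₀).symm (z + -(-(chartAt E x₀ x₀))) = _
    rw [neg_neg]
  have hsrc : φ.source = (chartAt E x₀).source ∩ B := rfl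
  have hs1 : ∀ y ∈ φ.source, y ∈ (chartAt E x₀).source := fun y hy ↦ (hsrc ▸ hy).1
  have hc : ∀ y ∈ φ.source, ContMDiffAt 𝓘(ℝ, E) 𝓘(ℝ, E) ∞ (chartAt E x₀) y := fun y hy ↦
    (contMDiffOn_chart (I := 𝓘(ℝ, E)) (n := ∞) (x := x₀)).contMDiffAt
      ((chartAt E x₀).open_source.mem_nhds (hs1 y hy))
  refine ⟨⟨φ, ?_, ⟨mem_chart_source E x₀, hx₀⟩, hs1, fun y hy ↦ (hsrc ▸ hy).2, fun y hy ↦ ?_,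
    fun z hz ↦ ?_, fun y hy v ↦ ?_⟩⟩
  · rw [hφ, add_neg_cancel]
  · have h1 : ContMDiff 𝓘(ℝ, E) 𝓘(ℝ, E) ∞ (fun z : E ↦ z + -(chartAt E x₀ x₀)) :=
      (contDiff_id.add contDiff_const).contMDiff
    exact h1.contMDiffAt.comp y (hc y hy)
  · have hz' : z + chartAt E x₀ x₀ ∈ (chartAt E x₀).target := by
      have h2 := (chartAt E x₀).map_source (hs1 _ (φ.map_target hz))
      have h3 := hφ (φ.symm z)
      rw [φ.right_inv hz] at h3
      have h4 : z + chartAt E x₀ x₀ = chartAt E x₀ (φ.symm z) := by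
        conv_lhs => rw [h3]
        rw [neg_add_cancel_right]
      rw [h4]
      exact h2
    have h1 : ContMDiff 𝓘(ℝ, E) 𝓘(ℝ, E) ∞ (fun z : E ↦ z + chartAt E x₀ x₀) :=
      (contDiff_id.add contDiff_const).contMDiff
    have h2 : ContMDiffAt 𝓘(ℝ, E) 𝓘(ℝ, E) ∞ (chartAt E x₀).symm (z + chartAt E x₀ x₀) :=
      (contMDiffOn_chart_symm (I := 𝓘(ℝ, E)) (n := ∞) (x := x₀)).contMDiffAt
        ((chartAt E x₀).open_target.mem_nhds hz')
    have h3 : (φ.symm : E → M) = (chartAt E x₀).symm ∘ fun z ↦ z + chartAt E x₀ x₀ :=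
      funext hφs
    rw [h3]
    exact ContMDiffAt.comp z h2 h1.contMDiffAt
  · have hd : HasMFDerivAt 𝓘(ℝ, E) 𝓘(ℝ, E) (chartAt E x₀) y
        (mfderiv 𝓘(ℝ, E) 𝓘(ℝ, E) (chartAt E x₀) y) :=
      ((hc y hy).mdifferentiableAt (by simp)).hasMFDerivAt
    have h1 : HasMFDerivAt 𝓘(ℝ, E) 𝓘(ℝ, E) (fun z : E ↦ z + -(chartAt E x₀ x₀)) (chartAt E x₀ y)
        (ContinuousLinearMap.id ℝ E) :=
      ((hasFDerivAt_id (chartAt E x₀ y)).add_const (-(chartAt E x₀ x₀))).hasMFDerivAt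
    have h2 := h1.comp y hd
    have h3 : mfderiv 𝓘(ℝ, E) 𝓘(ℝ, E) φ y = _ := h2.mfderiv
    have h4 := TangentBundle.continuousLinearMapAt_trivializationAt (I := 𝓘(ℝ, E)) (hs1 y hy)
    have h5 := congrArg (fun L ↦ L v) h4
    have hb : y ∈ (trivializationAt E (TangentSpace 𝓘(ℝ, E)) x₀).baseSet := by
      rw [TangentBundle.trivializationAt_baseSet]
      exact hs1 y hy
    have h6 : (trivializationAt E (TangentSpace 𝓘(ℝ, E)) x₀).continuousLinearMapAt ℝ y v =
        (trivializationAt E (TangentSpace 𝓘(ℝ, E)) x₀ ⟨y, v⟩).2 := by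
      rw [Bundle.Trivialization.continuousLinearMapAt_apply,
        Bundle.Trivialization.coe_linearMapAt_of_mem _ hb]
    rw [← h6, mvfderiv, h3]
    exact h5.symm

namespace CenteredChart

variable {x₀ : M} {B : Set M} (c : CenteredChart (E := E) x₀ B)

theorem zero_mem_target : (0 : E) ∈ c.chart.target := c.apply_self ▸ c.chart.map_source c.mem_source

/-- The restriction of a centered chart to a neighbourhood of the origin. -/
def restr {O : Set E} (hO : IsOpen O) (h0 : (0 : E) ∈ O) : CenteredChart (E := E) x₀ B where
  chart := c.chart.trans (OpenPartialHomeomorph.ofSet O hO)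
  apply_self := c.apply_self
  mem_source := by
    rw [OpenPartialHomeomorph.trans_source]
    exact ⟨c.mem_source, by
      rw [OpenPartialHomeomorph.ofSet_source, mem_preimage, c.apply_self]; exact h0⟩
  source_subset y hy := c.source_subset (c.chart.trans_source (OpenPartialHomeomorph.ofSet O hO) ▸ hy).1
  source_subset' y hy := c.source_subset' (c.chart.trans_source (OpenPartialHomeomorph.ofSet O hO) ▸ hy).1
  contMDiffAt y hy := c.contMDiffAt y (c.chart.trans_source (OpenPartialHomeomorph.ofSet O hO) ▸ hy).1
  contMDiffAt_symm z hz := c.contMDiffAt_symm z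
    (c.chart.trans_target (OpenPartialHomeomorph.ofSet O hO) ▸ hz).2
  mvfderiv_eq y hy := c.mvfderiv_eq y (c.chart.trans_source (OpenPartialHomeomorph.ofSet O hO) ▸ hy).1

theorem restr_source {O : Set E} (hO : IsOpen O) (h0 : (0 : E) ∈ O) :
    (c.restr hO h0).chart.source = c.chart.source ∩ c.chart ⁻¹' O :=
  c.chart.trans_source _

theorem hasDerivWithinAt {γ : ℝ → M} {J : Set ℝ} {t : ℝ} {v : TangentSpace 𝓘(ℝ, E) (γ t)}
    (hγ : HasMFDerivWithinAt 𝓘(ℝ, ℝ) 𝓘(ℝ, E) γ J t ((1 : ℝ →L[ℝ] ℝ).smulRight v))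
    (ht : γ t ∈ c.chart.source) :
    HasDerivWithinAt (fun s ↦ c.chart (γ s))
      (trivializationAt E (TangentSpace 𝓘(ℝ, E)) x₀ ⟨γ t, v⟩).2 J t := by
  have h1 := ((c.contMDiffAt _ ht).mdifferentiableAt (by simp)).hasMFDerivAt
  have h2 := h1.comp_hasMFDerivWithinAt t hγ
  have h3 : HasMFDerivWithinAt 𝓘(ℝ, ℝ) 𝓘(ℝ, E) (c.chart ∘ γ) J t
      (ContinuousLinearMap.toSpanSingleton ℝ (mvfderiv 𝓘(ℝ, E) c.chart (γ t) v) : ℝ →L[ℝ] E) := by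
    refine h2.congr_mfderiv (ContinuousLinearMap.ext fun a ↦ ?_)
    change mfderiv 𝓘(ℝ, E) 𝓘(ℝ, E) c.chart (γ t) (((1 : ℝ →L[ℝ] ℝ) a) • v) = _
    rw [map_smul]
    rfl
  rw [← c.mvfderiv_eq _ ht, hasDerivWithinAt_iff_hasFDerivWithinAt]
  exact hasMFDerivWithinAt_iff_hasFDerivWithinAt.1 h3

/-- The converse of `CenteredChart.hasDerivWithinAt`. -/
theorem hasMFDerivWithinAt_symm {δ : ℝ → E} {J : Set ℝ} {t : ℝ} {w : E}
    (hδ : HasDerivWithinAt δ w J t) (ht : δ t ∈ c.chart.target)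
    {v : TangentSpace 𝓘(ℝ, E) (c.chart.symm (δ t))}
    (hv : (trivializationAt E (TangentSpace 𝓘(ℝ, E)) x₀ ⟨c.chart.symm (δ t), v⟩).2 = w) :
    HasMFDerivWithinAt 𝓘(ℝ, ℝ) 𝓘(ℝ, E) (fun s ↦ c.chart.symm (δ s)) J t
      ((1 : ℝ →L[ℝ] ℝ).smulRight v) := by
  have hs := c.chart.map_target ht
  have h1 := ((c.contMDiffAt_symm _ ht).mdifferentiableAt (by simp)).hasMFDerivAt
  have h2 := h1.comp_hasMFDerivWithinAt t
    (hasMFDerivWithinAt_iff_hasFDerivWithinAt.2 hδ.hasFDerivWithinAt)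
  have h3 := ((c.contMDiffAt _ hs).mdifferentiableAt (by simp)).hasMFDerivAt
  have h4 := ((c.contMDiffAt_symm _ (c.chart.map_source hs)).mdifferentiableAt
    (by simp)).hasMFDerivAt.comp _ h3
  have h5 : mfderiv 𝓘(ℝ, E) 𝓘(ℝ, E) c.chart.symm (δ t) w = v := by
    have h6 : HasMFDerivAt 𝓘(ℝ, E) 𝓘(ℝ, E) (c.chart.symm ∘ c.chart) (c.chart.symm (δ t))
        (ContinuousLinearMap.id ℝ E) := by
      refine (hasMFDerivAt_id _).congr_of_eventuallyEq ?_
      filter_upwards [c.chart.open_source.mem_nhds hs] with y hy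
      exact c.chart.left_inv hy
    have h7 := congrArg (fun L : E →L[ℝ] E ↦ L v) (hasMFDerivAt_unique h4 h6)
    have h8 : ∀ z, z = δ t → (mfderiv 𝓘(ℝ, E) 𝓘(ℝ, E) c.chart.symm z : E →L[ℝ] E) =
        mfderiv 𝓘(ℝ, E) 𝓘(ℝ, E) c.chart.symm (δ t) := by
      rintro _ rfl
      rfl
    rw [← hv, ← c.mvfderiv_eq _ hs]
    refine Eq.trans ?_ h7
    exact congrArg (fun L : E →L[ℝ] E ↦ L _) (h8 _ (c.chart.right_inv ht)).symm
  refine h2.congr_mfderiv (ContinuousLinearMap.ext fun (a : ℝ) ↦ ?_)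
  rw [← h5]
  exact map_smul (mfderiv 𝓘(ℝ, E) 𝓘(ℝ, E) c.chart.symm (δ t)) a w

/-- The derivative of a vector valued function in a centered chart. -/
theorem mvfderiv_apply {G : Type*} [NormedAddCommGroup G] [NormedSpace ℝ G] {g : M → G} {y : M}
    (hy : y ∈ c.chart.source) (hg : MDifferentiableAt 𝓘(ℝ, E) 𝓘(ℝ, G) g y)
    (v : TangentSpace 𝓘(ℝ, E) y) :
    mvfderiv 𝓘(ℝ, E) g y v = fderiv ℝ (fun z ↦ g (c.chart.symm z)) (c.chart y)
      (trivializationAt E (TangentSpace 𝓘(ℝ, E)) x₀ ⟨y, v⟩).2 := by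
  have h1 := ((c.contMDiffAt y hy).mdifferentiableAt (by simp)).hasMFDerivAt
  have h2 : MDifferentiableAt 𝓘(ℝ, E) 𝓘(ℝ, G) (fun z ↦ g (c.chart.symm z)) (c.chart y) := by
    have hg' : MDifferentiableAt 𝓘(ℝ, E) 𝓘(ℝ, G) g (c.chart.symm (c.chart y)) := by
      rwa [c.chart.left_inv hy]
    exact MDifferentiableAt.comp (c.chart y) hg'
      ((c.contMDiffAt_symm _ (c.chart.map_source hy)).mdifferentiableAt (by simp))
  have h3 := h2.hasMFDerivAt.comp y h1
  have h4 := h3.congr_of_eventuallyEq (f₁ := g) (by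
    filter_upwards [c.chart.open_source.mem_nhds hy] with z hz
    simp [c.chart.left_inv hz])
  rw [← c.mvfderiv_eq y hy]
  have h5 := congrArg (fun L : E →L[ℝ] G ↦ L v) h4.mfderiv
  refine Eq.trans h5 ?_
  rw [← mfderiv_eq_fderiv]
  rfl

end CenteredChart

end CenteredChart

/-! ### Coordinate expression of the operator ∇_X + A -/

section LocalModel

set_option linter.unusedSectionVars false

variable {E : Type*} [NormedAddCommGroup E] [NormedSpace ℝ E] [FiniteDimensional ℝ E]
  {M : Type*} [TopologicalSpace M] [ChartedSpace E M] [IsManifold 𝓘(ℝ, E) ∞ M]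
  {F : Type*} [NormedAddCommGroup F] [NormedSpace ℂ F] [FiniteDimensional ℂ F]
  {V : M → Type*} [TopologicalSpace (TotalSpace F V)]
  [∀ x, AddCommGroup (V x)] [∀ x, Module ℂ (V x)] [∀ x, TopologicalSpace (V x)]
  [∀ x, IsTopologicalAddGroup (V x)] [∀ x, ContinuousSMul ℝ (V x)]
  [FiberBundle F V] [VectorBundle ℂ F V] [VectorBundle ℝ F V]
  [ContMDiffVectorBundle ∞ F V 𝓘(ℝ, E)]

variable (E F) in
/-- Smoothness of a section of `V` at a point. -/
def SmoothSectionAt (s : Π x : M, V x) (y : M) : Prop :=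
  ContMDiffAt 𝓘(ℝ, E) (𝓘(ℝ, E).prod 𝓘(ℝ, F)) ∞ (fun x ↦ TotalSpace.mk' F x (s x)) y

/-- The operator `∇_X + A` on globally defined sections. -/
def transportAt (nabla : ComplexConnection E F V) (X : Π x : M, TangentSpace 𝓘(ℝ, E) x)
    (A : SmoothEndomorphismField E F V) (s : Π x : M, V x) : Π x : M, V x :=
  fun x ↦ nabla.toFun s x (X x) + A.toFun x (s x)

variable {nabla : ComplexConnection E F V} {X : Π x : M, TangentSpace 𝓘(ℝ, E) x}
  {A : SmoothEndomorphismField E F V}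

theorem SmoothSectionAt.mdifferentiableAt {s : Π x : M, V x} {y : M}
    (hs : SmoothSectionAt E F s y) :
    MDifferentiableAt 𝓘(ℝ, E) (𝓘(ℝ, E).prod 𝓘(ℝ, F)) (fun x ↦ TotalSpace.mk' F x (s x)) y :=
  ContMDiffAt.mdifferentiableAt hs (by simp)

theorem SmoothSectionAt.congr {s t : Π x : M, V x} {y : M} (hs : SmoothSectionAt E F s y)
    (h : ∀ᶠ x in 𝓝 y, t x = s x) : SmoothSectionAt E F t y :=
  ContMDiffAt.congr_of_eventuallyEq hs (h.mono fun x hx ↦ by simp only [hx])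

theorem SmoothSectionAt.add {s t : Π x : M, V x} {y : M} (hs : SmoothSectionAt E F s y)
    (ht : SmoothSectionAt E F t y) : SmoothSectionAt E F (s + t) y :=
  ContMDiffAt.add_section hs ht

theorem SmoothSectionAt.const_smul {s : Π x : M, V x} {y : M} (c : ℂ)
    (hs : SmoothSectionAt E F s y) : SmoothSectionAt E F (c • s) y := by
  let e := trivializationAt F V y
  have hy : y ∈ e.baseSet := mem_baseSet_trivializationAt F V y
  refine (e.contMDiffAt_section_iff hy).2 ?_
  have hL : ContMDiff 𝓘(ℝ, F) 𝓘(ℝ, F) ∞ (fun y : F ↦ c • y) := (contDiff_const_smul c).contMDiff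
  refine (hL.contMDiffAt.comp y ((e.contMDiffAt_section_iff hy).1 hs)).congr_of_eventuallyEq ?_
  filter_upwards [e.open_baseSet.mem_nhds hy] with x hx
  exact (e.linear ℂ hx).2 c (s x)

theorem transportAt_congr {s t : Π x : M, V x} {y : M} (hs : SmoothSectionAt E F s y)
    (h : ∀ᶠ x in 𝓝 y, t x = s x) : transportAt nabla X A t y = transportAt nabla X A s y := by
  have h1 := nabla.isCovariantDerivativeOnUniv.congr_of_eventuallyEq
    (hs.congr h).mdifferentiableAt hs.mdifferentiableAt univ_mem h
  have h2 : nabla.toFun t y = nabla.toFun s y := h1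
  rw [transportAt, transportAt, h2, h.self_of_nhds]

theorem transportAt_add {s t : Π x : M, V x} {y : M} (hs : SmoothSectionAt E F s y)
    (ht : SmoothSectionAt E F t y) :
    transportAt nabla X A (s + t) y = transportAt nabla X A s y + transportAt nabla X A t y := by
  have h1 := nabla.isCovariantDerivativeOnUniv.add hs.mdifferentiableAt ht.mdifferentiableAt
  have h2 : nabla.toFun (s + t) y = nabla.toFun s y + nabla.toFun t y := h1
  simp only [transportAt, h2, add_apply, Pi.add_apply, map_add]
  abel

theorem transportAt_smul {s : Π x : M, V x} {y : M} (c : ℂ) (hs : SmoothSectionAt E F s y) :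
    transportAt nabla X A (c • s) y = c • transportAt nabla X A s y := by
  simp only [transportAt, nabla.map_smul c _ y hs.mdifferentiableAt (X y), Pi.smul_apply, map_smul,
    smul_add]

theorem SmoothSectionAt.transportAt [T2Space M]
    (hX : ContMDiff 𝓘(ℝ, E) 𝓘(ℝ, E).tangent ∞ (fun x ↦ (⟨x, X x⟩ : TangentBundle 𝓘(ℝ, E) M)))
    {s : Π x : M, V x} {U : TopologicalSpace.Opens M} (hs : ∀ x ∈ U, SmoothSectionAt E F s x)
    {y : M} (hy : y ∈ U) : SmoothSectionAt E F (transportAt nabla X A s) y := by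
  have h0 : ∀ x ∈ U, extendByZero (fun x : U ↦ s x) x = s x := fun x hx ↦
    extendByZero_apply (fun x : U ↦ s x) ⟨x, hx⟩
  have h1 : ∀ x ∈ U, ∀ᶠ z in 𝓝 x, extendByZero (fun x : U ↦ s x) z = s z := fun x hx ↦ by
    filter_upwards [U.isOpen.mem_nhds hx] with z hz using h0 z hz
  let s' : smoothSections E F V U :=
    ⟨fun x ↦ s x, fun x hx ↦ ((hs x hx).congr (h1 x hx)).contMDiffWithinAt⟩
  have h2 : SmoothSectionAt E F (extendByZero (transportFun nabla X A s'.1)) y :=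
    (transportFun_mem nabla hX A s' y hy).contMDiffAt (U.isOpen.mem_nhds hy)
  refine h2.congr ?_
  filter_upwards [U.isOpen.mem_nhds hy] with x hx
  rw [extendByZero_apply _ ⟨x, hx⟩, ← transportAt_congr (hs x hx) (h1 x hx)]
  simp [transportFun, _root_.transportAt, s', h0 x hx]

end LocalModel

section LocalModel

set_option linter.unusedSectionVars false

variable {E : Type*} [NormedAddCommGroup E] [NormedSpace ℝ E] [FiniteDimensional ℝ E]
  {M : Type*} [TopologicalSpace M] [ChartedSpace E M] [IsManifold 𝓘(ℝ, E) ∞ M]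
  {F : Type*} [NormedAddCommGroup F] [NormedSpace ℂ F] [FiniteDimensional ℂ F]
  {V : M → Type*} [TopologicalSpace (TotalSpace F V)]
  [∀ x, AddCommGroup (V x)] [∀ x, Module ℂ (V x)] [∀ x, TopologicalSpace (V x)]
  [∀ x, IsTopologicalAddGroup (V x)] [∀ x, ContinuousSMul ℝ (V x)]
  [FiberBundle F V] [VectorBundle ℂ F V] [VectorBundle ℝ F V]
  [ContMDiffVectorBundle ∞ F V 𝓘(ℝ, E)]
  {nabla : ComplexConnection E F V} {X : Π x : M, TangentSpace 𝓘(ℝ, E) x}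
  {A : SmoothEndomorphismField E F V}

/-- The local frame of sections which are constant in a trivialization. -/
def constSection (e : Trivialization F (TotalSpace.proj : TotalSpace F V → M))
    [MemTrivializationAtlas e] (f : F) : Π x : M, V x := fun x ↦ e.symmₗ ℂ x f

theorem apply_constSection (e : Trivialization F (TotalSpace.proj : TotalSpace F V → M))
    [MemTrivializationAtlas e] (f : F) {y : M} (hy : y ∈ e.baseSet) :
    (e ⟨y, constSection e f y⟩).2 = f := by
  rw [constSection, e.symmₗ_apply hy, e.apply_mk_symm hy]

theorem constSection_apply (e : Trivialization F (TotalSpace.proj : TotalSpace F V → M))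
    [MemTrivializationAtlas e] {y : M} (hy : y ∈ e.baseSet) (v : V y) :
    constSection e (e ⟨y, v⟩).2 y = v := by
  have h := e.symmₗ_linearMapAt (R := ℂ) hy v
  rwa [e.coe_linearMapAt_of_mem hy] at h

theorem smoothSectionAt_constSection (e : Trivialization F (TotalSpace.proj : TotalSpace F V → M))
    [MemTrivializationAtlas e] (f : F) {y : M} (hy : y ∈ e.baseSet) :
    SmoothSectionAt E F (constSection e f) y := by
  refine (e.contMDiffAt_section_iff hy).2 ?_
  refine (contMDiffAt_const (c := f)).congr_of_eventuallyEq ?_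
  filter_upwards [e.open_baseSet.mem_nhds hy] with x hx
  exact apply_constSection e f hx

/-- In a trivialization, `∇_X + A` is the derivative along `X` plus a zeroth order term, which is
given by the values on the constant sections. -/
theorem apply_transportAt (e : Trivialization F (TotalSpace.proj : TotalSpace F V → M))
    [MemTrivializationAtlas e] {s : Π x : M, V x} {y : M} (hy : y ∈ e.baseSet)
    (hs : SmoothSectionAt E F s y) :
    (e ⟨y, transportAt nabla X A s y⟩).2 =
      mvfderiv 𝓘(ℝ, E) (fun z ↦ (e ⟨z, s z⟩).2) y (X y) +
        (e ⟨y, transportAt nabla X A (constSection e (e ⟨y, s y⟩).2) y⟩).2 := by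
  -- The section and the constant section with the same value at `y` have the same zeroth order
  -- term. For the constant section the derivative term vanishes, so its image is exactly that term.
  let b := Module.finBasis ℝ F
  set f := (e ⟨y, s y⟩).2 with hf
  have hadd : ∀ v w : V y, (e ⟨y, v + w⟩).2 = (e ⟨y, v⟩).2 + (e ⟨y, w⟩).2 := (e.linear ℂ hy).1
  have h1 := nabla.isCovariantDerivativeOnUniv.apply_trivialization b e hy
    hs.mdifferentiableAt (X y)
  have h2 := nabla.isCovariantDerivativeOnUniv.apply_trivialization b e hy
    (smoothSectionAt_constSection e f hy).mdifferentiableAt (X y)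
  have h3 : mvfderiv 𝓘(ℝ, E) (fun z ↦ (e ⟨z, constSection e f z⟩).2) y (X y) = 0 := by
    have h4 : HasMFDerivAt 𝓘(ℝ, E) 𝓘(ℝ, F) (fun z ↦ (e ⟨z, constSection e f z⟩).2) y
        (0 : E →L[ℝ] F) := by
      refine (hasMFDerivAt_const f y).congr_of_eventuallyEq ?_
      filter_upwards [e.open_baseSet.mem_nhds hy] with x hx
      exact apply_constSection e f hx
    rw [mvfderiv, h4.mfderiv]
    rfl
  rw [e.coe_linearMapAt_of_mem hy] at h1 h2
  rw [h3, zero_add, apply_constSection e f hy] at h2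
  rw [← h2] at h1
  have h5 : constSection e f y = s y := constSection_apply e hy (s y)
  rw [transportAt, transportAt, hadd, hadd, h5, ← add_assoc]
  exact congrArg (· + _) h1

/-- The zeroth order part of `∇_X + A` in a trivialization. -/
def zerothOrder (nabla : ComplexConnection E F V) (X : Π x : M, TangentSpace 𝓘(ℝ, E) x)
    (A : SmoothEndomorphismField E F V)
    (e : Trivialization F (TotalSpace.proj : TotalSpace F V → M))
    [MemTrivializationAtlas e] {y : M} (hy : y ∈ e.baseSet) : F →ₗ[ℂ] F where
  toFun f := (e ⟨y, transportAt nabla X A (constSection e f) y⟩).2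
  map_add' f g := by
    have h : constSection e (f + g) = constSection e f + constSection e g := by
      funext x; simp [constSection]
    rw [h, transportAt_add (smoothSectionAt_constSection e f hy)
      (smoothSectionAt_constSection e g hy)]
    exact (e.linear ℂ hy).1 _ _
  map_smul' c f := by
    have h : constSection e (c • f) = c • constSection e f := by
      funext x; simp [constSection]
    rw [h, transportAt_smul c (smoothSectionAt_constSection e f hy)]
    exact (e.linear ℂ hy).2 _ _

/-- The coordinate expression at `x₀` of the operator `∇_X + A`, as an operator on functions on
`E` with values in `F`. -/
structure LocalModel (nabla : ComplexConnection E F V) (X : Π x : M, TangentSpace 𝓘(ℝ, E) x)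
    (A : SmoothEndomorphismField E F V) (x₀ : M) extends
    CenteredChart (E := E) x₀ (trivializationAt F V x₀).baseSet where
  field : E → E
  contDiff_field : ContDiff ℝ ∞ field
  coeff : SmoothEnd E F
  field_eq : ∀ y ∈ chart.source,
    field (chart y) = (trivializationAt E (TangentSpace 𝓘(ℝ, E)) x₀ ⟨y, X y⟩).2
  coeff_eq : ∀ y (hy : y ∈ chart.source), coeff.1 (chart y) =
    zerothOrder nabla X A (trivializationAt F V x₀) (source_subset' hy)

/-- The coordinate expressions of `X` and of the zeroth order part are smooth on a ball only.
Cutoffs extend them to `E`, and the chart is shrunk to the half ball on which the cutoffs equal 1.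
-/
theorem nonempty_localModel [T2Space M] (nabla : ComplexConnection E F V)
    (hX : ContMDiff 𝓘(ℝ, E) 𝓘(ℝ, E).tangent ∞ (fun x ↦ (⟨x, X x⟩ : TangentBundle 𝓘(ℝ, E) M)))
    (A : SmoothEndomorphismField E F V) (x₀ : M) : Nonempty (LocalModel nabla X A x₀) := by
  classical
  let e := trivializationAt F V x₀
  let eT := trivializationAt E (TangentSpace 𝓘(ℝ, E) : M → Type _) x₀
  obtain ⟨c⟩ := nonempty_centeredChart (E := E) e.open_baseSet
    (mem_baseSet_trivializationAt F V x₀)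
  obtain ⟨r, hr, hball⟩ := Metric.isOpen_iff.1 c.chart.open_target 0 c.zero_mem_target
  have hsrc : ∀ z ∈ Metric.ball (0 : E) r, c.chart.symm z ∈ c.chart.source := fun z hz ↦
    c.chart.map_target (hball hz)
  let fld : E → E := fun z ↦ (eT ⟨c.chart.symm z, X (c.chart.symm z)⟩).2
  have hfld : ContDiffOn ℝ ∞ fld (Metric.ball 0 r) := by
    intro z hz
    have hb : c.chart.symm z ∈ eT.baseSet := by
      rw [TangentBundle.trivializationAt_baseSet]
      exact c.source_subset (hsrc z hz)
    have h1 := (eT.contMDiffAt_section_iff (IB := 𝓘(ℝ, E)) (n := ∞) (s := X) hb).1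
      (hX (c.chart.symm z))
    exact (contMDiffAt_iff_contDiffAt.1
      (h1.comp z (c.contMDiffAt_symm z (hball hz)))).contDiffWithinAt
  let cf : E → F →ₗ[ℂ] F := fun z ↦ if h : c.chart.symm z ∈ e.baseSet then
    zerothOrder nabla X A e h else 0
  have hcf0 : ∀ z ∈ Metric.ball (0 : E) r, ∀ f,
      cf z f = (e ⟨c.chart.symm z, transportAt nabla X A (constSection e f) (c.chart.symm z)⟩).2 :=
    fun z hz f ↦ by
      simp only [cf, dif_pos (c.source_subset' (hsrc z hz))]
      rfl
  have hcf : ∀ f, ContDiffOn ℝ ∞ (fun z ↦ cf z f) (Metric.ball 0 r) := by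
    intro f z hz
    have hb : c.chart.symm z ∈ e.baseSet := c.source_subset' (hsrc z hz)
    have h0 : SmoothSectionAt E F (transportAt nabla X A (constSection e f)) (c.chart.symm z) :=
      SmoothSectionAt.transportAt hX (U := ⟨e.baseSet, e.open_baseSet⟩)
        (fun x hx ↦ smoothSectionAt_constSection e f hx) hb
    have h1 := (e.contMDiffAt_section_iff hb).1 h0
    have h2 := (contMDiffAt_iff_contDiffAt.1
      (h1.comp z (c.contMDiffAt_symm z (hball hz)))).contDiffWithinAt (s := Metric.ball 0 r)
    exact h2.congr (fun w hw ↦ hcf0 w hw f) (hcf0 z hz f)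
  obtain ⟨χ, hχ, hχ1, hχE⟩ := exists_smooth_cutoff E (0 : E) hr
  obtain ⟨χ', hχ', hχ1', hχF⟩ := exists_smooth_cutoff F (0 : E) hr
  have h0 : (0 : E) ∈ Metric.ball (0 : E) (r / 2) := Metric.mem_ball_self (by positivity)
  refine ⟨{ c.restr Metric.isOpen_ball h0 with
    field := fun z ↦ χ z • fld z
    contDiff_field := hχE _ hfld
    coeff := ⟨fun z ↦ ((χ' z : ℝ) : ℂ) • cf z, fun f ↦ ?_⟩
    field_eq := fun y hy ↦ ?_
    coeff_eq := fun y hy ↦ ?_ }⟩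
  · simpa using! hχF _ (hcf f)
  · have hy' : y ∈ c.chart.source ∩ c.chart ⁻¹' Metric.ball 0 (r / 2) :=
      c.restr_source Metric.isOpen_ball h0 ▸ hy
    change χ (c.chart y) • fld (c.chart y) = _
    simp only [hχ1 _ hy'.2, one_smul, fld]
    exact congrArg (fun x ↦ (eT ⟨x, X x⟩).2) (c.chart.left_inv hy'.1)
  · have hy' : y ∈ c.chart.source ∩ c.chart ⁻¹' Metric.ball 0 (r / 2) :=
      c.restr_source Metric.isOpen_ball h0 ▸ hy
    change ((χ' (c.chart y) : ℝ) : ℂ) • cf (c.chart y) = _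
    ext f
    have hz : c.chart y ∈ Metric.ball (0 : E) r := Metric.ball_subset_ball (by linarith) hy'.2
    simp only [hχ1' _ hy'.2, Complex.ofReal_one, one_smul, hcf0 _ hz]
    exact congrArg (fun x ↦ (e ⟨x, transportAt nabla X A (constSection e f) x⟩).2)
      (c.chart.left_inv hy'.1)

namespace LocalModel

variable {x₀ : M} (m : LocalModel nabla X A x₀)

/-- The coordinate expression of a section. -/
def loc (_m : LocalModel nabla X A x₀) (s : Π x : M, V x) (z : E) : F :=
  (trivializationAt F V x₀ ⟨_m.chart.symm z, s (_m.chart.symm z)⟩).2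

/-- The section with a given coordinate expression. -/
def sec (_m : LocalModel nabla X A x₀) (u : E → F) : Π x : M, V x :=
  fun x ↦ constSection (trivializationAt F V x₀) (u (_m.chart x)) x

theorem loc_chart (s : Π x : M, V x) {y : M} (hy : y ∈ m.chart.source) :
    m.loc s (m.chart y) = (trivializationAt F V x₀ ⟨y, s y⟩).2 :=
  congrArg (fun x ↦ (trivializationAt F V x₀ ⟨x, s x⟩).2) (m.chart.left_inv hy)

theorem loc_sec (u : E → F) {z : E} (hz : z ∈ m.chart.target) : m.loc (m.sec u) z = u z := by
  rw [loc, sec, apply_constSection _ _ (m.source_subset' (m.chart.map_target hz)),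
    m.chart.right_inv hz]

theorem apply_sec (u : E → F) {y : M} (hy : y ∈ m.chart.source) :
    (trivializationAt F V x₀ ⟨y, m.sec u y⟩).2 = u (m.chart y) :=
  apply_constSection _ _ (m.source_subset' hy)

theorem sec_loc (s : Π x : M, V x) {y : M} (hy : y ∈ m.chart.source) : m.sec (m.loc s) y = s y := by
  rw [sec, m.loc_chart s hy, constSection_apply _ (m.source_subset' hy)]

theorem loc_chart_eq_zero_iff (s : Π x : M, V x) {y : M} (hy : y ∈ m.chart.source) :
    m.loc s (m.chart y) = 0 ↔ s y = 0 := by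
  refine ⟨fun h ↦ ?_, fun h ↦ ?_⟩
  · rw [← m.sec_loc s hy, sec, h, constSection, map_zero]
  · rw [m.loc_chart s hy, h]
    have := (trivializationAt F V x₀).linearMapAt ℂ y |>.map_zero
    rwa [(trivializationAt F V x₀).coe_linearMapAt_of_mem (m.source_subset' hy)] at this

theorem contDiffAt_loc {s : Π x : M, V x} {y : M} (hy : y ∈ m.chart.source)
    (hs : SmoothSectionAt E F s y) : ContDiffAt ℝ ∞ (m.loc s) (m.chart y) := by
  have h1 := ((trivializationAt F V x₀).contMDiffAt_section_iff (m.source_subset' hy)).1 hs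
  have h2 : ContMDiffAt 𝓘(ℝ, E) 𝓘(ℝ, F) ∞ (fun x ↦ (trivializationAt F V x₀ ⟨x, s x⟩).2)
      (m.chart.symm (m.chart y)) := by
    rwa [m.chart.left_inv hy]
  exact contMDiffAt_iff_contDiffAt.1
    (h2.comp (m.chart y) (m.contMDiffAt_symm _ (m.chart.map_source hy)))

theorem smoothSectionAt_sec {u : E → F} {y : M} (hy : y ∈ m.chart.source)
    (hu : ContDiffAt ℝ ∞ u (m.chart y)) : SmoothSectionAt E F (m.sec u) y := by
  refine ((trivializationAt F V x₀).contMDiffAt_section_iff (m.source_subset' hy)).2 ?_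
  refine ((contMDiffAt_iff_contDiffAt.2 hu).comp y (m.contMDiffAt y hy)).congr_of_eventuallyEq ?_
  filter_upwards [m.chart.open_source.mem_nhds hy] with x hx
  exact m.apply_sec u hx

/-- The coordinate expression of `∇_X + A`. -/
theorem loc_transportAt {s : Π x : M, V x} {y : M} (hy : y ∈ m.chart.source)
    (hs : SmoothSectionAt E F s y) :
    m.loc (transportAt nabla X A s) (m.chart y) =
      fderiv ℝ (m.loc s) (m.chart y) (m.field (m.chart y)) +
        m.coeff.1 (m.chart y) (m.loc s (m.chart y)) := by
  have hb := m.source_subset' hy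
  rw [m.loc_chart _ hy, apply_transportAt _ hb hs, m.coeff_eq y hy, m.loc_chart s hy,
    m.field_eq y hy]
  congr 1
  exact m.mvfderiv_apply hy
    ((((trivializationAt F V x₀).contMDiffAt_section_iff hb).1 hs).mdifferentiableAt (by simp)) _

/-- The eigenvalue equation for `∇_X + A` in coordinates. -/
theorem transportAt_eq_smul_iff {s : Π x : M, V x} {y : M} (hy : y ∈ m.chart.source)
    (hs : SmoothSectionAt E F s y) (lam : ℂ) :
    transportAt nabla X A s y = lam • s y ↔
      fderiv ℝ (m.loc s) (m.chart y) (m.field (m.chart y)) =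
        m.coeff.coefficient lam (m.chart y) (m.loc s (m.chart y)) := by
  have hb := m.source_subset' hy
  have h1 := m.loc_transportAt hy hs
  rw [m.loc_chart _ hy] at h1
  rw [SmoothEnd.coefficient_apply, eq_sub_iff_add_eq, ← h1, m.loc_chart s hy]
  have h2 := ((trivializationAt F V x₀).linear ℂ hb).2 lam (s y)
  refine ⟨fun h ↦ ?_, fun h ↦ ?_⟩
  · rw [h]
    exact h2
  · rw [← constSection_apply (trivializationAt F V x₀) hb (transportAt nabla X A s y), h]
    refine Eq.trans ?_ (constSection_apply (trivializationAt F V x₀) hb (lam • s y))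
    exact congrArg (fun f ↦ constSection (trivializationAt F V x₀) f y) h2.symm

theorem hasDerivWithinAt_chart {γ : ℝ → M} {J : Set ℝ} {t : ℝ} (ht : γ t ∈ m.chart.source)
    (hγ : HasMFDerivWithinAt 𝓘(ℝ, ℝ) 𝓘(ℝ, E) γ J t ((1 : ℝ →L[ℝ] ℝ).smulRight (X (γ t)))) :
    HasDerivWithinAt (fun s ↦ m.chart (γ s)) (m.field (m.chart (γ t))) J t := by
  rw [m.field_eq _ ht]
  exact m.toCenteredChart.hasDerivWithinAt hγ ht

theorem hasMFDerivWithinAt_symm {δ : ℝ → E} {J : Set ℝ} {t : ℝ} (ht : δ t ∈ m.chart.target)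
    (hδ : HasDerivWithinAt δ (m.field (δ t)) J t) :
    HasMFDerivWithinAt 𝓘(ℝ, ℝ) 𝓘(ℝ, E) (fun s ↦ m.chart.symm (δ s)) J t
      ((1 : ℝ →L[ℝ] ℝ).smulRight (X (m.chart.symm (δ t)))) := by
  refine m.toCenteredChart.hasMFDerivWithinAt_symm hδ ht ?_
  rw [← m.field_eq _ (m.chart.map_target ht), m.chart.right_inv ht]

/-- Along an integral curve of `X`, solutions of the eigenvalue equation satisfy a linear ordinary
differential equation. -/
theorem hasDerivWithinAt_loc {γ : ℝ → M} {J : Set ℝ} {t : ℝ} (ht : γ t ∈ m.chart.source)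
    (hγ : HasMFDerivWithinAt 𝓘(ℝ, ℝ) 𝓘(ℝ, E) γ J t ((1 : ℝ →L[ℝ] ℝ).smulRight (X (γ t))))
    {s : Π x : M, V x} (hs : SmoothSectionAt E F s (γ t)) {lam : ℂ}
    (h : transportAt nabla X A s (γ t) = lam • s (γ t)) :
    HasDerivWithinAt (fun t ↦ m.loc s (m.chart (γ t)))
      (m.coeff.coefficient lam (m.chart (γ t)) (m.loc s (m.chart (γ t)))) J t := by
  rw [← (m.transportAt_eq_smul_iff ht hs lam).1 h]
  exact ((m.contDiffAt_loc ht hs).differentiableAt (by simp)).hasFDerivAt.comp_hasDerivWithinAt t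
    (m.hasDerivWithinAt_chart ht hγ)

end LocalModel

end LocalModel

/-- Used for connectedness arguments along curves: the whole segment between `x` and a nearby `y`
then lies in one chart, where uniqueness for ordinary differential equations applies. -/
theorem eventually_uIcc_subset {a b x : ℝ} {s : Set ℝ} (hx : x ∈ Icc a b) (hs : s ∈ 𝓝[Icc a b] x) :
    ∀ᶠ y in 𝓝[Icc a b] x, uIcc x y ⊆ s ∩ Icc a b := by
  obtain ⟨ε, hε, h⟩ := Metric.mem_nhdsWithin_iff.1 hs
  filter_upwards [inter_mem_nhdsWithin _ (Metric.ball_mem_nhds x hε)] with y hy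
  have h1 : uIcc x y ⊆ Metric.ball x ε := by
    rw [Real.ball_eq_Ioo] at hy ⊢
    exact ordConnected_Ioo.uIcc_subset ⟨by linarith, by linarith⟩ hy.2
  have h2 : uIcc x y ⊆ Icc a b := ordConnected_Icc.uIcc_subset hx hy.1
  exact fun z hz ↦ ⟨h ⟨h1 hz, h2 hz⟩, h2 hz⟩

/-! ### Uniqueness along integral curves -/

section Eigensections

set_option linter.unusedSectionVars false

variable {E : Type*} [NormedAddCommGroup E] [NormedSpace ℝ E] [FiniteDimensional ℝ E]
  {M : Type*} [TopologicalSpace M] [T2Space M] [ChartedSpace E M] [IsManifold 𝓘(ℝ, E) ∞ M]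
  {F : Type*} [NormedAddCommGroup F] [NormedSpace ℂ F] [FiniteDimensional ℂ F]
  {V : M → Type*} [TopologicalSpace (TotalSpace F V)]
  [∀ x, AddCommGroup (V x)] [∀ x, Module ℂ (V x)] [∀ x, TopologicalSpace (V x)]
  [∀ x, IsTopologicalAddGroup (V x)] [∀ x, ContinuousSMul ℝ (V x)]
  [FiberBundle F V] [VectorBundle ℂ F V] [VectorBundle ℝ F V]
  [ContMDiffVectorBundle ∞ F V 𝓘(ℝ, E)]
  {nabla : ComplexConnection E F V} {X : Π x : M, TangentSpace 𝓘(ℝ, E) x}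
  {A : SmoothEndomorphismField E F V}

/-- Integral curves of a smooth vector field on a compact interval are determined by one value. -/
theorem eqOn_Icc_of_isMIntegralCurveOn (nabla : ComplexConnection E F V)
    (hX : ContMDiff 𝓘(ℝ, E) 𝓘(ℝ, E).tangent ∞ (fun x ↦ (⟨x, X x⟩ : TangentBundle 𝓘(ℝ, E) M)))
    (A : SmoothEndomorphismField E F V) {γ η : ℝ → M} {a b t₀ : ℝ} (ht₀ : t₀ ∈ Icc a b)
    (hγ : IsMIntegralCurveOn (I := 𝓘(ℝ, E)) γ X (Icc a b))
    (hη : IsMIntegralCurveOn (I := 𝓘(ℝ, E)) η X (Icc a b)) (h : γ t₀ = η t₀) :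
    EqOn γ η (Icc a b) := by
  intro t ht
  -- Coincidence of the curves is an open condition by uniqueness in a chart, and so is its failure
  -- by Hausdorff separation; the interval is connected.
  refine isPreconnected_Icc.induction₂' (fun x y ↦ γ x = η x → γ y = η y) (fun x hx ↦ ?_)
    (fun _ _ _ _ _ _ h1 h2 h3 ↦ h2 (h1 h3)) ht₀ ht h
  by_cases hxe : γ x = η x
  · obtain ⟨m⟩ := nonempty_localModel nabla hX A (γ x)
    have h1 : γ ⁻¹' m.chart.source ∩ η ⁻¹' m.chart.source ∈ 𝓝[Icc a b] x :=
      inter_mem ((hγ x hx).1 (m.chart.open_source.mem_nhds m.mem_source))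
        ((hη x hx).1 (m.chart.open_source.mem_nhds (hxe ▸ m.mem_source)))
    filter_upwards [eventually_uIcc_subset hx h1] with y hy
    refine ⟨fun _ ↦ ?_, fun _ ↦ hxe⟩
    have h2 := eqOn_Icc_of_hasDerivWithinAt m.contDiff_field (f := fun t ↦ m.chart (γ t))
      (g := fun t ↦ m.chart (η t)) (left_mem_uIcc : x ∈ uIcc x y)
      (fun t ht ↦ m.hasDerivWithinAt_chart (hy ht).1.1
        ((hγ t (hy ht).2).mono fun r hr ↦ (hy hr).2))
      (fun t ht ↦ m.hasDerivWithinAt_chart (hy ht).1.2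
        ((hη t (hy ht).2).mono fun r hr ↦ (hy hr).2)) (congrArg m.chart hxe)
      (right_mem_uIcc : y ∈ uIcc x y)
    exact m.chart.injOn (hy right_mem_uIcc).1.1 (hy right_mem_uIcc).1.2 h2
  · obtain ⟨u, v, hu, hv, hxu, hxv, huv⟩ := t2_separation hxe
    filter_upwards [(hγ x hx).1 (hu.mem_nhds hxu), (hη x hx).1 (hv.mem_nhds hxv)] with y hy1 hy2
    exact ⟨fun h ↦ absurd h hxe, fun h ↦ (disjoint_left.1 huv hy1 (by rw [h]; exact hy2)).elim⟩

variable (nabla X A) in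
/-- `s` is a smooth solution of `(∇_X + A) s = lam s` on `W`. -/
def IsEigensectionOn (lam : ℂ) (s : Π x : M, V x) (W : Set M) : Prop :=
  ∀ y ∈ W, SmoothSectionAt E F s y ∧ transportAt nabla X A s y = lam • s y

namespace IsEigensectionOn

variable {lam : ℂ} {s t : Π x : M, V x} {W W' : Set M}

theorem mono (h : IsEigensectionOn nabla X A lam s W) (hW : W' ⊆ W) :
    IsEigensectionOn nabla X A lam s W' := fun y hy ↦ h y (hW hy)

theorem congr (h : IsEigensectionOn nabla X A lam s W) (hW : IsOpen W) (hst : ∀ x ∈ W, t x = s x) :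
    IsEigensectionOn nabla X A lam t W := fun y hy ↦ by
  have h1 : ∀ᶠ x in 𝓝 y, t x = s x := by
    filter_upwards [hW.mem_nhds hy] with x hx using hst x hx
  refine ⟨(h y hy).1.congr h1, ?_⟩
  rw [transportAt_congr (h y hy).1 h1, (h y hy).2, h1.self_of_nhds]

theorem sub (hs : IsEigensectionOn nabla X A lam s W) (ht : IsEigensectionOn nabla X A lam t W) :
    IsEigensectionOn nabla X A lam (s - t) W := fun y hy ↦ by
  have h1 : s - t = s + (-1 : ℂ) • t := by rw [neg_one_smul, sub_eq_add_neg]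
  have h2 := (ht y hy).1.const_smul (-1)
  rw [h1]
  refine ⟨(hs y hy).1.add h2, ?_⟩
  rw [transportAt_add (hs y hy).1 h2, transportAt_smul _ (ht y hy).1, (hs y hy).2, (ht y hy).2,
    Pi.add_apply, Pi.smul_apply, smul_add, smul_comm]

/-- An eigensection vanishes along an integral curve if it vanishes at one of its points. -/
theorem eq_zero_of_isMIntegralCurveOn (hs : IsEigensectionOn nabla X A lam s W)
    (hX : ContMDiff 𝓘(ℝ, E) 𝓘(ℝ, E).tangent ∞ (fun x ↦ (⟨x, X x⟩ : TangentBundle 𝓘(ℝ, E) M)))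
    {γ : ℝ → M} {a b t₀ t₁ : ℝ} (ht₀ : t₀ ∈ Icc a b) (ht₁ : t₁ ∈ Icc a b)
    (hγ : IsMIntegralCurveOn (I := 𝓘(ℝ, E)) γ X (Icc a b)) (hW : ∀ t ∈ Icc a b, γ t ∈ W)
    (h : s (γ t₀) = 0) : s (γ t₁) = 0 := by
  -- In a chart the section solves a linear equation along the curve. Comparison with the zero
  -- solution shows that vanishing spreads in both directions between nearby parameters.
  refine isPreconnected_Icc.induction₂' (fun x y ↦ s (γ x) = 0 → s (γ y) = 0) (fun x hx ↦ ?_)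
    (fun _ _ _ _ _ _ h1 h2 h3 ↦ h2 (h1 h3)) ht₀ ht₁ h
  obtain ⟨m⟩ := nonempty_localModel nabla hX A (γ x)
  have h1 : γ ⁻¹' m.chart.source ∈ 𝓝[Icc a b] x :=
    (hγ x hx).1 (m.chart.open_source.mem_nhds m.mem_source)
  filter_upwards [eventually_uIcc_subset hx h1] with y hy
  let a' := m.coeff.coefficient lam
  have ha' : ContDiff ℝ ∞ a' := SmoothEnd.contDiff_coefficient _ _
  let Y : E × F → E × F := fun z ↦ (m.field z.1, a' z.1 z.2)
  have hY : ContDiff ℝ ∞ Y :=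
    (m.contDiff_field.comp contDiff_fst).prodMk ((ha'.comp contDiff_fst).clm_apply contDiff_snd)
  have key : ∀ r₀ ∈ uIcc x y, ∀ r₁ ∈ uIcc x y, s (γ r₀) = 0 → s (γ r₁) = 0 := by
    intro r₀ hr₀ r₁ hr₁ h0
    have hd : ∀ t ∈ uIcc x y, HasMFDerivWithinAt 𝓘(ℝ, ℝ) 𝓘(ℝ, E) γ (uIcc x y) t
        ((1 : ℝ →L[ℝ] ℝ).smulRight (X (γ t))) := fun t ht ↦
      (hγ t (hy ht).2).mono fun r hr ↦ (hy hr).2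
    have h2 := eqOn_Icc_of_hasDerivWithinAt hY
      (f := fun t ↦ (m.chart (γ t), m.loc s (m.chart (γ t))))
      (g := fun t ↦ (m.chart (γ t), (0 : F))) hr₀
      (fun t ht ↦ (m.hasDerivWithinAt_chart (hy ht).1 (hd t ht)).prodMk
        (m.hasDerivWithinAt_loc (hy ht).1 (hd t ht) (hs _ (hW t (hy ht).2)).1
          (hs _ (hW t (hy ht).2)).2))
      (fun t ht ↦ ((m.hasDerivWithinAt_chart (hy ht).1 (hd t ht)).prodMk
        (hasDerivWithinAt_const _ _ _)).congr_deriv (by simp [Y]))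
      (by simp [(m.loc_chart_eq_zero_iff s (hy hr₀).1).2 h0]) hr₁
    exact (m.loc_chart_eq_zero_iff s (hy hr₁).1).1 (congrArg Prod.snd h2)
  exact ⟨key x left_mem_uIcc y right_mem_uIcc, key y right_mem_uIcc x left_mem_uIcc⟩

end IsEigensectionOn

end Eigensections

/-! ### Extending a solution along the local flow -/

section TransportExtension

variable {E : Type*} [NormedAddCommGroup E] [NormedSpace ℝ E] [FiniteDimensional ℝ E]
  {F : Type*} [NormedAddCommGroup F] [NormedSpace ℝ F] [FiniteDimensional ℝ F]
  {X : E → E} {a : E → F →L[ℝ] F} {x₀ : E}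

namespace LocalTransport

/-- A neighbourhood of `x₀` on which the local flow is defined for all times in `[-3τ, 3τ]` and
stays in a given neighbourhood `N`. -/
theorem exists_forall_mem (T : LocalTransport X a x₀) (hX : ContDiff ℝ ∞ X) (ha : ContDiff ℝ ∞ a)
    {N : Set E} (hN : N ∈ 𝓝 x₀) {τ₀ : ℝ} (hτ₀ : 0 < τ₀) :
    ∃ τ ρ, 0 < τ ∧ τ < τ₀ ∧ 0 < ρ ∧ 3 * τ < T.ε ∧
      (∀ z ∈ Metric.ball x₀ ρ, z ∈ Metric.ball x₀ T.r ∧ ∀ t ∈ Icc (-(3 * τ)) (3 * τ),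
        T.Φ t z ∈ N ∩ Metric.ball x₀ T.r) ∧
      ∀ z ∈ Metric.ball x₀ ρ, ∀ s ∈ Icc (-(3 * τ)) (3 * τ), ∀ t ∈ Icc (-(3 * τ)) (3 * τ),
        s + t ∈ Icc (-(3 * τ)) (3 * τ) → T.Φ s (T.Φ t z) = T.Φ (s + t) z ∧
          ∀ y, T.P s (T.Φ t z) (T.P t z y) = T.P (s + t) z y := by
  have hx₀ : x₀ ∈ Metric.ball x₀ T.r := Metric.mem_ball_self T.r_pos
  have h1 : ContinuousAt (Function.uncurry T.Φ) (0, x₀) :=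
    T.continuousOn_Φ.continuousAt ((isOpen_Ioo.prod Metric.isOpen_ball).mem_nhds
      ⟨T.zero_mem, hx₀⟩)
  have h2 : N ∩ Metric.ball x₀ T.r ∈ 𝓝 (Function.uncurry T.Φ (0, x₀)) := by
    change _ ∈ 𝓝 (T.Φ 0 x₀)
    rw [T.Φ_zero x₀ hx₀]
    exact inter_mem hN (Metric.ball_mem_nhds x₀ T.r_pos)
  obtain ⟨δ, hδ, h3⟩ := Metric.mem_nhds_iff.1 (h1 h2)
  let τ := min (min (δ / 4) (T.ε / 4)) (τ₀ / 2)
  have hτ : 0 < τ := lt_min (lt_min (by linarith) (by linarith [T.ε_pos])) (by linarith)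
  have hτ1 : τ ≤ δ / 4 := (min_le_left _ _).trans (min_le_left _ _)
  have hτ2 : τ ≤ T.ε / 4 := (min_le_left _ _).trans (min_le_right _ _)
  have hτ3 : τ ≤ τ₀ / 2 := min_le_right _ _
  have hε : ∀ t ∈ Icc (-(3 * τ)) (3 * τ), t ∈ Ioo (-T.ε) T.ε := fun t ht ↦
    ⟨by linarith [ht.1, T.ε_pos], by linarith [ht.2, T.ε_pos]⟩
  have hmem : ∀ z ∈ Metric.ball x₀ (min δ T.r), z ∈ Metric.ball x₀ T.r ∧
      ∀ t ∈ Icc (-(3 * τ)) (3 * τ), T.Φ t z ∈ N ∩ Metric.ball x₀ T.r := by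
    intro z hz
    refine ⟨Metric.ball_subset_ball (min_le_right _ _) hz, fun t ht ↦ ?_⟩
    refine h3 (a := (t, z)) ?_
    rw [Metric.mem_ball, Prod.dist_eq, max_lt_iff]
    refine ⟨?_, (Metric.mem_ball.1 hz).trans_le (min_le_left _ _)⟩
    rw [Real.dist_eq, sub_zero, abs_lt]
    exact ⟨by linarith [ht.1], by linarith [ht.2]⟩
  refine ⟨τ, min δ T.r, hτ, by linarith, lt_min hδ T.r_pos, by linarith [T.ε_pos], hmem,
    fun z hz s hs t ht hst ↦ ?_⟩
  have h4 := T.add_apply hX ha (hmem z hz).1 (hε s hs) (hε t ht) (hε _ hst)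
    ((hmem z hz).2 t ht).2
  exact ⟨h4.1.symm, fun y ↦ (h4.2 y).symm⟩

/-- Extension of a solution `v` of the transport equation `Dv(X) = a v` on an open set `W` to a
neighbourhood of a point `x₀` whose past lies in `W`. -/
theorem exists_extension (T : LocalTransport X a x₀) (hX : ContDiff ℝ ∞ X) (ha : ContDiff ℝ ∞ a)
    {N W : Set E} (hN : N ∈ 𝓝 x₀) (hW : IsOpen W)
    (hback : ∀ (c : ℝ → E) (α β : ℝ), α ≤ β → (∀ t ∈ Icc α β, c t ∈ N ∧
      HasDerivWithinAt c (X (c t)) (Icc α β) t) → c β ∈ W → c α ∈ W)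
    {v : E → F} (hv : ∀ y ∈ W, ContDiffAt ℝ ∞ v y ∧ fderiv ℝ v y (X y) = a y (v y))
    {τ₀ : ℝ} (hτ₀ : 0 < τ₀) (hpast : ∀ τ ∈ Ioo 0 τ₀, T.Φ (-τ) x₀ ∈ W) :
    ∃ (O : Set E) (u : E → F), IsOpen O ∧ x₀ ∈ O ∧ O ⊆ N ∧
      (∀ y ∈ O, ContDiffAt ℝ ∞ u y ∧ fderiv ℝ u y (X y) = a y (u y)) ∧
      (∀ y ∈ O ∩ W, u y = v y) ∧
      ∀ y ∈ O, ∃ (c : ℝ → E) (τ : ℝ), 0 < τ ∧ c 0 = y ∧ c (-τ) ∈ W ∧ (∀ t ∈ Ioc (-τ) 0, c t ∈ O) ∧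
        ∀ t ∈ Icc (-τ) 0, c t ∈ N ∧ HasDerivWithinAt c (X (c t)) (Icc (-τ) 0) t := by
  obtain ⟨τ, ρ₀, hτ, hττ₀, hρ₀, hτε, hmem, hadd⟩ := T.exists_forall_mem hX ha hN hτ₀
  have hε : ∀ t ∈ Icc (-(3 * τ)) (3 * τ), t ∈ Ioo (-T.ε) T.ε := fun t ht ↦
    ⟨by linarith [ht.1], by linarith [ht.2]⟩
  have hx₀ : x₀ ∈ Metric.ball x₀ T.r := Metric.mem_ball_self T.r_pos
  have hcont : ∀ t ∈ Icc (-(3 * τ)) (3 * τ), ContinuousOn (T.Φ t) (Metric.ball x₀ T.r) :=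
    fun t ht ↦ (T.contDiffOn_Φ t (hε t ht)).continuousOn
  have hIτ : -τ ∈ Icc (-(3 * τ)) (3 * τ) := ⟨by linarith, by linarith⟩
  obtain ⟨ρ₁, hρ₁, hball⟩ := Metric.mem_nhds_iff.1
    (((hcont _ hIτ).continuousAt (Metric.ball_mem_nhds x₀ T.r_pos)).preimage_mem_nhds
      (hW.mem_nhds (hpast τ ⟨hτ, hττ₀⟩)))
  let B := Metric.ball x₀ (min ρ₀ ρ₁)
  have hB0 : ∀ z ∈ B, z ∈ Metric.ball x₀ ρ₀ := fun z hz ↦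
    Metric.ball_subset_ball (min_le_left _ _) hz
  have hBW : ∀ z ∈ B, T.Φ (-τ) z ∈ W := fun z hz ↦
    hball (Metric.ball_subset_ball (min_le_right _ _) hz)
  have hBr : ∀ z ∈ B, z ∈ Metric.ball x₀ T.r := fun z hz ↦ (hmem z (hB0 z hz)).1
  have hΦ : ∀ z ∈ B, ∀ t ∈ Icc (-(3 * τ)) (3 * τ), T.Φ t z ∈ N ∩ Metric.ball x₀ T.r :=
    fun z hz ↦ (hmem z (hB0 z hz)).2
  have hinv : ∀ z ∈ B, ∀ α β : ℝ, -(3 * τ) ≤ α → α ≤ β → β ≤ 3 * τ → T.Φ β z ∈ W →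
      T.Φ α z ∈ W := by
    intro z hz α β h1 h2 h3 h4
    refine hback (fun t ↦ T.Φ t z) α β h2 (fun t ht ↦ ?_) h4
    have ht' : t ∈ Icc (-(3 * τ)) (3 * τ) := ⟨h1.trans ht.1, ht.2.trans h3⟩
    exact ⟨(hΦ z hz t ht').1, (T.hasDerivAt_Φ z (hBr z hz) t (hε t ht')).hasDerivWithinAt⟩
  have hpastW : ∀ z ∈ B, ∀ t ∈ Icc (-(3 * τ)) (-τ), T.Φ t z ∈ W := fun z hz t ht ↦
    hinv z hz t (-τ) ht.1 ht.2 (by linarith) (hBW z hz)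
  -- `O` consists of the backward trajectories of duration less than `τ` issuing from `B`, and `u y`
  -- transports the value of `v` from `Φ (-τ) y`, a point of `W`. Verifying the equation for `u` at
  -- `Φ (-σ) z` takes one more backward step of length at most `τ`, which explains the times up to
  -- `3 * τ`.
  let O : Set E := {y | ∃ z ∈ B, ∃ σ ∈ Ico 0 τ, y = T.Φ (-σ) z}
  let u : E → F := fun y ↦ T.P τ (T.Φ (-τ) y) (v (T.Φ (-τ) y))
  have hOu : ∀ z ∈ B, ∀ σ ∈ Icc 0 (2 * τ),
      u (T.Φ (-σ) z) = T.P τ (T.Φ (-τ - σ) z) (v (T.Φ (-τ - σ) z)) := by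
    intro z hz σ hσ
    have h := (hadd z (hB0 z hz) (-τ) hIτ (-σ) ⟨by linarith [hσ.2], by linarith [hσ.1]⟩
      ⟨by linarith [hσ.2], by linarith [hσ.1]⟩).1
    simp only [u, h, sub_eq_add_neg]
  -- Where `O` meets `W`, backward invariance keeps the connecting trajectory in `W`. There `v` is
  -- itself propagated by the transport, so it agrees with `u`.
  have hback' : ∀ z ∈ B, ∀ σ ∈ Icc 0 (2 * τ), T.Φ (-σ) z ∈ W → u (T.Φ (-σ) z) = v (T.Φ (-σ) z) := by
    intro z hz σ hσ hσW
    rw [hOu z hz σ hσ]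
    have hI1 : -τ - σ ∈ Icc (-(3 * τ)) (3 * τ) := ⟨by linarith [hσ.2], by linarith [hσ.1]⟩
    have hI2 : τ ∈ Icc (-(3 * τ)) (3 * τ) := ⟨by linarith, by linarith⟩
    have hs : ∀ s ∈ Icc 0 τ, T.Φ s (T.Φ (-τ - σ) z) = T.Φ (s + (-τ - σ)) z := fun s hs ↦
      (hadd z (hB0 z hz) s ⟨by linarith [hs.1], by linarith [hs.2]⟩ _ hI1
        ⟨by linarith [hs.1, hσ.2], by linarith [hs.2, hσ.1]⟩).1
    have h := T.apply_eq_of_fderiv_eq hX ha (hΦ z hz _ hI1).2 (u := v) (hε τ hI2) (fun s hs' ↦ ?_)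
    · rw [← h, hs τ ⟨hτ.le, le_rfl⟩]
      congr 2
      ring
    · rw [uIcc_of_le hτ.le] at hs'
      rw [hs s hs']
      have h1 := hv _ (hinv z hz (s + (-τ - σ)) (-σ) (by linarith [hs'.1, hσ.2])
        (by linarith [hs'.2]) (by linarith [hσ.1]) hσW)
      exact ⟨h1.1.differentiableAt (by simp), h1.2⟩
  refine ⟨O, u, ?_, ⟨x₀, Metric.mem_ball_self (lt_min hρ₀ hρ₁), 0, ⟨le_rfl, hτ⟩, ?_⟩, ?_, ?_, ?_, ?_⟩
  · rw [isOpen_iff_mem_nhds]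
    rintro y ⟨z, hz, σ, hσ, rfl⟩
    have hI1 : -σ ∈ Icc (-(3 * τ)) (3 * τ) := ⟨by linarith [hσ.2], by linarith [hσ.1]⟩
    have hI2 : σ ∈ Icc (-(3 * τ)) (3 * τ) := ⟨by linarith [hσ.1], by linarith [hσ.2]⟩
    have h0 : T.Φ σ (T.Φ (-σ) z) = z := by
      rw [(hadd z (hB0 z hz) σ hI2 (-σ) hI1 ⟨by linarith, by linarith⟩).1, add_neg_cancel,
        T.Φ_zero z (hBr z hz)]
    have h1 := (hcont σ hI2).continuousAt (Metric.isOpen_ball.mem_nhds (hΦ z hz _ hI1).2)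
    filter_upwards [h1.preimage_mem_nhds (Metric.isOpen_ball.mem_nhds (h0.symm ▸ hz)),
      Metric.isOpen_ball.mem_nhds (hΦ z hz _ hI1).2] with y hy1 hy2
    refine ⟨T.Φ σ y, hy1, σ, hσ, ?_⟩
    have h2 := (T.add_apply hX ha hy2 (hε _ hI1) (hε _ hI2)
      (by rw [neg_add_cancel]; exact T.zero_mem) (hBr _ hy1)).1
    rw [← h2, neg_add_cancel, T.Φ_zero y hy2]
  · rw [neg_zero, T.Φ_zero x₀ hx₀]
  · rintro y ⟨z, hz, σ, hσ, rfl⟩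
    exact (hΦ z hz _ ⟨by linarith [hσ.2], by linarith [hσ.1]⟩).1
  · rintro y ⟨z, hz, σ, hσ, rfl⟩
    have hI1 : -σ ∈ Icc (-(3 * τ)) (3 * τ) := ⟨by linarith [hσ.2], by linarith [hσ.1]⟩
    have hI2 : τ ∈ Icc (-(3 * τ)) (3 * τ) := ⟨by linarith, by linarith⟩
    have hI3 : -τ - σ ∈ Icc (-(3 * τ)) (3 * τ) := ⟨by linarith [hσ.2], by linarith [hσ.1]⟩
    have hyr := (hΦ z hz _ hI1).2
    have hΦτ : T.Φ (-τ) (T.Φ (-σ) z) = T.Φ (-τ - σ) z := by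
      rw [sub_eq_add_neg]
      exact (hadd z (hB0 z hz) (-τ) hIτ (-σ) hI1 hI3).1
    have hsm : ContDiffAt ℝ ∞ u (T.Φ (-σ) z) := by
      have h1 : ContDiffAt ℝ ∞ (T.Φ (-τ)) (T.Φ (-σ) z) :=
        (T.contDiffOn_Φ _ (hε _ hIτ)).contDiffAt (Metric.isOpen_ball.mem_nhds hyr)
      have h2 : ContDiffAt ℝ ∞ (T.P τ) (T.Φ (-τ) (T.Φ (-σ) z)) := by
        rw [hΦτ]
        exact (T.contDiffOn_P _ (hε _ hI2)).contDiffAt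
          (Metric.isOpen_ball.mem_nhds (hΦ z hz _ hI3).2)
      have h3 : ContDiffAt ℝ ∞ v (T.Φ (-τ) (T.Φ (-σ) z)) := by
        rw [hΦτ]
        exact (hv _ (hpastW z hz _ ⟨hI3.1, by linarith [hσ.1]⟩)).1
      exact (h2.comp _ h1).clm_apply (h3.comp _ h1)
    refine ⟨hsm, T.fderiv_eq_of_apply_eq hyr (hsm.differentiableAt (by simp)) hτ fun h hh ↦ ?_⟩
    have hI4 : -h ∈ Icc (-(3 * τ)) (3 * τ) := ⟨by linarith [hh.2], by linarith [hh.1]⟩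
    have h1 : T.Φ (-h) (T.Φ (-σ) z) = T.Φ (-(h + σ)) z := by
      rw [(hadd z (hB0 z hz) (-h) hI4 (-σ) hI1 ⟨by linarith [hσ.2, hh.2],
        by linarith [hσ.1, hh.1]⟩).1, neg_add]
    rw [h1, hOu z hz _ ⟨by linarith [hσ.1, hh.1], by linarith [hσ.2, hh.2]⟩,
      hOu z hz σ ⟨hσ.1, by linarith [hσ.2]⟩]
    set w := T.Φ (-τ - σ) z with hw
    have hwr : w ∈ Metric.ball x₀ T.r := (hΦ z hz _ hI3).2
    have hwh : ∀ s ∈ Icc (-h) τ, T.Φ s w = T.Φ (s + (-τ - σ)) z := fun s hs ↦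
      (hadd z (hB0 z hz) s ⟨by linarith [hs.1, hh.2], by linarith [hs.2]⟩ _ hI3
        ⟨by linarith [hs.1, hσ.2, hh.2], by linarith [hs.2, hσ.1]⟩).1
    have hwh' := hwh (-h) ⟨le_rfl, by linarith [hh.1]⟩
    have hwt' := hwh τ ⟨by linarith [hh.1], le_rfl⟩
    have h2 : v (T.Φ (-h) w) = T.P (-h) w (v w) := by
      refine T.apply_eq_of_fderiv_eq hX ha hwr (hε _ hI4) fun s hs ↦ ?_
      rw [uIcc_of_ge (by linarith [hh.1])] at hs
      rw [hwh s ⟨hs.1, by linarith [hs.2]⟩]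
      have h3 := hv _ (hpastW z hz (s + (-τ - σ)) ⟨by linarith [hs.1, hh.2, hσ.2],
        by linarith [hs.2, hσ.1]⟩)
      exact ⟨h3.1.differentiableAt (by simp), h3.2⟩
    have h4 : -τ - (h + σ) = -h + (-τ - σ) := by ring
    have h5 : T.Φ τ w = T.Φ (-σ) z := by
      rw [hwt']
      congr 1
      ring
    have hI6 : τ + -h ∈ Ioo (-T.ε) T.ε := hε _ ⟨by linarith [hh.2], by linarith [hh.1]⟩
    have h6 := (T.add_apply hX ha hwr (hε _ hI2) (hε _ hI4) hI6 (by
      rw [hwh']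
      exact (hΦ z hz _ ⟨by linarith [hh.2, hσ.2], by linarith [hh.1, hσ.1]⟩).2)).2 (v w)
    have h7 := (T.add_apply hX ha hwr (hε _ hI4) (hε _ hI2) (by rw [add_comm]; exact hI6)
      (by rw [h5]; exact hyr)).2 (v w)
    rw [h4, ← hwh', h2, ← h6, ← h5, ← h7, add_comm]
  · rintro y ⟨⟨z, hz, σ, hσ, rfl⟩, hyW⟩
    exact hback' z hz σ ⟨hσ.1, by linarith [hσ.2]⟩ hyW
  -- Going backwards from `y`, the trajectory stays in `O` until it reaches `Φ (-τ) z ∈ W` after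
  -- time `τ - σ`. The union of `W` with `O` will be backward invariant for this reason.
  · rintro y ⟨z, hz, σ, hσ, rfl⟩
    have hI : ∀ t ∈ Icc (-(τ - σ)) 0, t + -σ ∈ Icc (-(3 * τ)) (3 * τ) := fun t ht ↦
      ⟨by linarith [ht.1], by linarith [ht.2, hσ.1]⟩
    refine ⟨fun t ↦ T.Φ (t + -σ) z, τ - σ, by linarith [hσ.2], by simp, ?_, fun t ht ↦ ?_,
      fun t ht ↦ ?_⟩
    · exact hpastW z hz _ ⟨by linarith, by linarith⟩
    · exact ⟨z, hz, σ - t, ⟨by linarith [ht.2, hσ.1], by linarith [ht.1]⟩, by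
        change T.Φ (t + -σ) z = T.Φ (-(σ - t)) z
        rw [neg_sub, sub_eq_add_neg]⟩
    · exact ⟨(hΦ z hz _ (hI t ht)).1,
        ((T.hasDerivAt_Φ z (hBr z hz) _ (hε _ (hI t ht))).comp_add_const t (-σ)).hasDerivWithinAt⟩

end LocalTransport

end TransportExtension

/-! ### From the source to the star-shaped neighbourhood -/

section Globalization

set_option linter.unusedSectionVars false

variable {E : Type*} [NormedAddCommGroup E] [NormedSpace ℝ E] [FiniteDimensional ℝ E]
  {M : Type*} [TopologicalSpace M] [T2Space M] [ChartedSpace E M] [IsManifold 𝓘(ℝ, E) ∞ M]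
  {F : Type*} [NormedAddCommGroup F] [NormedSpace ℂ F] [FiniteDimensional ℂ F]
  {V : M → Type*} [TopologicalSpace (TotalSpace F V)]
  [∀ x, AddCommGroup (V x)] [∀ x, Module ℂ (V x)] [∀ x, TopologicalSpace (V x)]
  [∀ x, IsTopologicalAddGroup (V x)] [∀ x, ContinuousSMul ℝ (V x)]
  [FiberBundle F V] [VectorBundle ℂ F V] [VectorBundle ℝ F V]
  [ContMDiffVectorBundle ∞ F V 𝓘(ℝ, E)]
  {nabla : ComplexConnection E F V} {X : Π x : M, TangentSpace 𝓘(ℝ, E) x}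
  {A : SmoothEndomorphismField E F V}

/-- Integral curves of `X` ending in `W` are contained in `W`. -/
def IsBackwardInvariant (X : Π x : M, TangentSpace 𝓘(ℝ, E) x) (W : Set M) : Prop :=
  ∀ (γ : ℝ → M) (a b : ℝ), a ≤ b → IsMIntegralCurveOn (I := 𝓘(ℝ, E)) γ X (Icc a b) → γ b ∈ W →
    γ a ∈ W

theorem IsBackwardInvariant.inter {W W' : Set M} (h : IsBackwardInvariant X W)
    (h' : IsBackwardInvariant X W') : IsBackwardInvariant X (W ∩ W') :=
  fun γ a b hab hγ hb ↦ ⟨h γ a b hab hγ hb.1, h' γ a b hab hγ hb.2⟩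

/-- An eigensection over a backward invariant set which vanishes near the source vanishes. -/
theorem IsEigensectionOn.eq_zero_of_eventually_eq_zero {p : M} {U : TopologicalSpace.Opens M}
    (hU : IsStarShapedAround X p U)
    (hX : ContMDiff 𝓘(ℝ, E) 𝓘(ℝ, E).tangent ∞ (fun x ↦ (⟨x, X x⟩ : TangentBundle 𝓘(ℝ, E) M)))
    {W : Set M} (hWU : W ⊆ U) (hW : IsBackwardInvariant X W) {lam : ℂ} {s : Π x : M, V x}
    (hs : IsEigensectionOn nabla X A lam s W) (h0 : ∀ᶠ x in 𝓝 p, s x = 0) {q : M} (hq : q ∈ W) :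
    s q = 0 := by
  obtain ⟨γ, rfl, hγ, -, hlim⟩ := hU.flow q (hWU hq)
  obtain ⟨T, hT, hT0⟩ := ((hlim.eventually h0).and (eventually_le_atBot 0)).exists
  have hγ' : ∀ t ≤ 0, IsMIntegralCurveOn (I := 𝓘(ℝ, E)) γ X (Icc t 0) := fun t _ ↦
    hγ.mono Icc_subset_Iic_self
  exact hs.eq_zero_of_isMIntegralCurveOn hX (left_mem_Icc.2 hT0) (right_mem_Icc.2 hT0) (hγ' T hT0)
    (fun t ht ↦ hW γ t 0 ht.2 (hγ' t ht.2) hq) hT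

/-- Extension of an eigensection on an open backward invariant set `W` to a neighbourhood of the
end point of an integral curve in `W`. -/
theorem IsEigensectionOn.exists_extension
    (hX : ContMDiff 𝓘(ℝ, E) 𝓘(ℝ, E).tangent ∞ (fun x ↦ (⟨x, X x⟩ : TangentBundle 𝓘(ℝ, E) M)))
    {W U : Set M} (hU : IsOpen U) (hWo : IsOpen W) (hW : IsBackwardInvariant X W) {lam : ℂ}
    {s : Π x : M, V x} (hs : IsEigensectionOn nabla X A lam s W) {γ : ℝ → M} {t₀ T : ℝ}
    (hT : T < t₀) (hγ : IsMIntegralCurveOn (I := 𝓘(ℝ, E)) γ X (Icc T t₀))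
    (hγW : ∀ t ∈ Ico T t₀, γ t ∈ W) (hγU : γ t₀ ∈ U) :
    ∃ (W' : Set M) (s' : Π x : M, V x), IsOpen W' ∧ W ⊆ W' ∧ W' ⊆ W ∪ U ∧ γ t₀ ∈ W' ∧
      IsBackwardInvariant X W' ∧ IsEigensectionOn nabla X A lam s' W' ∧ ∀ x ∈ W, s' x = s x := by
  classical
  obtain ⟨m⟩ := nonempty_localModel nabla hX A (γ t₀)
  have ha : ContDiff ℝ ∞ (m.coeff.coefficient lam) := SmoothEnd.contDiff_coefficient _ _
  obtain ⟨L⟩ := exists_localTransport m.contDiff_field ha 0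
  let N : Set E := m.chart.target ∩ m.chart.symm ⁻¹' U
  let WE : Set E := m.chart.target ∩ m.chart.symm ⁻¹' W
  have hsymm0 : m.chart.symm 0 = γ t₀ := by
    rw [← m.apply_self, m.chart.left_inv m.mem_source]
  have hN : N ∈ 𝓝 (0 : E) :=
    (m.chart.symm.isOpen_inter_preimage hU).mem_nhds
      ⟨m.toCenteredChart.zero_mem_target, by rw [mem_preimage, hsymm0]; exact hγU⟩
  have hWE : IsOpen WE := m.chart.symm.isOpen_inter_preimage hWo
  have hcurve : ∀ (c : ℝ → E) (α β : ℝ), (∀ t ∈ Icc α β, c t ∈ N ∧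
      HasDerivWithinAt c (m.field (c t)) (Icc α β) t) →
      IsMIntegralCurveOn (I := 𝓘(ℝ, E)) (fun t ↦ m.chart.symm (c t)) X (Icc α β) :=
    fun c α β hc t ht ↦ m.hasMFDerivWithinAt_symm (hc t ht).1.1 (hc t ht).2
  have hback : ∀ (c : ℝ → E) (α β : ℝ), α ≤ β → (∀ t ∈ Icc α β, c t ∈ N ∧
      HasDerivWithinAt c (m.field (c t)) (Icc α β) t) → c β ∈ WE → c α ∈ WE :=
    fun c α β hαβ hc hβ ↦ ⟨(hc α (left_mem_Icc.2 hαβ)).1.1,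
      hW _ α β hαβ (hcurve c α β hc) hβ.2⟩
  have hv : ∀ y ∈ WE, ContDiffAt ℝ ∞ (m.loc s) y ∧
      fderiv ℝ (m.loc s) y (m.field y) = m.coeff.coefficient lam y (m.loc s y) := by
    intro y hy
    obtain ⟨h1, h2⟩ := hs _ hy.2
    have hsrc := m.chart.map_target hy.1
    have h3 := m.contDiffAt_loc hsrc h1
    have h4 := (m.transportAt_eq_smul_iff hsrc h1 lam).1 h2
    rw [m.chart.right_inv hy.1] at h3 h4
    exact ⟨h3, h4⟩
  obtain ⟨τ₁, ρ, hτ₁, hτ₁T, hρ, hτε, hmem, -⟩ := L.exists_forall_mem m.contDiff_field ha hN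
    (sub_pos.2 hT)
  have h0ρ : (0 : E) ∈ Metric.ball (0 : E) ρ := Metric.mem_ball_self hρ
  have hΦ0 : L.Φ 0 0 = 0 := L.Φ_zero 0 (hmem 0 h0ρ).1
  -- By uniqueness the coordinate flow line through 0 is γ shifted by `t₀`, whose past lies in `W`;
  -- `τ₁ < t₀ - T` keeps it within the interval on which γ is given.
  have hpast : ∀ τ ∈ Ioo 0 τ₁, L.Φ (-τ) 0 ∈ WE := by
    intro τ hτ
    have h1 := hcurve (fun t ↦ L.Φ t 0) (-τ) 0 fun t ht ↦
      ⟨((hmem 0 h0ρ).2 t ⟨by linarith [ht.1, hτ.2], by linarith [ht.2]⟩).1,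
        (L.hasDerivAt_Φ 0 (hmem 0 h0ρ).1 t
          ⟨by linarith [ht.1, hτ.2], by linarith [ht.2]⟩).hasDerivWithinAt⟩
    have h2 : IsMIntegralCurveOn (I := 𝓘(ℝ, E)) (fun t ↦ γ (t + t₀)) X (Icc (-τ) 0) := by
      refine (hγ.comp_add t₀).mono fun t ht ↦ ?_
      exact ⟨by linarith [ht.1, hτ.2], by linarith [ht.2]⟩
    have h3 := eqOn_Icc_of_isMIntegralCurveOn nabla hX A (right_mem_Icc.2 (by linarith [hτ.1]))
      h1 h2 (by simp [hΦ0, hsymm0]) (left_mem_Icc.2 (by linarith [hτ.1]))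
    refine ⟨((hmem 0 h0ρ).2 (-τ) ⟨by linarith [hτ.2], by linarith [hτ.1]⟩).1.1, ?_⟩
    rw [mem_preimage]
    have h4 : m.chart.symm (L.Φ (-τ) 0) = γ (-τ + t₀) := h3
    rw [h4]
    exact hγW _ ⟨by linarith [hτ.2], by linarith [hτ.1]⟩
  obtain ⟨O, u, hO, h0O, hON, hu, huv, hOc⟩ :=
    L.exists_extension m.contDiff_field ha hN hWE hback hv hτ₁ hpast
  let OM : Set M := m.chart.source ∩ m.chart ⁻¹' O
  have hOM : IsOpen OM := m.chart.isOpen_inter_preimage hO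
  let s' : Π x : M, V x := fun x ↦ if x ∈ W then s x else m.sec u x
  have hs'W : ∀ x ∈ W, s' x = s x := fun x hx ↦ if_pos hx
  have hs'O : ∀ x ∈ OM, s' x = m.sec u x := by
    intro x hx
    by_cases hxW : x ∈ W
    · rw [hs'W x hxW, ← m.sec_loc s hx.1]
      have : u (m.chart x) = m.loc s (m.chart x) := by
        refine huv _ ⟨hx.2, m.chart.map_source hx.1, ?_⟩
        rw [mem_preimage, m.chart.left_inv hx.1]
        exact hxW
      simp only [LocalModel.sec, this]
    · exact if_neg hxW
  refine ⟨W ∪ OM, s', hWo.union hOM, subset_union_left, ?_, Or.inr ⟨m.mem_source, ?_⟩, ?_, ?_, hs'W⟩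
  · refine union_subset_union_right _ fun x hx ↦ ?_
    have h1 := (hON hx.2).2
    rwa [mem_preimage, m.chart.left_inv hx.1] at h1
  · rw [mem_preimage, m.apply_self]
    exact h0O
  · intro η a b hab hη hb
    rcases hb with hb | hb
    · exact Or.inl (hW η a b hab hη hb)
    obtain ⟨c, τ, hτ, hc0, hcτ, hcO, hc⟩ := hOc _ hb.2
    have h1 := hcurve c (-τ) 0 hc
    -- Backwards from `b`, η follows the curve supplied by the extension lemma. Either `a` is
    -- reached while that curve is still in `O`, or the curve has entered `W` at time `b - τ` and
    -- the invariance of `W` takes over.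
    have hshift : ∀ σ ∈ Icc 0 τ, a ≤ b - σ → η (b - σ) = m.chart.symm (c (-σ)) := by
      intro σ hσ haσ
      have h2 : IsMIntegralCurveOn (I := 𝓘(ℝ, E)) (fun t ↦ η (t + b)) X (Icc (-σ) 0) := by
        refine (hη.comp_add b).mono fun t ht ↦ ?_
        exact ⟨by linarith [ht.1], by linarith [ht.2]⟩
      have h3 := eqOn_Icc_of_isMIntegralCurveOn nabla hX A (right_mem_Icc.2 (by linarith [hσ.1]))
        h2 (h1.mono (Icc_subset_Icc_left (by linarith [hσ.2])))
        (by simp [hc0, m.chart.left_inv hb.1]) (left_mem_Icc.2 (by linarith [hσ.1]))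
      have h4 : η (-σ + b) = m.chart.symm (c (-σ)) := h3
      rw [← h4]
      congr 1
      ring
    rcases lt_or_ge (b - τ) a with hlt | hge
    · have hmemσ : b - a ∈ Icc 0 τ := ⟨by linarith, by linarith⟩
      have h2 := hshift (b - a) hmemσ (by linarith)
      rw [sub_sub_cancel] at h2
      have h3 : c (-(b - a)) ∈ O := hcO _ ⟨by linarith, by linarith⟩
      have h4 : c (-(b - a)) ∈ m.chart.target := (hON h3).1
      right
      rw [h2]
      refine ⟨m.chart.map_target h4, ?_⟩
      rw [mem_preimage, m.chart.right_inv h4]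
      exact h3
    · left
      refine hW η a (b - τ) hge (hη.mono (Icc_subset_Icc_right (by linarith))) ?_
      rw [hshift τ ⟨hτ.le, le_rfl⟩ hge]
      exact hcτ.2
  · have h1 := hs.congr hWo hs'W
    have h2 : IsEigensectionOn nabla X A lam (m.sec u) OM := by
      intro x hx
      have h3 := m.smoothSectionAt_sec hx.1 (hu _ hx.2).1
      refine ⟨h3, (m.transportAt_eq_smul_iff hx.1 h3 lam).2 ?_⟩
      have h4 : m.loc (m.sec u) =ᶠ[𝓝 (m.chart x)] u := by
        filter_upwards [m.chart.open_target.mem_nhds (m.chart.map_source hx.1)] with z hz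
        exact m.loc_sec u hz
      rw [h4.fderiv_eq, h4.self_of_nhds]
      exact (hu _ hx.2).2
    rintro x (hx | hx)
    · exact h1 x hx
    · exact h2.congr hOM hs'O x hx

end Globalization

section Globalization

set_option linter.unusedSectionVars false

variable {E : Type*} [NormedAddCommGroup E] [NormedSpace ℝ E] [FiniteDimensional ℝ E]
  {M : Type*} [TopologicalSpace M] [T2Space M] [ChartedSpace E M] [IsManifold 𝓘(ℝ, E) ∞ M]
  {F : Type*} [NormedAddCommGroup F] [NormedSpace ℂ F] [FiniteDimensional ℂ F]
  {V : M → Type*} [TopologicalSpace (TotalSpace F V)]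
  [∀ x, AddCommGroup (V x)] [∀ x, Module ℂ (V x)] [∀ x, TopologicalSpace (V x)]
  [∀ x, IsTopologicalAddGroup (V x)] [∀ x, ContinuousSMul ℝ (V x)]
  [FiberBundle F V] [VectorBundle ℂ F V] [VectorBundle ℝ F V]
  [ContMDiffVectorBundle ∞ F V 𝓘(ℝ, E)]
  {nabla : ComplexConnection E F V} {X : Π x : M, TangentSpace 𝓘(ℝ, E) x}
  {A : SmoothEndomorphismField E F V}

/-- An eigensection on a backward invariant neighbourhood of the source extends to the whole
star-shaped neighbourhood. -/
theorem IsEigensectionOn.exists_extension_of_isStarShapedAround {p : M}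
    {U : TopologicalSpace.Opens M} (hU : IsStarShapedAround X p U)
    (hX : ContMDiff 𝓘(ℝ, E) 𝓘(ℝ, E).tangent ∞ (fun x ↦ (⟨x, X x⟩ : TangentBundle 𝓘(ℝ, E) M)))
    {W₀ : Set M} (hWo : IsOpen W₀) (hp : p ∈ W₀) (hWU : W₀ ⊆ U) (hW : IsBackwardInvariant X W₀)
    {lam : ℂ} {s₀ : Π x : M, V x} (hs : IsEigensectionOn nabla X A lam s₀ W₀) :
    ∃ s : Π x : M, V x, IsEigensectionOn nabla X A lam s U ∧ ∀ᶠ x in 𝓝 p, s x = s₀ x := by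
  classical
  -- Two good extensions agree on their overlap: their difference is an eigensection on a backward
  -- invariant set and vanishes near `p`. So the union of all good sets carries a largest extension,
  -- and no choice of a maximal chain is needed.
  let good : Set M → (Π x : M, V x) → Prop := fun W s ↦ IsOpen W ∧ W ⊆ U ∧
    IsBackwardInvariant X W ∧ IsEigensectionOn nabla X A lam s W ∧ ∀ᶠ x in 𝓝 p, s x = s₀ x
  have hagree : ∀ W s W' s', good W s → good W' s' → ∀ x ∈ W ∩ W', s x = s' x := by
    rintro W s W' s' ⟨-, h2, h3, h4, h5⟩ ⟨-, -, h3', h4', h5'⟩ x hx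
    have h := ((h4.mono inter_subset_left).sub
      (h4'.mono inter_subset_right)).eq_zero_of_eventually_eq_zero hU hX
      (inter_subset_left.trans h2) (h3.inter h3') (by
        filter_upwards [h5, h5'] with y hy hy'
        rw [Pi.sub_apply, hy, hy', sub_self]) hx
    rwa [Pi.sub_apply, sub_eq_zero] at h
  let W : Set M := {x | ∃ W s, good W s ∧ x ∈ W}
  let s : Π x : M, V x := fun x ↦ if h : ∃ W s, good W s ∧ x ∈ W then h.choose_spec.choose x else 0
  have hgs : ∀ W' s', good W' s' → ∀ x ∈ W', s x = s' x := by
    intro W' s' h x hx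
    have hex : ∃ W s, good W s ∧ x ∈ W := ⟨W', s', h, hx⟩
    have h1 : s x = hex.choose_spec.choose x := dif_pos hex
    rw [h1]
    exact hagree _ _ _ _ hex.choose_spec.choose_spec.1 h x ⟨hex.choose_spec.choose_spec.2, hx⟩
  have hsub : ∀ W' s', good W' s' → W' ⊆ W := fun W' s' h x hx ↦ ⟨W', s', h, hx⟩
  have hgood0 : good W₀ s₀ := ⟨hWo, hWU, hW, hs, Eventually.of_forall fun _ ↦ rfl⟩
  have hgood : good W s := by
    refine ⟨?_, ?_, ?_, ?_, ?_⟩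
    · rw [isOpen_iff_mem_nhds]
      rintro x ⟨W', s', h, hx⟩
      exact mem_of_superset (h.1.mem_nhds hx) (hsub W' s' h)
    · rintro x ⟨W', s', h, hx⟩
      exact h.2.1 hx
    · rintro γ a b hab hγ ⟨W', s', h, hx⟩
      exact ⟨W', s', h, h.2.2.1 γ a b hab hγ hx⟩
    · rintro x ⟨W', s', h, hx⟩
      exact h.2.2.2.1.congr h.1 (hgs W' s' h) x hx
    · filter_upwards [hWo.mem_nhds hp] with x hx
      exact hgs W₀ s₀ hgood0 x hx
  have hback := hgood.2.2.1
  suffices hUW : (U : Set M) ⊆ W from ⟨s, hgood.2.2.2.1.mono hUW, hgood.2.2.2.2⟩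
  intro q hq
  by_contra hqW
  obtain ⟨γ, rfl, hγ, hγU, hlim⟩ := hU.flow q hq
  let S : Set ℝ := {t | t ≤ 0 ∧ γ t ∈ W}
  obtain ⟨T, hTW, hT0⟩ := ((hlim.eventually (hgood.1.mem_nhds (hsub _ _ hgood0 hp))).and
    (eventually_le_atBot 0)).exists
  have hSne : S.Nonempty := ⟨T, hT0, hTW⟩
  have hSb : BddAbove S := ⟨0, fun t ht ↦ ht.1⟩
  -- The last time up to which the flow line to `q` lies in `W`. As `W` is open and misses `q`, the
  -- point `γ t₀` is outside `W`; yet the local extension lemma puts it in a good set, a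
  -- contradiction.
  set t₀ := sSup S with ht₀
  have ht₀0 : t₀ ≤ 0 := csSup_le hSne fun t ht ↦ ht.1
  have hlt : ∀ t < t₀, γ t ∈ W := by
    intro t ht
    obtain ⟨t', ht', htt'⟩ := exists_lt_of_lt_csSup hSne ht
    exact hback γ t t' htt'.le (hγ.mono fun r hr ↦ hr.2.trans ht'.1) ht'.2
  have hnot : γ t₀ ∉ W := by
    intro h
    rcases ht₀0.eq_or_lt with h0 | h0
    · rw [h0] at h
      exact hqW h
    · have h1 : ContinuousAt γ t₀ := (hγ t₀ ht₀0).1.continuousAt (Iic_mem_nhds h0)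
      obtain ⟨ε, hε, hball⟩ := Metric.mem_nhds_iff.1 (h1.preimage_mem_nhds (hgood.1.mem_nhds h))
      have hm : min (t₀ + ε / 2) 0 ∈ S := by
        refine ⟨min_le_right _ _, hball ?_⟩
        rw [Metric.mem_ball, Real.dist_eq, abs_lt]
        constructor
        · rw [lt_sub_iff_add_lt]
          exact lt_min (by linarith) (by linarith)
        · rw [sub_lt_iff_lt_add]
          exact (min_le_left _ _).trans_lt (by linarith)
      have h2 := le_csSup hSb hm
      exact absurd h2 (not_le.2 (lt_min (by linarith) h0))
  obtain ⟨W', s', hW'o, hWW', hW'U, hmem, hW'b, hs', hss'⟩ :=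
    hgood.2.2.2.1.exists_extension hX U.isOpen hgood.1 hback (sub_one_lt t₀)
      (hγ.mono fun r hr ↦ hr.2.trans ht₀0) (fun t ht ↦ hlt t ht.2) (hγU t₀ ht₀0)
  refine hnot (hsub W' s' ⟨hW'o, hW'U.trans (union_subset hgood.2.1 subset_rfl), hW'b, hs', ?_⟩ hmem)
  filter_upwards [hgood.2.2.2.2, hgood.1.mem_nhds (hsub _ _ hgood0 hp)] with x hx hxW
  rw [hss' x hxW, hx]

/-- Small sublevel sets of a Lyapunov function near the source are backward invariant. -/
theorem LocalModel.isBackwardInvariant {ι : Type*} [Fintype ι] {p : M} (m : LocalModel nabla X A p)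
    (S : SourceRegion ι m.field) {R : ℝ} (hR : R ≤ S.r)
    (htarget : ∀ z, ‖S.W z‖ < R → z ∈ m.chart.target) :
    IsBackwardInvariant X (m.chart.source ∩ m.chart ⁻¹' (S.W ⁻¹' Metric.ball 0 R)) := by
  intro γ a b hab hγ hb
  have hbR : ‖S.W (m.chart (γ b))‖ < R := by simpa using hb.2
  set ρ := ‖S.W (m.chart (γ b))‖ with hρ
  -- `K` is compact, so its image is closed in the Hausdorff space `M`. The times at which γ lies in
  -- the image thus form a closed set, and from each of them one can move further back, since the
  -- Lyapunov function does not increase backwards. This set reaches `a`.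
  let K : Set E := {z | ‖S.W z‖ ≤ ρ}
  have hKc : IsCompact K := by
    refine Metric.isCompact_of_isClosed_isBounded
      (isClosed_le (S.W.continuous.norm) continuous_const) ?_
    refine (Metric.isBounded_closedBall (x := (0 : E)) (r := S.K * ρ)).subset fun z hz ↦ ?_
    rw [mem_closedBall_zero_iff]
    exact (S.norm_le z).trans (mul_le_mul_of_nonneg_left hz S.K_pos.le)
  have hKt : K ⊆ m.chart.target := fun z hz ↦ htarget z (lt_of_le_of_lt hz hbR)
  have hKM : IsClosed (m.chart.symm '' K) :=
    (hKc.image_of_continuousOn (m.chart.continuousOn_symm.mono hKt)).isClosed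
  have hKmem : ∀ x, x ∈ m.chart.symm '' K ↔ x ∈ m.chart.source ∧ ‖S.W (m.chart x)‖ ≤ ρ := by
    intro x
    constructor
    · rintro ⟨z, hz, rfl⟩
      refine ⟨m.chart.map_target (hKt hz), ?_⟩
      rw [m.chart.right_inv (hKt hz)]
      exact hz
    · rintro ⟨h1, h2⟩
      exact ⟨m.chart x, h2, m.chart.left_inv h1⟩
  let O : Set M := m.chart.source ∩ m.chart ⁻¹' (S.W ⁻¹' Metric.ball 0 R)
  have hO : IsOpen O := m.chart.isOpen_inter_preimage (Metric.isOpen_ball.preimage S.W.continuous)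
  have hKO : ∀ x ∈ m.chart.symm '' K, x ∈ O := fun x hx ↦ by
    obtain ⟨h1, h2⟩ := (hKmem x).1 hx
    exact ⟨h1, by simpa using h2.trans_lt hbR⟩
  refine hKO _ (IsClosed.mem_of_ge_of_forall_exists_lt (s := γ ⁻¹' (m.chart.symm '' K)) ?_
    ((hKmem _).2 ⟨hb.1, le_rfl⟩) hab fun x hx ↦ ?_)
  · rw [inter_comm]
    exact hγ.continuousOn.preimage_isClosed_of_isClosed isClosed_Icc hKM
  · have hxab : x ∈ Icc a b := ⟨hx.2.1.le, hx.2.2⟩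
    have h1 := eventually_uIcc_subset hxab ((hγ x hxab).1 (hO.mem_nhds (hKO _ hx.1)))
    have h2 : Ico a x ∈ 𝓝[<] x := Ico_mem_nhdsLT hx.2.1
    have h3 : 𝓝[<] x ≤ 𝓝[Icc a b] x := nhdsWithin_le_of_mem
      (mem_of_superset h2 fun y hy ↦ ⟨hy.1, hy.2.le.trans hx.2.2⟩)
    obtain ⟨y, hy, hyx⟩ := ((h1.filter_mono h3).and h2).exists
    rw [uIcc_of_ge hyx.2.le] at hy
    refine ⟨y, (hKmem _).2 ⟨(hy (left_mem_Icc.2 hyx.2.le)).1.1, ?_⟩, hyx⟩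
    have h4 := S.norm_le_exp_mul (γ := fun t ↦ m.chart (γ t)) hyx.2.le
      (fun t ht ↦ m.hasDerivWithinAt_chart (hy ht).1.1
        ((hγ t (hy ht).2).mono fun r hr ↦ (hy hr).2))
      (fun t ht ↦ lt_of_lt_of_le (by simpa using (hy ht).1.2) hR)
    refine h4.trans ((mul_le_of_le_one_left (norm_nonneg _) ?_).trans ((hKmem _).1 hx.1).2)
    rw [Real.exp_le_one_iff]
    nlinarith [S.c_pos, hyx.2]

end Globalization

/-! ### Identification of the eigenvalues in coordinates -/

section SourceModel

set_option linter.unusedSectionVars false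

variable {E : Type*} [NormedAddCommGroup E] [NormedSpace ℝ E] [FiniteDimensional ℝ E]
  {M : Type*} [TopologicalSpace M] [T2Space M] [ChartedSpace E M] [IsManifold 𝓘(ℝ, E) ∞ M]
  {F : Type*} [NormedAddCommGroup F] [NormedSpace ℂ F] [FiniteDimensional ℂ F]
  {V : M → Type*} [TopologicalSpace (TotalSpace F V)]
  [∀ x, AddCommGroup (V x)] [∀ x, Module ℂ (V x)] [∀ x, TopologicalSpace (V x)]
  [∀ x, IsTopologicalAddGroup (V x)] [∀ x, ContinuousSMul ℝ (V x)]
  [FiberBundle F V] [VectorBundle ℂ F V] [VectorBundle ℝ F V]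
  [ContMDiffVectorBundle ∞ F V 𝓘(ℝ, E)]
  {nabla : ComplexConnection E F V} {X : Π x : M, TangentSpace 𝓘(ℝ, E) x}
  {A : SmoothEndomorphismField E F V}

namespace LocalModel

variable {p : M} (m : LocalModel nabla X A p)

theorem trivialization_zero {y : M}
    (hy : y ∈ (trivializationAt E (TangentSpace 𝓘(ℝ, E) : M → Type _) p).baseSet) :
    (trivializationAt E (TangentSpace 𝓘(ℝ, E) : M → Type _) p ⟨y, 0⟩).2 = 0 := by
  have h := ((trivializationAt E (TangentSpace 𝓘(ℝ, E) : M → Type _) p).linearMapAt ℝ y).map_zero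
  rwa [(trivializationAt E (TangentSpace 𝓘(ℝ, E) : M → Type _) p).coe_linearMapAt_of_mem hy] at h

theorem field_zero (hXp : X p = 0) : m.field 0 = 0 := by
  have h := m.field_eq p m.mem_source
  rw [m.apply_self, hXp] at h
  exact h.trans (trivialization_zero (mem_baseSet_trivializationAt E _ p))

/-- The linearization of `X` at a zero in coordinates. -/
theorem charpoly_fderiv_field
    (nablaT : CovariantDerivative 𝓘(ℝ, E) E (TangentSpace 𝓘(ℝ, E) : M → Type _))
    (hX : ContMDiff 𝓘(ℝ, E) 𝓘(ℝ, E).tangent ∞ (fun x ↦ (⟨x, X x⟩ : TangentBundle 𝓘(ℝ, E) M)))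
    (hXp : X p = 0) :
    LinearMap.charpoly (fderiv ℝ m.field 0).toLinearMap =
      LinearMap.charpoly (linearizationAt nablaT X p).toLinearMap := by
  let e := trivializationAt E (TangentSpace 𝓘(ℝ, E) : M → Type _) p
  have hp : p ∈ e.baseSet := mem_baseSet_trivializationAt E _ p
  let L := e.linearEquivAt ℝ p hp
  have hL : ∀ v, L v = (e ⟨p, v⟩).2 := fun v ↦ rfl
  have key : ∀ v : TangentSpace 𝓘(ℝ, E) p,
      L (linearizationAt nablaT X p v) = fderiv ℝ m.field 0 (L v) := by
    intro v
    have hd : MDifferentiableAt 𝓘(ℝ, E) (𝓘(ℝ, E).prod 𝓘(ℝ, E))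
        (fun y ↦ TotalSpace.mk' E y (X y)) p := (hX p).mdifferentiableAt (by simp)
    have h1 := nablaT.isCovariantDerivativeOnUniv.apply_trivialization (Module.finBasis ℝ E) e hp
      hd v
    -- The connection enters through a term linear in `X p = 0`; only the derivative of the
    -- coordinate expression remains, whatever the connection.
    have h0 : (e ⟨p, X p⟩).2 = 0 := by
      rw [hXp]
      exact trivialization_zero hp
    rw [h0, e.coe_linearMapAt_of_mem hp] at h1
    simp only [map_zero, Finsupp.coe_zero, Pi.zero_apply, zero_smul, Finset.sum_const_zero,
      add_zero] at h1
    have hloc : MDifferentiableAt 𝓘(ℝ, E) 𝓘(ℝ, E) (fun z ↦ (e ⟨z, X z⟩).2) p :=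
      ((e.contMDiffAt_section_iff (IB := 𝓘(ℝ, E)) (n := ∞) (s := X) hp).1
        (hX p)).mdifferentiableAt (by simp)
    rw [m.mvfderiv_apply m.mem_source hloc v, m.apply_self] at h1
    have h2 : (fun z ↦ (e ⟨m.chart.symm z, X (m.chart.symm z)⟩).2) =ᶠ[𝓝 0] m.field := by
      filter_upwards [m.chart.open_target.mem_nhds m.toCenteredChart.zero_mem_target] with z hz
      rw [← m.field_eq _ (m.chart.map_target hz), m.chart.right_inv hz]
    rw [h2.fderiv_eq] at h1
    exact h1
  have hconj : L.conj (linearizationAt nablaT X p).toLinearMap =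
      (fderiv ℝ m.field 0).toLinearMap := by
    ext v
    rw [LinearEquiv.conj_apply_apply]
    refine (key (L.symm v)).trans ?_
    rw [L.apply_symm_apply]
    rfl
  rw [← hconj, LinearEquiv.charpoly_conj]

/-- The zeroth order term at a zero of `X` in coordinates. -/
theorem charpoly_coeff_zero (hXp : X p = 0) :
    LinearMap.charpoly (m.coeff.1 0) =
      haveI := moduleFinite_fiber F (V := V) p
      LinearMap.charpoly (A.toFun p).toLinearMap := by
  have := moduleFinite_fiber F (V := V) p
  let e := trivializationAt F V p
  have hp : p ∈ e.baseSet := mem_baseSet_trivializationAt F V p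
  let L := e.linearEquivAt ℂ p hp
  have hconj : L.conj (A.toFun p).toLinearMap = m.coeff.1 0 := by
    ext f
    have h1 := congrArg (fun g : F →ₗ[ℂ] F ↦ g f) (m.coeff_eq p m.mem_source)
    rw [m.apply_self] at h1
    refine Eq.trans ?_ h1.symm
    change (e ⟨p, A.toFun p (L.symm f)⟩).2 =
      (e ⟨p, transportAt nabla X A (constSection e f) p⟩).2
    have h2 : constSection e f p = L.symm f := e.symmₗ_apply hp f
    rw [transportAt, hXp, map_zero, zero_add, h2]
  rw [← hconj, LinearEquiv.charpoly_conj]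

end LocalModel

end SourceModel

/-! ### Injectivity of the resonant jet and existence of eigensections -/

section Eigenspace

set_option linter.unusedSectionVars false

variable {E : Type*} [NormedAddCommGroup E] [NormedSpace ℝ E] [FiniteDimensional ℝ E]
  {M : Type*} [TopologicalSpace M] [T2Space M] [ChartedSpace E M] [IsManifold 𝓘(ℝ, E) ∞ M]
  {F : Type*} [NormedAddCommGroup F] [NormedSpace ℂ F] [FiniteDimensional ℂ F]
  {V : M → Type*} [TopologicalSpace (TotalSpace F V)]
  [∀ x, AddCommGroup (V x)] [∀ x, Module ℂ (V x)] [∀ x, TopologicalSpace (V x)]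
  [∀ x, IsTopologicalAddGroup (V x)] [∀ x, ContinuousSMul ℝ (V x)]
  [FiberBundle F V] [VectorBundle ℂ F V] [VectorBundle ℝ F V]
  [ContMDiffVectorBundle ∞ F V 𝓘(ℝ, E)]
  {nabla : ComplexConnection E F V} {X : Π x : M, TangentSpace 𝓘(ℝ, E) x}
  {A : SmoothEndomorphismField E F V}
  {ι κ : Type*} [Fintype ι] [DecidableEq ι] [Fintype κ] [DecidableEq κ]

theorem mem_eigenspace_transportOperator_iff
    (hX : ContMDiff 𝓘(ℝ, E) 𝓘(ℝ, E).tangent ∞ (fun x ↦ (⟨x, X x⟩ : TangentBundle 𝓘(ℝ, E) M)))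
    {U : TopologicalSpace.Opens M} {lam : ℂ} (s : smoothSections E F V U) :
    s ∈ (transportOperator nabla X hX A U).eigenspace lam ↔
      IsEigensectionOn nabla X A lam (extendByZero s.1) U := by
  rw [Module.End.mem_eigenspace_iff]
  have h1 : ∀ x : U, transportAt nabla X A (extendByZero s.1) x =
      (transportOperator nabla X hX A U s).1 x := fun x ↦ by
    change _ = nabla.toFun (extendByZero s.1) x (X x) + A.toFun x (s.1 x)
    rw [transportAt, extendByZero_apply]
  constructor
  · intro h x hx
    refine ⟨(s.2 x hx).contMDiffAt (U.isOpen.mem_nhds hx), ?_⟩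
    rw [h1 ⟨x, hx⟩, h, extendByZero_apply s.1 ⟨x, hx⟩]
    rfl
  · intro h
    ext x
    rw [← h1 x, (h x x.2).2, extendByZero_apply]
    rfl

/-- An eigensection whose resonant jet coordinates at the source vanish is zero. -/
theorem LocalModel.eq_zero_of_jetCoord_eq_zero {p : M} (m : LocalModel nabla X A p)
    {U : TopologicalSpace.Opens M} (hU : IsStarShapedAround X p U)
    (hX : ContMDiff 𝓘(ℝ, E) 𝓘(ℝ, E).tangent ∞ (fun x ↦ (⟨x, X x⟩ : TangentBundle 𝓘(ℝ, E) M)))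
    (hXp : X p = 0) {μ : ι → ℂ} (fr : FlagFrame (fderiv ℝ m.field 0) μ) {ρ : κ → ℂ}
    (ff : FiberFlag (m.coeff.1 0) ρ) (S : SourceRegion ι m.field) {lam : ℂ} {s : Π x : M, V x}
    (hs : IsEigensectionOn nabla X A lam s U) {u : smoothFunctions E F}
    (hu : (u : E → F) =ᶠ[𝓝 0] m.loc s)
    (hjet : ∀ i : Multiset ι × κ, (i.1.map μ).sum + ρ i.2 = lam →
      jetCoord fr.vec ff.coord i u = 0) {q : M} (hq : q ∈ U) : s q = 0 := by
  have hsymm0 : m.chart.symm 0 = p := by rw [← m.apply_self, m.chart.left_inv m.mem_source]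
  have hnear : ∀ᶠ z in 𝓝 (0 : E), z ∈ m.chart.target ∧ m.chart.symm z ∈ U :=
    (m.chart.symm.isOpen_inter_preimage U.isOpen).mem_nhds
      ⟨m.toCenteredChart.zero_mem_target, by
        rw [mem_preimage, hsymm0]
        exact hU.mem⟩
  -- `u` has the same germ at 0 as the coordinate expression of `s`, so it solves the equation near
  -- 0, hence at the level of all jets at 0.
  have hop : (fieldOp m.field m.contDiff_field m.coeff u : E → F) =ᶠ[𝓝 0]
      ((lam • u : smoothFunctions E F) : E → F) := by
    filter_upwards [hnear, eventually_eventually_nhds.2 hu] with z hz hzu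
    have hsrc := m.chart.map_target hz.1
    have h1 := (m.transportAt_eq_smul_iff hsrc (hs _ hz.2).1 lam).1 (hs _ hz.2).2
    rw [m.chart.right_inv hz.1, SmoothEnd.coefficient_apply, eq_sub_iff_add_eq] at h1
    rw [fieldOp_apply, Filter.EventuallyEq.fderiv_eq hzu, hzu.self_of_nhds, h1]
    change _ = lam • (u : E → F) z
    rw [hzu.self_of_nhds]
  obtain ⟨mono, htri⟩ := exists_isTriangular_fieldOp m.contDiff_field (m.field_zero hXp) m.coeff
    fr ff
  have hzero : ∀ N (i : Multiset ι × κ), i.1.card ≤ N → jetCoord fr.vec ff.coord i u = 0 := by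
    intro N
    refine htri.eq_zero (lam := lam) (fun i _ ↦ ?_) fun i _ ↦ hjet i
    rw [← smul_eq_mul, ← map_smul, jetCoord_apply, jetCoord_apply,
      (iterDeriv_congr fr.vec hop i.1).self_of_nhds]
  let a := m.coeff.coefficient lam
  have ha : ContDiff ℝ ∞ a := SmoothEnd.contDiff_coefficient _ _
  -- Near 0 the coefficient `a` has norm at most `‖a 0‖ + 1`; `N` makes the contraction rate `S.c *
  -- N` exceed this growth rate.
  obtain ⟨N, hN⟩ := exists_nat_gt ((‖a 0‖ + 1) / S.c)
  rw [div_lt_iff₀' S.c_pos] at hN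
  obtain ⟨D, hD0, hD⟩ := (isBigO_of_jetCoord_eq_zero fr ff (hzero N)).exists_nonneg
  have hall : ∀ᶠ z in 𝓝 (0 : E), ‖S.W z‖ < S.r ∧ ‖a z‖ ≤ ‖a 0‖ + 1 ∧
      ‖m.loc s z‖ ≤ D * ‖z‖ ^ (N + 1) := by
    have h1 : ∀ᶠ z in 𝓝 (0 : E), ‖S.W z‖ < S.r :=
      S.W.continuous.norm.continuousAt.eventually_lt continuousAt_const (by simpa using S.r_pos)
    have h2 : ∀ᶠ z in 𝓝 (0 : E), ‖a z‖ < ‖a 0‖ + 1 :=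
      ha.continuous.norm.continuousAt.eventually_lt continuousAt_const (lt_add_one _)
    filter_upwards [h1, h2, hD.bound, hu] with z hz1 hz2 hz3 hz4
    rw [hz4] at hz3
    exact ⟨hz1, hz2.le, by simpa using hz3⟩
  obtain ⟨γ, rfl, hγ, hγU, hlim⟩ := hU.flow q hq
  have hchart : Tendsto (fun t ↦ m.chart (γ t)) atBot (𝓝 0) := by
    have h1 := (m.chart.continuousAt m.mem_source).tendsto
    rw [m.apply_self] at h1
    exact h1.comp hlim
  obtain ⟨T₁, hT₁⟩ := eventually_atBot.1 ((hchart.eventually hall).and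
    (hlim.eventually (m.chart.open_source.mem_nhds m.mem_source)))
  let T := min T₁ 0
  have hT0 : T ≤ 0 := min_le_right _ _
  have hT : ∀ t ≤ T, (‖S.W (m.chart (γ t))‖ < S.r ∧ ‖a (m.chart (γ t))‖ ≤ ‖a 0‖ + 1 ∧
      ‖m.loc s (m.chart (γ t))‖ ≤ D * ‖m.chart (γ t)‖ ^ (N + 1)) ∧ γ t ∈ m.chart.source :=
    fun t ht ↦ hT₁ t (ht.trans (min_le_left _ _))
  have hd : ∀ t ≤ T, HasMFDerivWithinAt 𝓘(ℝ, ℝ) 𝓘(ℝ, E) γ (Iic T) t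
      ((1 : ℝ →L[ℝ] ℝ).smulRight (X (γ t))) := fun t ht ↦
    (hγ t (ht.trans hT0)).mono (Iic_subset_Iic.2 hT0)
  have hdec := S.eq_zero_of_decay (a := a) (c := fun t ↦ m.chart (γ t))
    (y := fun t ↦ m.loc s (m.chart (γ t))) (T := T) (Ka := ‖a 0‖ + 1) (N := N + 1) hD0
    (fun t ht ↦ m.hasDerivWithinAt_chart (hT t ht).2 (hd t ht))
    (fun t ht ↦ m.hasDerivWithinAt_loc (hT t ht).2 (hd t ht) (hs _ (hγU t (ht.trans hT0))).1
      (hs _ (hγU t (ht.trans hT0))).2)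
    (fun t ht ↦ (hT t ht).1.1) (fun t ht ↦ (hT t ht).1.2.1) (fun t ht ↦ (hT t ht).1.2.2)
    (hN.trans_le (mul_le_mul_of_nonneg_left (by push_cast; linarith) S.c_pos.le))
  exact hs.eq_zero_of_isMIntegralCurveOn hX (left_mem_Icc.2 hT0) (right_mem_Icc.2 hT0)
    (hγ.mono Icc_subset_Iic_self) (fun t ht ↦ hγU t ht.2)
    ((m.loc_chart_eq_zero_iff s (hT T le_rfl).2).1 hdec)

/-- The germ at the source of the coordinate expression of a smooth section, as a linear map. -/
theorem LocalModel.exists_germ {p : M} (m : LocalModel nabla X A p)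
    {U : TopologicalSpace.Opens M} (hp : p ∈ U) :
    ∃ Ψ : smoothSections E F V U →ₗ[ℂ] smoothFunctions E F,
      ∀ s, (Ψ s : E → F) =ᶠ[𝓝 0] m.loc (extendByZero s.1) := by
  let e := trivializationAt F V p
  have hsymm0 : m.chart.symm 0 = p := by rw [← m.apply_self, m.chart.left_inv m.mem_source]
  obtain ⟨r, hr, hball⟩ := Metric.isOpen_iff.1 (m.chart.symm.isOpen_inter_preimage U.isOpen) 0
    ⟨m.toCenteredChart.zero_mem_target, by
      rw [mem_preimage, hsymm0]
      exact hp⟩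
  obtain ⟨χ, hχ, hχ1, hχF⟩ := exists_smooth_cutoff F (0 : E) hr
  -- `linearMapAt` is linear at every point, even outside the base set; this makes the germ map
  -- linear without restricting `z`.
  let g : (Π x : U, V x) → E → F := fun s z ↦
    e.linearMapAt ℂ (m.chart.symm z) (extendByZero s (m.chart.symm z))
  have hg : ∀ s, ∀ z ∈ m.chart.target, g s z = m.loc (extendByZero s) z := fun s z hz ↦ by
    simp only [g, LocalModel.loc]
    rw [e.coe_linearMapAt_of_mem (m.source_subset' (m.chart.map_target hz))]
  have hsm : ∀ s : smoothSections E F V U, ContDiffOn ℝ ∞ (g s.1) (Metric.ball 0 r) := by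
    intro s z hz
    have hz' := hball hz
    have h1 := m.contDiffAt_loc (m.chart.map_target hz'.1)
      (s := extendByZero s.1) ((s.2 _ hz'.2).contMDiffAt (U.isOpen.mem_nhds hz'.2))
    rw [m.chart.right_inv hz'.1] at h1
    exact h1.contDiffWithinAt.congr (fun w hw ↦ hg s.1 w (hball hw).1) (hg s.1 z hz'.1)
  refine ⟨{ toFun := fun s ↦ ⟨fun z ↦ χ z • g s.1 z, hχF _ (hsm s)⟩
            map_add' := fun s t ↦ ?_
            map_smul' := fun c s ↦ ?_ }, fun s ↦ ?_⟩
  · ext z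
    simp only [g, Submodule.coe_add, extendByZero_add, Pi.add_apply, map_add, smul_add]
  · ext z
    simp only [g, Submodule.coe_smul, extendByZero_smul, Pi.smul_apply, map_smul, RingHom.id_apply]
    exact smul_comm _ _ _
  · filter_upwards [Metric.ball_mem_nhds (0 : E) (half_pos hr)] with z hz
    have h1 : z ∈ Metric.ball (0 : E) r := Metric.ball_subset_ball (by linarith) hz
    change χ z • g s.1 z = _
    rw [hχ1 z hz, one_smul, hg s.1 z (hball h1).1]

/-- Existence of eigensections for resonant values. -/
theorem LocalModel.exists_eigensection {p : M} (m : LocalModel nabla X A p)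
    {U : TopologicalSpace.Opens M} (hU : IsStarShapedAround X p U)
    (hX : ContMDiff 𝓘(ℝ, E) 𝓘(ℝ, E).tangent ∞ (fun x ↦ (⟨x, X x⟩ : TangentBundle 𝓘(ℝ, E) M)))
    (hXp : X p = 0) {μ : ι → ℂ} (fr : FlagFrame (fderiv ℝ m.field 0) μ) {ρ : κ → ℂ}
    (ff : FiberFlag (m.coeff.1 0) ρ) (hμ : ∀ i, 0 < (μ i).re) (S : SourceRegion ι m.field)
    {lam : ℂ} (hlam : ∃ i : Multiset ι × κ, (i.1.map μ).sum + ρ i.2 = lam) :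
    ∃ s : Π x : M, V x, IsEigensectionOn nabla X A lam s U ∧ ∃ x ∈ U, s x ≠ 0 := by
  obtain ⟨R, hR, hRS, v, hv, hpde, hv0⟩ := exists_local_eigenfunction m.contDiff_field
    (m.field_zero hXp) m.coeff fr ff hμ S hlam
  have hsymm0 : m.chart.symm 0 = p := by rw [← m.apply_self, m.chart.left_inv m.mem_source]
  obtain ⟨r, hr, hball⟩ := Metric.isOpen_iff.1 (m.chart.symm.isOpen_inter_preimage U.isOpen) 0
    ⟨m.toCenteredChart.zero_mem_target, by
      rw [mem_preimage, hsymm0]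
      exact hU.mem⟩
  -- By `S.norm_le`, the bound `r / S.K` confines the Lyapunov ball to the part of the chart lying
  -- over `U`.
  let R' := min R (r / S.K)
  have hR' : 0 < R' := lt_min hR (div_pos hr S.K_pos)
  have hsmall : ∀ z, ‖S.W z‖ < R' → z ∈ m.chart.target ∧ m.chart.symm z ∈ U := fun z hz ↦ by
    refine hball (mem_ball_zero_iff.2 ((S.norm_le z).trans_lt ?_))
    have := hz.trans_le (min_le_right R (r / S.K))
    rwa [lt_div_iff₀' S.K_pos] at this
  let W : Set M := m.chart.source ∩ m.chart ⁻¹' (S.W ⁻¹' Metric.ball 0 R')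
  have hballO : IsOpen (S.W ⁻¹' Metric.ball 0 R') := Metric.isOpen_ball.preimage S.W.continuous
  have hW : IsOpen W := m.chart.isOpen_inter_preimage hballO
  have hpW : p ∈ W := ⟨m.mem_source, by
    rw [mem_preimage, m.apply_self, mem_preimage, map_zero]
    exact Metric.mem_ball_self hR'⟩
  have hWU : W ⊆ U := fun x hx ↦ by
    have h1 := (hsmall (m.chart x) (by simpa using hx.2)).2
    rwa [m.chart.left_inv hx.1] at h1
  have hback : IsBackwardInvariant X W := m.isBackwardInvariant S ((min_le_left _ _).trans hRS)
    fun z hz ↦ (hsmall z hz).1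
  have hsub : S.W ⁻¹' Metric.ball 0 R' ⊆ S.W ⁻¹' Metric.ball 0 R :=
    preimage_mono (Metric.ball_subset_ball (min_le_left _ _))
  have heig : IsEigensectionOn nabla X A lam (m.sec v) W := by
    intro x hx
    have hvx : ContDiffAt ℝ ∞ v (m.chart x) := (hv.mono hsub).contDiffAt (hballO.mem_nhds hx.2)
    have h1 := m.smoothSectionAt_sec hx.1 hvx
    refine ⟨h1, (m.transportAt_eq_smul_iff hx.1 h1 lam).2 ?_⟩
    have h2 : m.loc (m.sec v) =ᶠ[𝓝 (m.chart x)] v := by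
      filter_upwards [m.chart.open_target.mem_nhds (m.chart.map_source hx.1)] with z hz
      exact m.loc_sec v hz
    rw [h2.fderiv_eq, h2.self_of_nhds, SmoothEnd.coefficient_apply, eq_sub_iff_add_eq]
    exact hpde _ (hsub hx.2)
  obtain ⟨s, hs, hsv⟩ := heig.exists_extension_of_isStarShapedAround hU hX hW hpW hWU hback
  refine ⟨s, hs, ?_⟩
  by_contra! hcon
  refine hv0 ?_
  have h1 : Tendsto m.chart.symm (𝓝 0) (𝓝 p) := by
    have := (m.chart.continuousAt_symm m.toCenteredChart.zero_mem_target).tendsto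
    rwa [hsymm0] at this
  filter_upwards [h1.eventually hsv, h1.eventually (U.isOpen.mem_nhds hU.mem),
    m.chart.open_target.mem_nhds m.toCenteredChart.zero_mem_target] with z hz1 hz2 hz3
  have h2 : m.sec v (m.chart.symm z) = 0 := hz1.symm.trans (hcon _ hz2)
  have h3 := (m.loc_chart_eq_zero_iff (m.sec v) (m.chart.map_target hz3)).2 h2
  rw [m.chart.right_inv hz3, m.loc_sec v hz3] at h3
  exact h3

end Eigenspace

/-! ### Multi-indices as multisets -/

section Representations

variable {n k : ℕ}

theorem sum_map_eq_sum_count (μ : Fin n → ℂ) (w : Multiset (Fin n)) :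
    (w.map μ).sum = ∑ i, (w.count i : ℂ) * μ i := by
  rw [Finset.sum_multiset_map_count]
  simp only [nsmul_eq_mul]
  refine Finset.sum_subset (Finset.subset_univ _) fun i _ hi ↦ ?_
  rw [Multiset.mem_toFinset] at hi
  simp [Multiset.count_eq_zero_of_notMem hi]

/-- Multi-indices as multisets. -/
def multiIndexEquiv (n : ℕ) : Multiset (Fin n) ≃ (Fin n → ℕ) :=
  Multiset.toFinsupp.toEquiv.trans Finsupp.equivFunOnFinite

theorem multiIndexEquiv_apply (w : Multiset (Fin n)) (i : Fin n) :
    multiIndexEquiv n w i = w.count i := rfl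

theorem representations_eq_image (μ : Fin n → ℂ) (ρ : Fin k → ℂ) (lam : ℂ) :
    representations μ ρ lam = (multiIndexEquiv n).prodCongr (Equiv.refl (Fin k)) ''
      {i : Multiset (Fin n) × Fin k | (i.1.map μ).sum + ρ i.2 = lam} := by
  ext r
  rw [Equiv.image_eq_preimage_symm, mem_preimage, representations, mem_ofPred_eq, mem_ofPred_eq,
    eq_comm, sum_map_eq_sum_count]
  have h : ∀ i, r.1 i = ((multiIndexEquiv n).symm r.1).count i := fun i ↦ by
    rw [← multiIndexEquiv_apply, Equiv.apply_symm_apply]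
  simp only [h]
  rfl

end Representations

end

/-! ### The eigenvalue theorem -/

theorem mainTheorem2
    {E : Type*} [NormedAddCommGroup E] [NormedSpace ℝ E] [FiniteDimensional ℝ E]
    {M : Type*} [TopologicalSpace M] [T2Space M] [SigmaCompactSpace M]
    [ChartedSpace E M] [IsManifold 𝓘(ℝ, E) ∞ M]
    {F : Type*} [NormedAddCommGroup F] [NormedSpace ℂ F] [FiniteDimensional ℂ F]
    {V : M → Type*} [TopologicalSpace (TotalSpace F V)]
    [∀ x, AddCommGroup (V x)] [∀ x, Module ℂ (V x)] [∀ x, TopologicalSpace (V x)]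
    [∀ x, IsTopologicalAddGroup (V x)] [∀ x, ContinuousSMul ℝ (V x)]
    [FiberBundle F V] [VectorBundle ℂ F V] [VectorBundle ℝ F V]
    [ContMDiffVectorBundle ∞ F V 𝓘(ℝ, E)]
    {n m : ℕ} (hn : Module.finrank ℝ E = n) (hm : Module.finrank ℂ F = m)
    (nablaT : CovariantDerivative 𝓘(ℝ, E) E (TangentSpace 𝓘(ℝ, E) : M → Type _))
    (X : Π x : M, TangentSpace 𝓘(ℝ, E) x)
    (hX : ContMDiff 𝓘(ℝ, E) 𝓘(ℝ, E).tangent ∞ (fun x ↦ (⟨x, X x⟩ : TangentBundle 𝓘(ℝ, E) M)))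
    (p : M) (hp : IsStrictlyPositiveSource nablaT X p)
    (U : TopologicalSpace.Opens M) (hU : IsStarShapedAround X p U)
    (nabla : ComplexConnection E F V) (A : SmoothEndomorphismField E F V)
    (μ : Fin n → ℂ) (hμ : Finset.univ.val.map μ = linearizationEigenvalues nablaT X p)
    (ρ : Fin m → ℂ) (hρ : Finset.univ.val.map ρ = fiberEigenvalues F (A.toFun p))
    (lam : ℂ) :
    ((transportOperator nabla X hX A U).HasEigenvalue lam ↔
      ∃ (α : Fin n → ℕ) (j : Fin m), lam = ∑ i, (α i : ℂ) * μ i + ρ j) ∧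
    ((transportOperator nabla X hX A U).HasEigenvalue lam →
      (representations μ ρ lam).Finite ∧
      Module.Finite ℂ ((transportOperator nabla X hX A U).eigenspace lam) ∧
      1 ≤ Module.finrank ℂ ((transportOperator nabla X hX A U).eigenspace lam) ∧
      Module.finrank ℂ ((transportOperator nabla X hX A U).eigenspace lam) ≤
        (representations μ ρ lam).ncard) := by
  have hXp := hp.apply_eq_zero
  obtain ⟨m'⟩ := nonempty_localModel nabla hX A p
  have hμ' : Finset.univ.val.map μ =
      (LinearMap.charpoly (fderiv ℝ m'.field 0).toLinearMap).aroots ℂ := by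
    rw [hμ, linearizationEigenvalues, m'.charpoly_fderiv_field nablaT hX hXp]
  have hρ' : Finset.univ.val.map ρ = (LinearMap.charpoly (m'.coeff.1 0)).roots := by
    rw [hρ, fiberEigenvalues, m'.charpoly_coeff_zero hXp]
  obtain ⟨fr⟩ := nonempty_flagFrame (fderiv ℝ m'.field 0) hn hμ'
  obtain ⟨ff⟩ := nonempty_fiberFlag (m'.coeff.1 0) hm hρ'
  have hpos : ∀ i, 0 < (μ i).re := fun i ↦ hp.re_pos _ (by
    rw [← hμ]
    exact Multiset.mem_map_of_mem μ (Finset.mem_univ i))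
  obtain ⟨S⟩ := fr.nonempty_sourceRegion m'.contDiff_field (m'.field_zero hXp) hpos
  let R : Set (Multiset (Fin n) × Fin m) := {i | (i.1.map μ).sum + ρ i.2 = lam}
  have hRfin : R.Finite := finite_resonant hpos ρ lam
  have hrep := representations_eq_image μ ρ lam
  have hcard : (representations μ ρ lam).ncard = R.ncard := by
    rw [hrep]
    exact ncard_image_of_injective _ (Equiv.injective _)
  let T := transportOperator nabla X hX A U
  obtain ⟨Ψ, hΨ⟩ := m'.exists_germ hU.mem
  -- `J` reads off the resonant Taylor coefficients at `p`. Its injectivity yields both finite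
  -- dimension and the upper bound.
  let J : T.eigenspace lam →ₗ[ℂ] (R → ℂ) :=
    LinearMap.pi fun i ↦ jetCoord fr.vec ff.coord i.1 ∘ₗ Ψ ∘ₗ (T.eigenspace lam).subtype
  have hJ : Function.Injective J := by
    intro s t hst
    have hmem : s.1 - t.1 ∈ T.eigenspace lam := sub_mem s.2 t.2
    have h1 : ∀ x ∈ U, extendByZero (s.1 - t.1).1 x = 0 := fun x hx ↦
      m'.eq_zero_of_jetCoord_eq_zero hU hX hXp fr ff S
        ((mem_eigenspace_transportOperator_iff hX _).1 hmem) (hΨ _)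
        (fun i hi ↦ by
          rw [map_sub, map_sub, sub_eq_zero]
          exact congrFun hst ⟨i, hi⟩) hx
    refine Subtype.ext (Subtype.ext (funext fun x ↦ sub_eq_zero.1 ?_))
    have h2 := h1 x x.2
    rwa [extendByZero_apply] at h2
  have : Finite R := hRfin
  have : Fintype R := Fintype.ofFinite R
  have hfin : Module.Finite ℂ (T.eigenspace lam) := Module.Finite.of_injective J hJ
  have hle : Module.finrank ℂ (T.eigenspace lam) ≤ (representations μ ρ lam).ncard := by
    have h1 := LinearMap.finrank_le_finrank_of_injective hJ
    rwa [Module.finrank_fintype_fun_eq_card, ← Nat.card_eq_fintype_card, Nat.card_coe_set_eq,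
      ← hcard] at h1
  have hone : T.HasEigenvalue lam → 1 ≤ Module.finrank ℂ (T.eigenspace lam) := fun h ↦
    Nat.one_le_iff_ne_zero.2 fun h0 ↦ h (Submodule.finrank_eq_zero.1 h0)
  refine ⟨⟨fun h ↦ ?_, ?_⟩, fun h ↦ ⟨?_, hfin, hone h, hle⟩⟩
  -- The dimension bound already contains necessity: a nonzero eigenspace forces at least one
  -- representation.
  · obtain ⟨r, hr⟩ := nonempty_of_ncard_ne_zero (Nat.one_le_iff_ne_zero.1 ((hone h).trans hle))
    exact ⟨r.1, r.2, hr⟩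
  · rintro ⟨α, j, hαj⟩
    have hmem : (α, j) ∈ representations μ ρ lam := hαj
    rw [hrep] at hmem
    obtain ⟨i, hi, -⟩ := hmem
    obtain ⟨s, hs, x, hx, hsx⟩ := m'.exists_eigensection hU hX hXp fr ff hpos S ⟨i, hi⟩
    have h0 : ∀ y ∈ (U : Set M), extendByZero (fun y : U ↦ s y) y = s y := fun y hy ↦
      extendByZero_apply (fun y : U ↦ s y) ⟨y, hy⟩
    have hs' := hs.congr U.isOpen h0
    let s' : smoothSections E F V U := ⟨fun y ↦ s y, fun y hy ↦ (hs' y hy).1.contMDiffWithinAt⟩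
    refine Module.End.hasEigenvalue_of_hasEigenvector (x := s')
      ⟨(mem_eigenspace_transportOperator_iff hX s').2 hs', fun h ↦ hsx ?_⟩
    exact congrFun (congrArg Subtype.val h) ⟨x, hx⟩
  · rw [hrep]
    exact hRfin.image _
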